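/- Let $d\ge 3$, $0<b<2$, $0<\sigma\le\frac{4-2b}{d-2}$ and $c>-\left(\frac{d-2}{2}\right)^2$. For $f\in H^1(\mathbb R^d)$ write $$\|f\|_{\dot H^1_c}^2:=\int_{\mathbb R^d}\Big(|\nabla f|^2+c|x|^{-2}|f|^2\Big)\,dx ,$$ the quadratic form of $P_c=-\Delta+c|x|^{-2}$. Let $\theta:[0,\infty)\to[0,\infty)$ be a $C^4$ function with $\theta(r)=r^2$ for $0\le r\le 1$, $\theta$ constant on $[2,\infty)$ and $\theta''(r)\le 2$ for all $r\ge 0$; for $R>1$ set $\varphi_R(x)=R^2\theta(|x|/R)$. Let $I\subset\mathbb R$ be an interval with non-empty interior and let $u\in C(I,H^1(\mathbb R^d))$ be a radial solution of the focusing INLS$_c$ equation $$ i\,\partial_t u-P_c u=-|x|^{-b}|u|^{\sigma}u \quad\text{on } I\times\mathbb R^d ,$$ the equation being understood in $H^{-1}(\mathbb R^d)$ at each time $t\in I$ (time derivatives at endpoints of $I$ are one-sided). Put $V_{\varphi_R}(t)=\int_{\mathbb R^d}\varphi_R(x)|u(t,x)|^2\,dx$. Then $|x|^{-2}|u(t)|^2$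 and $|x|^{-b}|u(t)|^{\sigma+2}$ are integrable for every $t\in I$, $V_{\varphi_R}\in C^2(I)$ for every $R>1$, and for every $R>1$, every $\varepsilon>0$ and every $t\in I$, $$\frac{d^2}{dt^2}V_{\varphi_R}(t)\le 8\|u(t)\|_{\dot H^1_c}^2-\frac{4(d\sigma+2b)}{\sigma+2}\int_{\mathbb R^d}|x|^{-b}|u(t,x)|^{\sigma+2}\,dx+C\left(R^{-2}+\varepsilon^{-\frac{\sigma}{4-\sigma}}R^{-\frac{2[(d-1)\sigma+2b]}{4-\sigma}}+\varepsilon\|u(t)\|_{\dot H^1_c}^2\right),$$ where the constant $C>0$ depends only on $d,b,\sigma,c,\theta$ and an upper bound for the (conserved) mass $\int_{\mathbb R^d}|u|^2\,dx$ at some time of $I$; in particular $C$ is independent of $R$, $\varepsilon$, $t$ and $I$. -/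

import Mathlib

open MeasureTheory Set Filter Topology
open scoped ENNReal ContDiff ComplexConjugate

noncomputable section

namespace INLS

/-- The Euclidean space `ℝ^d`. -/
abbrev Space (d : ℕ) : Type := EuclideanSpace ℝ (Fin d)

/-- `g` is the gradient of `f` in the sense of distributions:
`∫ f ∂_j ψ = - ∫ g_j ψ` for all test functions `ψ` and all `j`. It is only used for
`f` and `g` in `L²`. -/
def IsWeakGradient {d : ℕ} (f : Space d → ℂ) (g : Space d → EuclideanSpace ℂ (Fin d)) : Prop :=
  ∀ ψ : Space d → ℝ, ContDiff ℝ ∞ ψ → HasCompactSupport ψ → ∀ j : Fin d,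
    ∫ x, f x * ((fderiv ℝ ψ x (EuclideanSpace.single j 1) : ℝ) : ℂ) = -∫ x, g x j * (ψ x : ℂ)

/-- `f ∈ H¹(ℝ^d)`: `f` is in `L²` and so is its distributional gradient. -/
def MemH1 {d : ℕ} (f : Space d → ℂ) : Prop :=
  MemLp f 2 volume ∧ ∃ g : Space d → EuclideanSpace ℂ (Fin d),
    MemLp g 2 volume ∧ IsWeakGradient f g

open Classical in
/-- The gradient `∇f` of `f ∈ H¹(ℝ^d)` (unique almost everywhere), and `0` if there is no
distributional gradient in `L²`. -/
def weakGrad {d : ℕ} (f : Space d → ℂ) : Space d → EuclideanSpace ℂ (Fin d) :=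
  if h : ∃ g : Space d → EuclideanSpace ℂ (Fin d), MemLp g 2 volume ∧ IsWeakGradient f g
  then h.choose else 0

theorem MemH1.weakGrad_spec {d : ℕ} {f : Space d → ℂ} (hf : MemH1 f) :
    MemLp (weakGrad f) 2 volume ∧ IsWeakGradient f (weakGrad f) := by
  have h := hf.2
  unfold weakGrad
  rw [dif_pos h]
  exact h.choose_spec

/-- `‖f‖²` in `Ḣ¹_c`, the quadratic form `∫ |∇f|² + c |x|⁻² |f|²` of `P_c = -Δ + c |x|⁻²`. -/
def normSqH1c {d : ℕ} (c : ℝ) (f : Space d → ℂ) : ℝ :=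
  ∫ x, (‖weakGrad f x‖ ^ 2 + c * (‖f x‖ ^ 2 / ‖x‖ ^ 2))

/-- The mass `∫ |f|²`. -/
def mass {d : ℕ} (f : Space d → ℂ) : ℝ :=
  ∫ x, ‖f x‖ ^ 2

/-- `f` agrees almost everywhere with a function of `|x|`. -/
def IsRadial {d : ℕ} (f : Space d → ℂ) : Prop :=
  ∃ h : ℝ → ℂ, ∀ᵐ x : Space d, f x = h ‖x‖

/-- The pairing `⟨P_c f - |x|^{-b} |f|^σ f, w⟩` of `H⁻¹` with `H¹` (antilinear in `w`), where
`⟨P_c f, w⟩ = ∫ ∇f · conj ∇w + c |x|⁻² f conj w`. -/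
def hamiltonianPairing {d : ℕ} (b c σ : ℝ) (f w : Space d → ℂ) : ℂ :=
  (∫ x, ∑ j : Fin d, weakGrad f x j * conj (weakGrad w x j))
    + (c : ℂ) * (∫ x, ((1 / ‖x‖ ^ 2 : ℝ) : ℂ) * (f x * conj (w x)))
    - ∫ x, ((‖x‖ ^ (-b) * ‖f x‖ ^ σ : ℝ) : ℂ) * (f x * conj (w x))

/-- `u : I × ℝ^d → ℂ` is an `H¹` solution of the focusing equation
`i ∂_t u - P_c u = -|x|^{-b} |u|^σ u`: it belongs to `C(I, H¹)`, and the equation holds in `H⁻¹`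
at every time of `I`, that is, after pairing with an arbitrary `w ∈ H¹`. At an endpoint of `I`
that belongs to `I` the time derivative is one-sided. -/
structure IsFocusingSolution {d : ℕ} (b c σ : ℝ) (I : Set ℝ) (u : ℝ → Space d → ℂ) : Prop where
  memH1 : ∀ t ∈ I, MemH1 (u t)
  continuousH1 : ∀ t ∈ I,
    Tendsto (fun s => eLpNorm (u s - u t) 2 volume
      + eLpNorm (weakGrad (u s) - weakGrad (u t)) 2 volume) (𝓝[I] t) (𝓝 0)
  equation : ∀ w : Space d → ℂ, MemH1 w → ∀ t ∈ I,
    HasDerivWithinAt (fun s => ∫ x, u s x * conj (w x))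
      (-Complex.I * hamiltonianPairing b c σ (u t) w) I t

/-- The profiles `θ : [0, ∞) → [0, ∞)` of the truncated weight: `θ(r) = r²` on `[0, 1]`, `θ` is
constant on `[2, ∞)` and `θ'' ≤ 2`. -/
structure IsVirialProfile (θ : ℝ → ℝ) : Prop where
  contDiffOn : ContDiffOn ℝ 4 θ (Ici 0)
  nonneg : ∀ r, 0 ≤ r → 0 ≤ θ r
  eq_sq : ∀ r, 0 ≤ r → r ≤ 1 → θ r = r ^ 2
  eq_const : ∃ k : ℝ, ∀ r, 2 ≤ r → θ r = k
  deriv_two_le : ∀ r, 0 ≤ r → iteratedDerivWithin 2 θ (Ici 0) r ≤ 2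

/-- `φ_R(x) = R² θ(|x| / R)`. -/
def truncatedWeight {d : ℕ} (θ : ℝ → ℝ) (R : ℝ) (x : Space d) : ℝ :=
  R ^ 2 * θ (‖x‖ / R)

/-- The virial potential `V_a(t) = ∫ a(x) |u(t,x)|² dx`. -/
def virial {d : ℕ} (a : Space d → ℝ) (u : ℝ → Space d → ℂ) (t : ℝ) : ℝ :=
  ∫ x, a x * ‖u t x‖ ^ 2

end INLS

end

set_option linter.unusedSectionVars false

noncomputable section

/-! Put α = (d - 2)/2 and write a radial function as f(x) = |x|^(-α) v(y) with y = log |x|. Up to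
the area κ of the unit sphere, ∫ |∇f|² becomes ∫ |v'|² + α² |v|², because the cross term is an exact
derivative. The Hardy integral becomes ∫ |v|², the mass ∫ e^(2y) |v|², and the potential energy ∫
e^(βy) |v|^(σ+2) with β = 2 - b - σα. Thus the inverse square potential turns into the constant γ =
c + α², which is positive by assumption, and the upper bound on σ says exactly that β ≥ 0. Since
also β ≤ 2, the weight e^(βy) is at most 1 + e^(2y). Since v is bounded by the one-dimensional
Sobolev inequality, the nonlinearity is then controlled by the H¹ norm. `HasProfile` is this
dictionary. `HasProfile.exists_of_isRadial` supplies a profile for each radial H¹ function, and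
`IsFocusingSolution.isProfileSolution` transports the equation to the line.

Time derivatives have to be justified with only H¹ regularity. For an operator T that is bounded on
profiles together with its adjoint T', `IsProfileSolution.hasDerivWithinAt_quadratic` differentiates
⟨T v, v⟩. The quadratic remainder ⟨v(s) - v(t), T'(v(s) - v(t))⟩ is o(s - t), because v is Lipschitz
in time in the dual norm and continuous in H¹. Multiplication by the weight gives the first
derivative of the virial, which is `momentum`, and the identity gives conservation of mass. The
momentum contains v', so its operator is not bounded on profiles. It is replaced by a difference
quotient in y of step δ. The rate of change of this quotient is bounded uniformly for 0 < δ ≤ 1 and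
has a limit involving only v and v' (`approxRate_eq`, `exists_approxRate_le`, `tendsto_approxRate`).
Integration in time and dominated convergence (`IsProfileSolution.momentum_sub_eq`), followed by
integration by parts in space (`pairRate_eq`), express increments of the momentum as integrals of
`virialRate`. This rate is continuous in time, so the virial is C².

The inequality is `virialRate_le`. For m = φ_R'(r)/r one has m + dm/dy = φ_R'' ≤ 2 and m ≤ 2, which
bounds the quadratic main terms by 8 times the form of P_c. On |x| < R the weight is |x|² and the
identity is exact, so all errors come from |x| ≥ R. There the derivatives of m against |v|² cost R⁻²
times the mass. The nonlinear error is handled by the radial decay e^y |v|² ≤ 2 ‖v'‖ ‖e^y v‖ (L²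
norms) and Young's inequality with parameter ε. -/

namespace INLS

/-! ### Absolutely continuous functions on the line -/

/-- `v` is an absolutely continuous function with almost everywhere derivative `q`. -/
structure IsPrimitive {E : Type*} [NormedAddCommGroup E] [NormedSpace ℝ E] (v q : ℝ → E) :
    Prop where
  intervalIntegrable : ∀ x y, IntervalIntegrable q volume x y
  sub_eq : ∀ x y, v y - v x = ∫ z in x..y, q z

namespace IsPrimitive

variable {E F : Type*} [NormedAddCommGroup E] [NormedSpace ℝ E]
  [NormedAddCommGroup F] [NormedSpace ℝ F] {v q w p : ℝ → E}

theorem continuous (h : IsPrimitive v q) : Continuous v := by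
  have : v = fun y => v 0 + ∫ z in (0 : ℝ)..y, q z := by
    ext y; rw [← h.sub_eq 0 y]; abel
  rw [this]
  exact continuous_const.add (intervalIntegral.continuous_primitive h.intervalIntegrable 0)

theorem prodMk [CompleteSpace E] [CompleteSpace F] {u r : ℝ → F} (h : IsPrimitive v q) (h' : IsPrimitive u r) :
    IsPrimitive (fun y => (v y, u y)) (fun y => (q y, r y)) := by
  have key : ∀ x y, IntervalIntegrable (fun y => (q y, r y)) volume x y := fun x y =>
    ⟨(h.intervalIntegrable x y).1.prodMk (h'.intervalIntegrable x y).1,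
      (h.intervalIntegrable x y).2.prodMk (h'.intervalIntegrable x y).2⟩
  refine ⟨key, fun x y => ?_⟩
  have h1 := (ContinuousLinearMap.fst ℝ E F).intervalIntegral_comp_comm (key x y)
  have h2 := (ContinuousLinearMap.snd ℝ E F).intervalIntegral_comp_comm (key x y)
  simp only [ContinuousLinearMap.coe_fst', ContinuousLinearMap.coe_snd'] at h1 h2
  ext
  · simp [← h1, h.sub_eq]
  · simp [← h2, h'.sub_eq]

theorem of_hasDerivAt [CompleteSpace E] (h : ∀ x, HasDerivAt v (q x) x) (hq : Continuous q) :
    IsPrimitive v q :=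
  ⟨fun x y => hq.intervalIntegrable x y, fun x y =>
    (intervalIntegral.integral_eq_sub_of_hasDerivAt (fun z _ => h z)
      (hq.intervalIntegrable x y)).symm⟩

theorem comp_add_right (h : IsPrimitive v q) (δ : ℝ) :
    IsPrimitive (fun x => v (x + δ)) (fun x => q (x + δ)) := by
  refine ⟨fun x y => ?_, fun x y => ?_⟩
  · have := (h.intervalIntegrable (x + δ) (y + δ)).comp_add_right δ
    simpa using this
  · rw [h.sub_eq, intervalIntegral.integral_comp_add_right]

theorem congr (h : IsPrimitive v q) (hv : ∀ x, v x = w x) (hq : ∀ x, q x = p x) :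
    IsPrimitive w p := by
  obtain rfl : v = w := funext hv
  obtain rfl : q = p := funext hq
  exact h

/-- The chain rule for absolutely continuous functions. -/
theorem comp [ProperSpace E] [CompleteSpace F] (h : IsPrimitive v q) {Ψ : E → F}
    (hΨ : ContDiff ℝ 1 Ψ) :
    IsPrimitive (fun y => Ψ (v y)) (fun y => fderiv ℝ Ψ (v y) (q y)) := by
  have hcD : Continuous (fderiv ℝ Ψ) := hΨ.continuous_fderiv one_ne_zero
  have hvc := h.continuous
  have hmeas : ∀ {u : ℝ → E} {r : ℝ → E} {μ : Measure ℝ}, Continuous u →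
      AEStronglyMeasurable r μ →
      AEStronglyMeasurable (fun y => fderiv ℝ Ψ (u y) (r y)) μ := fun {u r μ} hu hr =>
    (isBoundedBilinearMap_apply (𝕜 := ℝ) (E := E) (F := F)).continuous.comp_aestronglyMeasurable
      ((hcD.comp hu).aestronglyMeasurable.prodMk hr)
  suffices key : ∀ a b, a ≤ b → IntervalIntegrable (fun y => fderiv ℝ Ψ (v y) (q y)) volume a b ∧
      Ψ (v b) - Ψ (v a) = ∫ y in a..b, fderiv ℝ Ψ (v y) (q y) by
    refine ⟨fun x y => ?_, fun x y => ?_⟩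
    · rcases le_total x y with hxy | hxy
      · exact (key x y hxy).1
      · exact (key y x hxy).1.symm
    · rcases le_total x y with hxy | hxy
      · exact (key x y hxy).2
      · rw [intervalIntegral.integral_symm, ← (key y x hxy).2]; abel
  intro a b hab
  obtain ⟨r, hr⟩ := (isCompact_Icc (a := a) (b := b)).exists_bound_of_continuousOn
    hvc.continuousOn
  -- The radius is r + 1 because the smooth approximants of v below stay within distance 1 of it.
  obtain ⟨L, hL⟩ := (isCompact_closedBall (0 : E) (r + 1)).exists_bound_of_continuousOn
    hcD.continuousOn
  have hqi := h.intervalIntegrable a b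
  have hbound : ∀ {u : ℝ → E} {s : ℝ → E} {y : ℝ}, ‖u y‖ ≤ r + 1 →
      ‖fderiv ℝ Ψ (u y) (s y)‖ ≤ L * ‖s y‖ := fun {u s y} hu =>
    (ContinuousLinearMap.le_opNorm _ _).trans
      (mul_le_mul_of_nonneg_right (hL _ (by simpa using hu)) (norm_nonneg _))
  have hsub : uIoc a b ⊆ Icc a b := by rw [uIoc_of_le hab]; exact Ioc_subset_Icc_self
  have hint : IntervalIntegrable (fun y => fderiv ℝ Ψ (v y) (q y)) volume a b := by
    refine (hqi.norm.const_mul L).mono_fun (hmeas hvc ?_) ?_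
    · exact hqi.def'.aestronglyMeasurable
    · refine (ae_restrict_iff' measurableSet_uIoc).2 (ae_of_all _ fun y hy => ?_)
      exact (hbound (u := v) (s := q) (by linarith [hr y (hsub hy)])).trans (le_abs_self _)
  refine ⟨hint, ?_⟩
  have hqI : Integrable ((Ioc a b).indicator q) := by
    rw [integrable_indicator_iff measurableSet_Ioc]; exact hqi.1
  -- L¹ approximation of the derivative by continuous functions. Their primitives are C¹ and
  -- converge uniformly to v on [a, b], so the classical chain rule passes to the limit.
  choose Q hQ0 hQ1 hQ2 hQ3 using fun n : ℕ =>
    hqI.exists_hasCompactSupport_integral_sub_le (ε := 1 / ((n : ℝ) + 1)) (by positivity)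
  set V : ℕ → ℝ → E := fun n y => v a + ∫ z in a..y, Q n z with hV
  have hVd : ∀ n y, HasDerivAt (V n) (Q n y) y := fun n y =>
    (intervalIntegral.integral_hasDerivAt_right ((hQ2 n).intervalIntegrable _ _)
      ((hQ2 n).stronglyMeasurableAtFilter _ _) (hQ2 n).continuousAt).const_add _
  have hVc : ∀ n, Continuous (V n) := fun n =>
    continuous_iff_continuousAt.2 fun y => (hVd n y).continuousAt
  have hL1 : ∀ n, ∫ y in a..b, ‖q y - Q n y‖ ≤ 1 / ((n : ℝ) + 1) := fun n => by
    refine le_trans ?_ (hQ1 n)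
    rw [intervalIntegral.integral_of_le hab]
    calc ∫ y in Ioc a b, ‖q y - Q n y‖ = ∫ y in Ioc a b, ‖(Ioc a b).indicator q y - Q n y‖ := by
          refine setIntegral_congr_fun measurableSet_Ioc fun y hy => ?_
          simp [indicator_of_mem hy]
      _ ≤ _ := setIntegral_le_integral (hqI.sub (hQ3 n)).norm (ae_of_all _ fun _ => norm_nonneg _)
  have hclose : ∀ n, ∀ y ∈ Icc a b, ‖V n y - v y‖ ≤ 1 / ((n : ℝ) + 1) := fun n y hy => by
    have h1 : V n y - v y = -∫ z in a..y, (q z - Q n z) := by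
      rw [intervalIntegral.integral_sub (h.intervalIntegrable a y)
        ((hQ2 n).intervalIntegrable a y), ← h.sub_eq, hV]
      simp only; abel
    rw [h1, norm_neg]
    refine (intervalIntegral.norm_integral_le_integral_norm hy.1).trans ((?_ : _ ≤ _).trans (hL1 n))
    refine intervalIntegral.integral_mono_interval le_rfl hy.1 hy.2
      (ae_of_all _ fun _ => norm_nonneg _) (hqi.sub ((hQ2 n).intervalIntegrable a b)).norm
  have hVr : ∀ n, ∀ y ∈ Icc a b, ‖V n y‖ ≤ r + 1 := fun n y hy => by
    have h1 := hclose n y hy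
    have h2 : (1 : ℝ) / (n + 1) ≤ 1 := by
      rw [div_le_one (by positivity)]; linarith [(Nat.cast_nonneg n : (0 : ℝ) ≤ n)]
    have h3 := norm_add_le (V n y - v y) (v y)
    rw [sub_add_cancel] at h3
    linarith [hr y hy]
  have hto : ∀ y ∈ Icc a b, Tendsto (fun n => V n y) atTop (𝓝 (v y)) := fun y hy => by
    rw [tendsto_iff_norm_sub_tendsto_zero]
    exact squeeze_zero (fun _ => norm_nonneg _) (fun n => hclose n y hy)
      tendsto_one_div_add_atTop_nhds_zero_nat
  have hFTC : ∀ n, Ψ (V n b) - Ψ (V n a) = ∫ y in a..b, fderiv ℝ Ψ (V n y) (Q n y) := fun n => by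
    refine (intervalIntegral.integral_eq_sub_of_hasDerivAt (f := fun y => Ψ (V n y))
      (fun y _ => ?_) ?_).symm
    · exact ((hΨ.differentiable one_ne_zero) _).hasFDerivAt.comp_hasDerivAt y (hVd n y)
    · exact (((hcD.comp (hVc n)).clm_apply (hQ2 n))).intervalIntegrable _ _
  have hiQ : ∀ n, IntervalIntegrable (fun y => fderiv ℝ Ψ (V n y) (q y)) volume a b := fun n => by
    refine (hqi.norm.const_mul L).mono_fun (hmeas (hVc n) ?_) ?_
    · exact hqi.def'.aestronglyMeasurable
    · refine (ae_restrict_iff' measurableSet_uIoc).2 (ae_of_all _ fun y hy => ?_)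
      exact (hbound (u := V n) (s := q) (hVr n y (hsub hy))).trans (le_abs_self _)
  have hlim1 : Tendsto (fun n => ∫ y in a..b, fderiv ℝ Ψ (V n y) (q y)) atTop
      (𝓝 (∫ y in a..b, fderiv ℝ Ψ (v y) (q y))) := by
    refine intervalIntegral.tendsto_integral_filter_of_dominated_convergence
      (fun y => L * ‖q y‖) (Eventually.of_forall fun n => (hiQ n).def'.aestronglyMeasurable)
      (Eventually.of_forall fun n => ae_of_all _ fun y hy => hbound (hVr n y (hsub hy)))
      (hqi.norm.const_mul L) (ae_of_all _ fun y hy => ?_)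
    have h1 : Tendsto (fun n => fderiv ℝ Ψ (V n y)) atTop (𝓝 (fderiv ℝ Ψ (v y))) :=
      (hcD.tendsto _).comp (hto y (hsub hy))
    exact ((ContinuousLinearMap.apply ℝ F (q y)).continuous.tendsto _).comp h1
  have hlim2 : Tendsto (fun n => ∫ y in a..b, fderiv ℝ Ψ (V n y) (Q n y)) atTop
      (𝓝 (∫ y in a..b, fderiv ℝ Ψ (v y) (q y))) := by
    -- The derivatives of Ψ are bounded by L on the ball, so replacing Q n by q costs at most L
    -- times their L¹ distance.
    have hd : Tendsto (fun n => ∫ y in a..b, fderiv ℝ Ψ (V n y) (q y - Q n y)) atTop (𝓝 0) := by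
      refine squeeze_zero_norm (a := fun n : ℕ => L * (1 / ((n : ℝ) + 1))) (fun n => ?_) ?_
      · have hL0 : 0 ≤ L := (norm_nonneg _).trans (hL (V n a) (by simpa using hVr n a ⟨le_rfl, hab⟩))
        calc _ ≤ ∫ y in a..b, L * ‖q y - Q n y‖ := by
              refine intervalIntegral.norm_integral_le_of_norm_le hab
                (ae_of_all _ fun y hy => ?_)
                ((hqi.sub ((hQ2 n).intervalIntegrable a b)).norm.const_mul L)
              exact hbound (u := V n) (s := fun y => q y - Q n y) (hVr n y (Ioc_subset_Icc_self hy))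
          _ ≤ _ := by
              rw [intervalIntegral.integral_const_mul]
              exact mul_le_mul_of_nonneg_left (hL1 n) hL0
      · simpa using tendsto_one_div_add_atTop_nhds_zero_nat.const_mul L
    have := hlim1.sub hd
    rw [sub_zero] at this
    refine this.congr fun n => ?_
    have hi : IntervalIntegrable (fun y => fderiv ℝ Ψ (V n y) (Q n y)) volume a b :=
      (((hcD.comp (hVc n)).clm_apply (hQ2 n))).intervalIntegrable _ _
    simp only [map_sub]
    rw [intervalIntegral.integral_sub (hiQ n) hi]; abel
  have hlim3 : Tendsto (fun n => Ψ (V n b) - Ψ (V n a)) atTop (𝓝 (Ψ (v b) - Ψ (v a))) :=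
    ((hΨ.continuous.tendsto _).comp (hto b ⟨hab, le_rfl⟩)).sub
      ((hΨ.continuous.tendsto _).comp (hto a ⟨le_rfl, hab⟩))
  exact tendsto_nhds_unique hlim3 (by simpa only [hFTC] using hlim2)

end IsPrimitive

/-- A function integrable at infinity takes small values arbitrarily far out. -/
theorem frequently_atTop_norm_lt {E : Type*} [NormedAddCommGroup E] {G : ℝ → E}
    (hG : Integrable G) {ε : ℝ} (hε : 0 < ε) : ∃ᶠ x in atTop, ‖G x‖ < ε := by
  rw [frequently_atTop]
  intro a
  by_contra! hcon
  have hc : IntegrableOn (fun _ : ℝ => ε) (Ici a) := by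
    refine (hG.norm.integrableOn).mono' aestronglyMeasurable_const ?_
    refine (ae_restrict_iff' measurableSet_Ici).2 (ae_of_all _ fun x hx => ?_)
    rw [Real.norm_of_nonneg hε.le]; exact hcon x hx
  rw [integrableOn_const_iff] at hc
  simp [hε.ne'] at hc

theorem eq_zero_of_tendsto_atTop_of_integrable {E : Type*} [NormedAddCommGroup E] {G : ℝ → E}
    (hG : Integrable G) {L : E} (hL : Tendsto G atTop (𝓝 L)) : L = 0 := by
  by_contra hne
  have hpos : 0 < ‖L‖ := norm_pos_iff.2 hne
  have h1 := hL.norm.eventually (lt_mem_nhds (half_lt_self hpos))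
  obtain ⟨x, hx, hx'⟩ := ((frequently_atTop_norm_lt hG (half_pos hpos)).and_eventually h1).exists
  linarith

theorem eq_zero_of_tendsto_atBot_of_integrable {E : Type*} [NormedAddCommGroup E] {G : ℝ → E}
    (hG : Integrable G) {L : E} (hL : Tendsto G atBot (𝓝 L)) : L = 0 :=
  eq_zero_of_tendsto_atTop_of_integrable hG.comp_neg (hL.comp tendsto_neg_atTop_atBot)

namespace IsPrimitive

variable {E : Type*} [NormedAddCommGroup E] [NormedSpace ℝ E] {G g : ℝ → E}

theorem tendsto_atTop_zero (h : IsPrimitive G g) (hG : Integrable G) (hg : Integrable g) :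
    Tendsto G atTop (𝓝 0) := by
  have h1 : Tendsto G atTop (𝓝 (G 0 + ∫ z in Ioi (0 : ℝ), g z)) := by
    have := (intervalIntegral_tendsto_integral_Ioi 0 hg.integrableOn tendsto_id).const_add (G 0)
    refine this.congr fun y => ?_
    rw [id, ← h.sub_eq]; abel
  have h2 := eq_zero_of_tendsto_atTop_of_integrable hG h1
  rwa [h2] at h1

theorem tendsto_atBot_zero (h : IsPrimitive G g) (hG : Integrable G) (hg : Integrable g) :
    Tendsto G atBot (𝓝 0) := by
  have h1 : Tendsto G atBot (𝓝 (G 0 - ∫ z in Iic (0 : ℝ), g z)) := by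
    have := (intervalIntegral_tendsto_integral_Iic 0 hg.integrableOn tendsto_id).const_sub (G 0)
    refine this.congr fun y => ?_
    rw [id, ← h.sub_eq]; abel
  have h2 := eq_zero_of_tendsto_atBot_of_integrable hG h1
  rwa [h2] at h1

/-- The integral of the derivative of an integrable function vanishes. -/
theorem integral_eq_zero (h : IsPrimitive G g) (hG : Integrable G) (hg : Integrable g) :
    ∫ x, g x = 0 := by
  have h1 := intervalIntegral_tendsto_integral hg tendsto_neg_atTop_atBot tendsto_id
  have h2 : Tendsto (fun x => G x - G (-x)) atTop (𝓝 (0 - 0)) :=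
    (h.tendsto_atTop_zero hG hg).sub ((h.tendsto_atBot_zero hG hg).comp tendsto_neg_atTop_atBot)
  rw [sub_zero] at h2
  refine tendsto_nhds_unique h1 (h2.congr fun x => ?_)
  rw [h.sub_eq]; rfl

/-- Integrability of both G and g forces G to vanish at infinity. Pointwise bounds on profiles are
read off from this formula. -/
theorem eq_neg_integral_Ioi (h : IsPrimitive G g) (hG : Integrable G) (hg : Integrable g) (x : ℝ) :
    G x = -∫ z in Ioi x, g z := by
  have h1 := intervalIntegral_tendsto_integral_Ioi x hg.integrableOn tendsto_id
  have h2 : Tendsto (fun y => G y - G x) atTop (𝓝 (0 - G x)) :=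
    (h.tendsto_atTop_zero hG hg).sub_const _
  have h3 := tendsto_nhds_unique h2 (h1.congr fun y => by rw [h.sub_eq]; rfl)
  rw [← h3]; simp

end IsPrimitive

namespace IsPrimitive

variable {E F : Type*} [NormedAddCommGroup E] [NormedSpace ℝ E]
  [NormedAddCommGroup F] [NormedSpace ℝ F]

theorem clm_apply [CompleteSpace E] [CompleteSpace F] {v q : ℝ → E} (h : IsPrimitive v q)
    (L : E →L[ℝ] F) : IsPrimitive (fun x => L (v x)) (fun x => L (q x)) :=
  ⟨fun x y => ⟨L.integrable_comp (h.intervalIntegrable x y).1,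
    L.integrable_comp (h.intervalIntegrable x y).2⟩, fun x y => by
    rw [← map_sub, h.sub_eq, L.intervalIntegral_comp_comm (h.intervalIntegrable x y)]⟩

theorem mul {A : Type*} [NormedRing A] [NormedAlgebra ℝ A] [ProperSpace A] {v q w p : ℝ → A}
    (h : IsPrimitive v q) (h' : IsPrimitive w p) :
    IsPrimitive (fun x => v x * w x) (fun x => v x * p x + q x * w x) := by
  have hb := isBoundedBilinearMap_mul (𝕜 := ℝ) (A := A)
  refine ((h.prodMk h').comp hb.contDiff).congr (fun _ => rfl) fun x => ?_
  rw [(hb.hasFDerivAt _).fderiv]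
  rfl

theorem ofReal_mul {m m' : ℝ → ℝ} {v q : ℝ → ℂ} (hm : ∀ x, HasDerivAt m (m' x) x)
    (hm' : Continuous m') (h : IsPrimitive v q) :
    IsPrimitive (fun x => (m x : ℂ) * v x) (fun x => (m' x : ℂ) * v x + (m x : ℂ) * q x) := by
  have h1 : IsPrimitive (fun x => (m x : ℂ)) (fun x => (m' x : ℂ)) :=
    of_hasDerivAt (fun x => (hm x).ofReal_comp) (by fun_prop)
  exact (h1.mul h).congr (fun _ => rfl) fun _ => add_comm _ _

theorem real_mul {m m' G g : ℝ → ℝ} (hm : ∀ x, HasDerivAt m (m' x) x)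
    (hm' : Continuous m') (h : IsPrimitive G g) :
    IsPrimitive (fun x => m x * G x) (fun x => m' x * G x + m x * g x) :=
  ((of_hasDerivAt hm hm').mul h).congr (fun _ => rfl) fun _ => add_comm _ _

variable {v q w p : ℝ → ℂ}

theorem conj_comp (h : IsPrimitive v q) : IsPrimitive (fun x => conj (v x)) (fun x => conj (q x)) :=
  h.clm_apply (Complex.conjCLE : ℂ →L[ℝ] ℂ)

theorem sub (h : IsPrimitive v q) (h' : IsPrimitive w p) :
    IsPrimitive (fun x => v x - w x) (fun x => q x - p x) :=
  (h.prodMk h').clm_apply (ContinuousLinearMap.fst ℝ ℂ ℂ - ContinuousLinearMap.snd ℝ ℂ ℂ)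

theorem const_mul (h : IsPrimitive v q) (a : ℂ) :
    IsPrimitive (fun x => a * v x) (fun x => a * q x) :=
  h.clm_apply (ContinuousLinearMap.mul ℝ ℂ a)

theorem norm_sq (h : IsPrimitive v q) :
    IsPrimitive (fun x => ‖v x‖ ^ 2) (fun x => 2 * (q x * conj (v x)).re) := by
  refine (h.comp (contDiff_norm_sq ℝ (n := 1))).congr (fun _ => rfl) fun x => ?_
  have : HasFDerivAt (fun z : ℂ => ‖z‖ ^ 2) (2 • (innerSL ℝ) (v x) ∘SL .id ℝ ℂ) (v x) :=
    (hasFDerivAt_id (v x)).norm_sq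
  rw [this.fderiv]
  simp [Complex.inner]
  ring

theorem norm_rpow (h : IsPrimitive v q) {p : ℝ} (hp : 1 < p) :
    IsPrimitive (fun x => ‖v x‖ ^ p) (fun x => p * (‖v x‖ ^ (p - 2) * (q x * conj (v x)).re)) := by
  refine (h.comp (contDiff_norm_rpow hp)).congr (fun _ => rfl) fun x => ?_
  rw [fderiv_norm_rpow _ hp]
  simp [Complex.inner]
  ring

end IsPrimitive

/-! ### Norm and pairing of L² on the line -/

/-- The norm of `L²(ℝ)`. -/
def l2 (f : ℝ → ℂ) : ℝ := (eLpNorm f 2 volume).toReal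

theorem l2_nonneg (f : ℝ → ℂ) : 0 ≤ l2 f := ENNReal.toReal_nonneg

theorem l2_eq_rpow {f : ℝ → ℂ} (hf : MemLp f 2 volume) :
    l2 f = (∫ x, ‖f x‖ ^ (2 : ℝ)) ^ (1 / (2 : ℝ)) := by
  rw [l2, hf.eLpNorm_eq_integral_rpow_norm two_ne_zero ENNReal.ofNat_ne_top,
    ENNReal.toReal_ofReal (by positivity)]
  simp

theorem l2_sq {f : ℝ → ℂ} (hf : MemLp f 2 volume) : l2 f ^ 2 = ∫ x, ‖f x‖ ^ 2 := by
  have h0 : 0 ≤ ∫ x, ‖f x‖ ^ (2 : ℝ) := integral_nonneg fun x => by positivity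
  rw [l2_eq_rpow hf, ← Real.rpow_natCast, ← Real.rpow_mul h0]
  norm_num

theorem integrable_norm_mul {f g : ℝ → ℂ} (hf : MemLp f 2 volume) (hg : MemLp g 2 volume) :
    Integrable fun x => ‖f x‖ * ‖g x‖ :=
  hf.norm.integrable_mul hg.norm

theorem integral_norm_mul_le {f g : ℝ → ℂ} (hf : MemLp f 2 volume) (hg : MemLp g 2 volume) :
    ∫ x, ‖f x‖ * ‖g x‖ ≤ l2 f * l2 g := by
  rw [l2_eq_rpow hf, l2_eq_rpow hg]
  refine integral_mul_norm_le_Lp_mul_Lq (Real.HolderConjugate.two_two) ?_ ?_ <;> simpa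

/-- The pairing `∫ f conj g`. -/
def pair (f g : ℝ → ℂ) : ℂ := ∫ x, f x * conj (g x)

theorem memLp_conj {f : ℝ → ℂ} (hf : MemLp f 2 volume) : MemLp (fun x => conj (f x)) 2 volume :=
  hf.star

theorem integrable_pair {f g : ℝ → ℂ} (hf : MemLp f 2 volume) (hg : MemLp g 2 volume) :
    Integrable fun x => f x * conj (g x) :=
  hf.integrable_mul (memLp_conj hg)

theorem norm_pair_le {f g : ℝ → ℂ} (hf : MemLp f 2 volume) (hg : MemLp g 2 volume) :
    ‖pair f g‖ ≤ l2 f * l2 g := by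
  refine (norm_integral_le_integral_norm _).trans (le_trans (le_of_eq ?_)
    (integral_norm_mul_le hf hg))
  simp

theorem pair_conj (f g : ℝ → ℂ) : conj (pair f g) = pair g f := by
  rw [pair, pair, ← integral_conj]
  congr 1; ext x; simp [mul_comm]

theorem pair_self {f : ℝ → ℂ} (hf : MemLp f 2 volume) : pair f f = ((l2 f ^ 2 : ℝ) : ℂ) := by
  rw [l2_sq hf, pair, ← integral_complex_ofReal]
  congr 1; ext x; rw [Complex.mul_conj, Complex.normSq_eq_norm_sq]

theorem pair_add_right {f g h : ℝ → ℂ} (hf : MemLp f 2 volume) (hg : MemLp g 2 volume)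
    (hh : MemLp h 2 volume) : pair h (fun x => f x + g x) = pair h f + pair h g := by
  simp only [pair, map_add, mul_add]
  exact integral_add (integrable_pair hh hf) (integrable_pair hh hg)

theorem pair_sub_left {f g h : ℝ → ℂ} (hf : MemLp f 2 volume) (hg : MemLp g 2 volume)
    (hh : MemLp h 2 volume) : pair (fun x => f x - g x) h = pair f h - pair g h := by
  simp only [pair, sub_mul]
  exact integral_sub (integrable_pair hf hh) (integrable_pair hg hh)

theorem pair_sub_right {f g h : ℝ → ℂ} (hf : MemLp f 2 volume) (hg : MemLp g 2 volume)
    (hh : MemLp h 2 volume) : pair h (fun x => f x - g x) = pair h f - pair h g := by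
  simp only [pair, map_sub, mul_sub]
  exact integral_sub (integrable_pair hh hf) (integrable_pair hh hg)

theorem pair_smul_right (a : ℝ) (f g : ℝ → ℂ) : pair f (fun x => (a : ℂ) * g x) = a * pair f g := by
  rw [pair, pair, ← integral_const_mul]
  congr 1; ext x; simp; ring

theorem pair_smul_left (a : ℝ) (f g : ℝ → ℂ) : pair (fun x => (a : ℂ) * f x) g = a * pair f g := by
  rw [pair, pair, ← integral_const_mul]
  congr 1; ext x; ring

theorem pair_real_mul (m : ℝ → ℝ) (f g : ℝ → ℂ) :
    pair (fun x => (m x : ℂ) * f x) g = pair f (fun x => (m x : ℂ) * g x) := by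
  rw [pair, pair]
  congr 1; ext x; simp; ring

theorem pair_comp_add_right (f g : ℝ → ℂ) (δ : ℝ) :
    pair (fun x => f (x + δ)) (fun x => g (x + δ)) = pair f g :=
  integral_add_right_eq_self (fun x => f x * conj (g x)) δ

theorem l2_add_le {f g : ℝ → ℂ} (hf : MemLp f 2 volume) (hg : MemLp g 2 volume) :
    l2 (fun x => f x + g x) ≤ l2 f + l2 g := by
  rw [l2, l2, l2, ← ENNReal.toReal_add hf.eLpNorm_ne_top hg.eLpNorm_ne_top]
  exact ENNReal.toReal_mono (ENNReal.add_ne_top.2 ⟨hf.eLpNorm_ne_top, hg.eLpNorm_ne_top⟩)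
    (eLpNorm_add_le hf.1 hg.1 (by norm_num))

theorem l2_sub_comm (f g : ℝ → ℂ) : l2 (fun x => f x - g x) = l2 (fun x => g x - f x) := by
  rw [l2, l2]
  congr 1
  exact eLpNorm_sub_comm f g 2 volume

theorem memLp_ofReal_mul {m : ℝ → ℝ} {f : ℝ → ℂ} {C : ℝ} (hm : Continuous m)
    (hC : ∀ x, |m x| ≤ C) (hf : MemLp f 2 volume) :
    MemLp (fun x => (m x : ℂ) * f x) 2 volume := by
  refine hf.of_le_mul (c := C) ?_ (ae_of_all _ fun x => ?_)
  · exact (Complex.continuous_ofReal.comp hm).aestronglyMeasurable.mul hf.1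
  · rw [norm_mul, Complex.norm_real]; exact mul_le_mul_of_nonneg_right (hC x) (norm_nonneg _)

theorem l2_le_of_le_mul {f g : ℝ → ℂ} {C : ℝ} (hC : 0 ≤ C) (hg : MemLp g 2 volume)
    (h : ∀ x, ‖f x‖ ≤ C * ‖g x‖) : l2 f ≤ C * l2 g := by
  have h1 := eLpNorm_le_mul_eLpNorm_of_ae_le_mul (ae_of_all volume h) 2
  have h2 := ENNReal.toReal_mono (ENNReal.mul_ne_top ENNReal.ofReal_ne_top hg.eLpNorm_ne_top) h1
  rwa [ENNReal.toReal_mul, ENNReal.toReal_ofReal hC] at h2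

theorem l2_ofReal_mul_le {m : ℝ → ℝ} {f : ℝ → ℂ} {C : ℝ}
    (hC : ∀ x, |m x| ≤ C) (hf : MemLp f 2 volume) :
    l2 (fun x => (m x : ℂ) * f x) ≤ C * l2 f :=
  l2_le_of_le_mul ((abs_nonneg _).trans (hC 0)) hf fun x => by
    rw [norm_mul, Complex.norm_real]; exact mul_le_mul_of_nonneg_right (hC x) (norm_nonneg _)

theorem memLp_comp_add_right {f : ℝ → ℂ} (hf : MemLp f 2 volume) (δ : ℝ) :
    MemLp (fun x => f (x + δ)) 2 volume :=
  hf.comp_measurePreserving (measurePreserving_add_right volume δ)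

theorem l2_comp_add_right {f : ℝ → ℂ} (hf : MemLp f 2 volume) (δ : ℝ) :
    l2 (fun x => f (x + δ)) = l2 f := by
  rw [l2, l2]
  congr 1
  exact eLpNorm_comp_measurePreserving hf.1 (measurePreserving_add_right volume δ)

/-! ### Logarithmic profiles and their pointwise bounds -/

/-- Multiplication by `eˣ`. -/
def expMul (v : ℝ → ℂ) (x : ℝ) : ℂ := (Real.exp x : ℂ) * v x

theorem norm_expMul (v : ℝ → ℂ) (x : ℝ) : ‖expMul v x‖ = Real.exp x * ‖v x‖ := by
  rw [expMul, norm_mul, Complex.norm_real, Real.norm_of_nonneg (Real.exp_pos x).le]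

/-- The logarithmic profile `v`, with derivative `q`, of a radial function in `H¹`. -/
structure IsProfile (v q : ℝ → ℂ) : Prop where
  prim : IsPrimitive v q
  memLp : MemLp v 2 volume
  memLp_deriv : MemLp q 2 volume
  memLp_exp : MemLp (expMul v) 2 volume

/-- A norm equivalent to the `H¹` norm in terms of logarithmic profiles. -/
def profileNorm (v q : ℝ → ℂ) : ℝ := l2 v + l2 q + l2 (expMul v)

theorem profileNorm_nonneg (v q : ℝ → ℂ) : 0 ≤ profileNorm v q :=
  add_nonneg (add_nonneg (l2_nonneg _) (l2_nonneg _)) (l2_nonneg _)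

theorem l2_le_profileNorm (v q : ℝ → ℂ) : l2 v ≤ profileNorm v q := by
  have := l2_nonneg q; have := l2_nonneg (expMul v); unfold profileNorm; linarith

theorem l2_deriv_le_profileNorm (v q : ℝ → ℂ) : l2 q ≤ profileNorm v q := by
  have := l2_nonneg v; have := l2_nonneg (expMul v); unfold profileNorm; linarith

theorem l2_expMul_le_profileNorm (v q : ℝ → ℂ) : l2 (expMul v) ≤ profileNorm v q := by
  have := l2_nonneg q; have := l2_nonneg v; unfold profileNorm; linarith

namespace IsProfile

variable {v q w p : ℝ → ℂ}

theorem sub (h : IsProfile v q) (h' : IsProfile w p) :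
    IsProfile (fun x => v x - w x) (fun x => q x - p x) := by
  refine ⟨h.prim.sub h'.prim, h.memLp.sub h'.memLp, h.memLp_deriv.sub h'.memLp_deriv, ?_⟩
  refine (h.memLp_exp.sub h'.memLp_exp).ae_eq (ae_of_all _ fun x => ?_)
  simp [expMul]; ring

theorem comp_add_right (h : IsProfile v q) (δ : ℝ) :
    IsProfile (fun x => v (x + δ)) (fun x => q (x + δ)) := by
  refine ⟨h.prim.comp_add_right δ, memLp_comp_add_right h.memLp δ,
    memLp_comp_add_right h.memLp_deriv δ, ?_⟩
  refine ((memLp_comp_add_right h.memLp_exp δ).const_mul (Real.exp (-δ) : ℂ)).ae_eq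
    (ae_of_all _ fun x => ?_)
  simp only [expMul]
  rw [← mul_assoc, ← Complex.ofReal_mul, ← Real.exp_add]
  ring_nf

theorem ofReal_mul {m m' : ℝ → ℝ} {C : ℝ} (h : IsProfile v q) (hm : ∀ x, HasDerivAt m (m' x) x)
    (hm' : Continuous m') (hC : ∀ x, |m x| ≤ C) (hC' : ∀ x, |m' x| ≤ C) :
    IsProfile (fun x => (m x : ℂ) * v x) (fun x => (m' x : ℂ) * v x + (m x : ℂ) * q x) := by
  have hmc : Continuous m := continuous_iff_continuousAt.2 fun x => (hm x).continuousAt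
  refine ⟨h.prim.ofReal_mul hm hm', memLp_ofReal_mul hmc hC h.memLp,
    (memLp_ofReal_mul hm' hC' h.memLp).add (memLp_ofReal_mul hmc hC h.memLp_deriv), ?_⟩
  refine (memLp_ofReal_mul hmc hC h.memLp_exp).ae_eq (ae_of_all _ fun x => ?_)
  simp [expMul]; ring

theorem const_mul (h : IsProfile v q) (a : ℝ) :
    IsProfile (fun x => (a : ℂ) * v x) (fun x => (a : ℂ) * q x) := by
  refine ⟨h.prim.const_mul a, h.memLp.const_mul _, h.memLp_deriv.const_mul _, ?_⟩
  refine (h.memLp_exp.const_mul (a : ℂ)).ae_eq (ae_of_all _ fun x => ?_)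
  simp [expMul]; ring

theorem integrable_norm_sq (h : IsProfile v q) : Integrable fun x => ‖v x‖ ^ 2 :=
  (memLp_two_iff_integrable_sq_norm h.memLp.1).1 h.memLp

theorem integrable_re (h : IsProfile v q) : Integrable fun x => 2 * (q x * conj (v x)).re :=
  (integrable_pair h.memLp_deriv h.memLp).re.const_mul 2

/-- One-dimensional Sobolev embedding: integrate the derivative of |v|² from x to infinity and use
Cauchy–Schwarz. -/
theorem norm_sq_le (h : IsProfile v q) (x : ℝ) : ‖v x‖ ^ 2 ≤ 2 * (l2 q * l2 v) := by
  rw [h.prim.norm_sq.eq_neg_integral_Ioi h.integrable_norm_sq h.integrable_re x, ← integral_neg]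
  have hi := (integrable_norm_mul h.memLp_deriv h.memLp).const_mul 2
  calc ∫ z in Ioi x, -(2 * (q z * conj (v z)).re)
      ≤ ∫ z in Ioi x, 2 * (‖q z‖ * ‖v z‖) := by
        refine setIntegral_mono h.integrable_re.neg.integrableOn hi.integrableOn fun z => ?_
        have := Complex.abs_re_le_norm (q z * conj (v z))
        rw [norm_mul, RCLike.norm_conj] at this
        have := neg_le_abs (q z * conj (v z)).re
        dsimp only; linarith
    _ ≤ ∫ z, 2 * (‖q z‖ * ‖v z‖) :=
        setIntegral_le_integral hi (ae_of_all _ fun z => by positivity)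
    _ ≤ _ := by
        rw [integral_const_mul]
        exact mul_le_mul_of_nonneg_left (integral_norm_mul_le h.memLp_deriv h.memLp) two_pos.le

theorem norm_le (h : IsProfile v q) (x : ℝ) : ‖v x‖ ≤ profileNorm v q := by
  refine abs_le_of_sq_le_sq' ?_ (profileNorm_nonneg v q) |>.2
  have h1 := h.norm_sq_le x
  have := l2_nonneg v; have := l2_nonneg q; have := l2_nonneg (expMul v)
  unfold profileNorm
  nlinarith [mul_nonneg (l2_nonneg v) (l2_nonneg (expMul v)),
    mul_nonneg (l2_nonneg q) (l2_nonneg (expMul v))]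

theorem integrable_exp_norm_mul (h : IsProfile v q) :
    Integrable fun x => Real.exp x * (‖v x‖ * ‖v x‖) := by
  refine (integrable_norm_mul h.memLp_exp h.memLp).congr (ae_of_all _ fun x => ?_)
  simp only [norm_expMul]; ring

/-- Decay of radial functions at infinity. -/
theorem exp_mul_norm_sq_le (h : IsProfile v q) (x : ℝ) :
    Real.exp x * ‖v x‖ ^ 2 ≤ 2 * (l2 q * l2 (expMul v)) := by
  have hp := h.prim.norm_sq.real_mul (fun x => Real.hasDerivAt_exp x) Real.continuous_exp
  have hi1 : Integrable fun x => Real.exp x * ‖v x‖ ^ 2 :=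
    h.integrable_exp_norm_mul.congr (ae_of_all _ fun x => by simp only; ring)
  have hi2 : Integrable fun x => Real.exp x * (2 * (q x * conj (v x)).re) := by
    refine ((integrable_pair h.memLp_deriv h.memLp_exp).re.const_mul 2).congr
      (ae_of_all _ fun x => ?_)
    simp [expMul, -Complex.ofReal_exp]; ring
  rw [hp.eq_neg_integral_Ioi hi1 (hi1.add hi2) x, ← integral_neg]
  have hi := (integrable_norm_mul h.memLp_deriv h.memLp_exp).const_mul 2
  calc ∫ z in Ioi x, -(Real.exp z * ‖v z‖ ^ 2 + Real.exp z * (2 * (q z * conj (v z)).re))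
      ≤ ∫ z in Ioi x, 2 * (‖q z‖ * ‖expMul v z‖) := by
        refine setIntegral_mono (hi1.add hi2).neg.integrableOn hi.integrableOn fun z => ?_
        have := Complex.abs_re_le_norm (q z * conj (v z))
        rw [norm_mul, RCLike.norm_conj] at this
        have h2 := neg_le_abs (q z * conj (v z)).re
        have h3 : -(q z * conj (v z)).re ≤ ‖q z‖ * ‖v z‖ := by linarith
        have h4 := mul_le_mul_of_nonneg_left h3 (Real.exp_pos z).le
        -- The term from differentiating the exponential enters with a favourable sign and is
        -- dropped. Hence l2 v does not appear in the bound.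
        have h5 : 0 ≤ Real.exp z * ‖v z‖ ^ 2 := by positivity
        rw [norm_expMul]
        dsimp only; linarith
    _ ≤ ∫ z, 2 * (‖q z‖ * ‖expMul v z‖) :=
        setIntegral_le_integral hi (ae_of_all _ fun z => by positivity)
    _ ≤ _ := by
        rw [integral_const_mul]
        exact mul_le_mul_of_nonneg_left (integral_norm_mul_le h.memLp_deriv h.memLp_exp) two_pos.le

end IsProfile

/-- This is where both ends of the range of β enter: the weight of the nonlinearity lies between the
weight 1 of the Hardy term and the weight e^(2x) of the mass. -/
theorem exp_mul_le_one_add {β : ℝ} (h0 : 0 ≤ β) (h2 : β ≤ 2) (x : ℝ) :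
    Real.exp (β * x) ≤ 1 + Real.exp x * Real.exp x := by
  rw [← Real.exp_add]
  rcases le_total x 0 with hx | hx
  · have : Real.exp (β * x) ≤ 1 := Real.exp_le_one_iff.2 (mul_nonpos_of_nonneg_of_nonpos h0 hx)
    have := Real.exp_pos (x + x); linarith
  · have : Real.exp (β * x) ≤ Real.exp (x + x) := Real.exp_le_exp.2 (by nlinarith)
    linarith

/-! ### The energy pairing and its boundedness on profiles -/

/-- The pairing of `P_c f - |x|^{-b} |f|^σ f` with `H¹` in logarithmic variables. -/
def energyPairing (β γ σ : ℝ) (v q w p : ℝ → ℂ) : ℂ :=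
  pair q p + γ * pair v w
    - ∫ x, ((Real.exp (β * x) * ‖v x‖ ^ σ : ℝ) : ℂ) * (v x * conj (w x))

section nonlinear

variable {β σ : ℝ} {v q w p : ℝ → ℂ}

theorem norm_nonlinear_le (hβ0 : 0 ≤ β) (hβ2 : β ≤ 2) (hσ : 0 ≤ σ) {K : ℝ}
    (hK : ∀ x, ‖v x‖ ≤ K) (w w' : ℝ → ℂ) (x : ℝ) :
    Real.exp (β * x) * ‖v x‖ ^ σ * (‖w x‖ * ‖w' x‖) ≤
      K ^ σ * (‖w x‖ * ‖w' x‖ + ‖expMul w x‖ * ‖expMul w' x‖) := by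
  rw [norm_expMul, norm_expMul]
  have h1 := exp_mul_le_one_add hβ0 hβ2 x
  have h2 : ‖v x‖ ^ σ ≤ K ^ σ := Real.rpow_le_rpow (norm_nonneg _) (hK x) hσ
  have h3 : 0 ≤ ‖v x‖ ^ σ := by positivity
  calc _ ≤ (1 + Real.exp x * Real.exp x) * K ^ σ * (‖w x‖ * ‖w' x‖) := by gcongr
    _ = _ := by ring

theorem integrable_profile_mul (hv : IsProfile v q) (hw : IsProfile w p) :
    Integrable fun x => ‖v x‖ * ‖w x‖ + ‖expMul v x‖ * ‖expMul w x‖ :=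
  (integrable_norm_mul hv.memLp hw.memLp).add (integrable_norm_mul hv.memLp_exp hw.memLp_exp)

theorem integral_profile_mul_le (hv : IsProfile v q) (hw : IsProfile w p) :
    ∫ x, (‖v x‖ * ‖w x‖ + ‖expMul v x‖ * ‖expMul w x‖) ≤
      2 * (profileNorm v q * profileNorm w p) := by
  rw [integral_add (integrable_norm_mul hv.memLp hw.memLp)
    (integrable_norm_mul hv.memLp_exp hw.memLp_exp)]
  have h1 := integral_norm_mul_le hv.memLp hw.memLp
  have h2 := integral_norm_mul_le hv.memLp_exp hw.memLp_exp
  have h3 := mul_le_mul (l2_le_profileNorm v q) (l2_le_profileNorm w p) (l2_nonneg _)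
    (profileNorm_nonneg v q)
  have h4 := mul_le_mul (l2_expMul_le_profileNorm v q) (l2_expMul_le_profileNorm w p) (l2_nonneg _)
    (profileNorm_nonneg v q)
  linarith

theorem continuous_nonlinear_weight (hσ : 0 ≤ σ) (hv : Continuous v) :
    Continuous fun x => Real.exp (β * x) * ‖v x‖ ^ σ :=
  (by fun_prop : Continuous fun x => Real.exp (β * x)).mul
    (hv.norm.rpow_const fun _ => Or.inr hσ)

theorem norm_integral_nonlinear_le (hβ0 : 0 ≤ β) (hβ2 : β ≤ 2) (hσ : 0 ≤ σ) (hv : IsProfile v q)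
    (hw : IsProfile w p) :
    ‖∫ x, ((Real.exp (β * x) * ‖v x‖ ^ σ : ℝ) : ℂ) * (v x * conj (w x))‖ ≤
      profileNorm v q ^ σ * (2 * (profileNorm v q * profileNorm w p)) := by
  refine (norm_integral_le_of_norm_le
    ((integrable_profile_mul hv hw).const_mul (profileNorm v q ^ σ))
    (ae_of_all _ fun x => ?_)).trans ?_
  · rw [norm_mul, norm_mul, RCLike.norm_conj, Complex.norm_real,
      Real.norm_of_nonneg (by positivity)]
    exact norm_nonlinear_le hβ0 hβ2 hσ hv.norm_le v w x
  · rw [integral_const_mul]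
    exact mul_le_mul_of_nonneg_left (integral_profile_mul_le hv hw)
      (Real.rpow_nonneg (profileNorm_nonneg v q) _)

/-- Boundedness of the Hamiltonian from the profile space to its dual, locally uniformly in v. It
yields the Lipschitz bound in time. -/
theorem norm_energyPairing_le {γ : ℝ} (hβ0 : 0 ≤ β) (hβ2 : β ≤ 2) (hσ : 0 ≤ σ)
    (hv : IsProfile v q) (hw : IsProfile w p) :
    ‖energyPairing β γ σ v q w p‖ ≤
      (1 + |γ| + 2 * profileNorm v q ^ σ) * profileNorm v q * profileNorm w p := by
  have h1 := norm_pair_le hv.memLp_deriv hw.memLp_deriv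
  have h2 := norm_pair_le hv.memLp hw.memLp
  have h3 := norm_integral_nonlinear_le hβ0 hβ2 hσ hv hw
  have h4 := mul_le_mul (l2_deriv_le_profileNorm v q) (l2_deriv_le_profileNorm w p) (l2_nonneg _)
    (profileNorm_nonneg v q)
  have h5 := mul_le_mul (l2_le_profileNorm v q) (l2_le_profileNorm w p) (l2_nonneg _)
    (profileNorm_nonneg v q)
  have h6 : ‖(γ : ℂ) * pair v w‖ ≤ |γ| * (profileNorm v q * profileNorm w p) := by
    rw [norm_mul, Complex.norm_real]
    exact mul_le_mul_of_nonneg_left (h2.trans h5) (abs_nonneg _)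
  have h7 := norm_sub_le (pair q p + γ * pair v w)
    (∫ x, ((Real.exp (β * x) * ‖v x‖ ^ σ : ℝ) : ℂ) * (v x * conj (w x)))
  have h8 := norm_add_le (pair q p) (γ * pair v w)
  unfold energyPairing
  nlinarith

end nonlinear

/-! ### Translations and difference quotients -/

/-- Translations act strongly continuously on L²; the pairing is an inner product with a fixed
vector. -/
theorem continuous_pair_comp_add {g q : ℝ → ℂ} (hg : MemLp g 2 volume) (hq : MemLp q 2 volume) :
    Continuous fun s : ℝ => pair g (fun x => q (x + s)) := by
  let T : ℝ → C(ℝ, ℝ) := fun s => ⟨fun x => x + s, by fun_prop⟩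
  have hT : Continuous T := ContinuousMap.continuous_of_continuous_uncurry _ (by
    change Continuous fun p : ℝ × ℝ => p.2 + p.1
    fun_prop)
  have hTm : ∀ s, MeasurePreserving (T s) volume volume := fun s =>
    measurePreserving_add_right volume s
  have hc : Continuous fun s => Lp.compMeasurePreserving (T s) (hTm s) (hq.toLp q) :=
    Continuous.compMeasurePreservingLp continuous_const hT hTm ENNReal.ofNat_ne_top
  have hi : Continuous fun s => inner ℂ (Lp.compMeasurePreserving (T s) (hTm s) (hq.toLp q))
      (hg.toLp g) := hc.inner continuous_const
  refine hi.congr fun s => ?_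
  rw [L2.inner_def]
  refine integral_congr_ae ?_
  have h1 : (Lp.compMeasurePreserving (T s) (hTm s) (hq.toLp q) : ℝ → ℂ) =ᵐ[volume]
      q ∘ T s := by
    rw [Lp.toLp_compMeasurePreserving hq (hTm s)]
    exact (hq.comp_measurePreserving (hTm s)).coeFn_toLp
  filter_upwards [h1, hg.coeFn_toLp] with x hx hx'
  rw [hx, hx', RCLike.inner_apply]
  rfl

/-- Fubini applied to v(x + δ) - v(x) = ∫ q(x + s) ds. Everything about difference quotients in weak
form follows from this average. -/
theorem pair_comp_add_sub {g v q : ℝ → ℂ} (h : IsPrimitive v q) (hg : MemLp g 2 volume)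
    (hq : MemLp q 2 volume) (δ : ℝ) :
    pair g (fun x => v (x + δ) - v x) = ∫ s in (0 : ℝ)..δ, pair g (fun x => q (x + s)) := by
  have hcq : MemLp (fun x => conj (q x)) 2 volume := memLp_conj hq
  have hmeas : AEStronglyMeasurable (fun z : ℝ × ℝ => g z.2 * conj (q (z.2 + z.1)))
      ((volume.restrict (uIoc 0 δ)).prod volume) := by
    refine (hg.1.comp_snd).mul ?_
    have := hcq.1.comp_quasiMeasurePreserving
      (quasiMeasurePreserving_add (volume.restrict (uIoc 0 δ)) (volume : Measure ℝ))
    refine this.congr (ae_of_all _ fun z => ?_)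
    simp [add_comm]
  have hint : Integrable (Function.uncurry fun s x => g x * conj (q (x + s)))
      ((volume.restrict (uIoc 0 δ)).prod volume) := by
    refine (integrable_prod_iff hmeas).2 ⟨ae_of_all _ fun s =>
      integrable_pair hg (memLp_comp_add_right hq s), ?_⟩
    have hfin : IsFiniteMeasure (volume.restrict (uIoc (0 : ℝ) δ)) :=
      ⟨by simp [uIoc]⟩
    refine (integrable_const (l2 g * l2 q)).mono' hmeas.norm.integral_prod_right'
      (ae_of_all _ fun s => ?_)
    rw [Real.norm_of_nonneg (integral_nonneg fun x => norm_nonneg _), ← l2_comp_add_right hq s]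
    refine le_trans (le_of_eq ?_) (integral_norm_mul_le hg (memLp_comp_add_right hq s))
    simp
  have hswap := intervalIntegral_integral_swap hint
  unfold pair
  rw [hswap]
  congr 1; ext x
  have h1 : v (x + δ) - v x = ∫ s in (0 : ℝ)..δ, q (x + s) := by
    rw [h.sub_eq, intervalIntegral.integral_comp_add_left]; simp
  dsimp only
  rw [h1, intervalIntegral.integral_const_mul]
  congr 1
  simp only [intervalIntegral, map_sub, integral_conj]

/-- The difference quotient of `v` paired with `g`. -/
def diffQuot (δ : ℝ) (g v : ℝ → ℂ) : ℂ := (δ : ℂ)⁻¹ * pair g (fun x => v (x + δ) - v x)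

theorem norm_diffQuot_le {g v q : ℝ → ℂ} (h : IsPrimitive v q) (hg : MemLp g 2 volume)
    (hq : MemLp q 2 volume) (δ : ℝ) : ‖diffQuot δ g v‖ ≤ l2 g * l2 q := by
  rcases eq_or_ne δ 0 with rfl | hδ
  · simp [diffQuot, mul_nonneg (l2_nonneg g) (l2_nonneg q)]
  rw [diffQuot, norm_mul, norm_inv, Complex.norm_real, pair_comp_add_sub h hg hq,
    inv_mul_le_iff₀ (norm_pos_iff.2 hδ)]
  have := intervalIntegral.norm_integral_le_of_norm_le_const (a := 0) (b := δ)
    (f := fun s => pair g (fun x => q (x + s))) (C := l2 g * l2 q) fun s _ => by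
      rw [← l2_comp_add_right hq s]
      exact norm_pair_le hg (memLp_comp_add_right hq s)
  rw [sub_zero] at this
  rw [mul_comm, Real.norm_eq_abs]; exact this

theorem tendsto_diffQuot {g v q : ℝ → ℂ} (h : IsPrimitive v q) (hg : MemLp g 2 volume)
    (hq : MemLp q 2 volume) :
    Tendsto (fun δ => diffQuot δ g v) (𝓝[≠] 0) (𝓝 (pair g q)) := by
  have hc := continuous_pair_comp_add hg hq
  have hd := intervalIntegral.integral_hasDerivAt_right (hc.intervalIntegrable 0 0)
    (hc.stronglyMeasurableAtFilter _ _) hc.continuousAt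
  rw [hasDerivAt_iff_tendsto_slope_zero] at hd
  simp only [add_zero, zero_add, intervalIntegral.integral_same, sub_zero] at hd
  refine hd.congr fun δ => ?_
  rw [diffQuot, pair_comp_add_sub h hg hq, Complex.real_smul, Complex.ofReal_inv]

/-! ### The equation on the line and derivatives of quadratic forms -/

/-- The pairing of radial functions in `L²(ℝ^d)` in logarithmic variables. -/
def massPairing (v w : ℝ → ℂ) : ℂ := pair (expMul v) (expMul w)

theorem massPairing_conj (v w : ℝ → ℂ) : conj (massPairing v w) = massPairing w v :=
  pair_conj _ _

theorem massPairing_sub_left {v q v' q' w p : ℝ → ℂ} (hv : IsProfile v q) (hv' : IsProfile v' q')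
    (hw : IsProfile w p) :
    massPairing (fun x => v x - v' x) w = massPairing v w - massPairing v' w := by
  rw [massPairing, massPairing, massPairing, ← pair_sub_left hv.memLp_exp hv'.memLp_exp hw.memLp_exp]
  congr 1; ext x; simp [expMul]; ring

theorem massPairing_sub_right {v q v' q' w p : ℝ → ℂ} (hv : IsProfile v q) (hv' : IsProfile v' q')
    (hw : IsProfile w p) :
    massPairing w (fun x => v x - v' x) = massPairing w v - massPairing w v' := by
  rw [← massPairing_conj, massPairing_sub_left hv hv' hw, map_sub, massPairing_conj,
    massPairing_conj]

theorem profileNorm_sub_comm (v q w p : ℝ → ℂ) :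
    profileNorm (fun x => v x - w x) (fun x => q x - p x) =
      profileNorm (fun x => w x - v x) (fun x => p x - q x) := by
  have h : ∀ v w : ℝ → ℂ, expMul (fun x => v x - w x) = fun x => expMul v x - expMul w x := by
    intro v w; ext x; simp [expMul]; ring
  simp only [profileNorm, h]
  rw [l2_sub_comm v w, l2_sub_comm q p, l2_sub_comm (expMul v)]

theorem profileNorm_le_add {v q w p : ℝ → ℂ} (hv : IsProfile v q) (hw : IsProfile w p) :
    profileNorm v q ≤ profileNorm (fun x => v x - w x) (fun x => q x - p x) + profileNorm w p := by
  have h1 := l2_add_le (hv.sub hw).memLp hw.memLp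
  have h2 := l2_add_le (hv.sub hw).memLp_deriv hw.memLp_deriv
  have h3 := l2_add_le (hv.sub hw).memLp_exp hw.memLp_exp
  have h : (fun x => expMul (fun x => v x - w x) x + expMul w x) = expMul v := by
    ext x; simp [expMul]; ring
  rw [h] at h3
  simp only [sub_add_cancel] at h1 h2
  unfold profileNorm
  linarith

/-- A solution of the equation in logarithmic variables. -/
structure IsProfileSolution (β γ σ : ℝ) (I : Set ℝ) (v q : ℝ → ℝ → ℂ) : Prop where
  isProfile : ∀ t ∈ I, IsProfile (v t) (q t)
  tendsto : ∀ t ∈ I, Tendsto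
    (fun s => profileNorm (fun x => v s x - v t x) (fun x => q s x - q t x)) (𝓝[I] t) (𝓝 0)
  equation : ∀ w p, IsProfile w p → ∀ t ∈ I,
    HasDerivWithinAt (fun s => massPairing (v s) w)
      (-Complex.I * energyPairing β γ σ (v t) (q t) w p) I t

/-- Bounded operators on profiles together with their adjoints for the mass pairing. Each operator
is given by its action on a profile and on the derivative of the profile. -/
structure IsAdjointPair (T T' : (ℝ → ℂ) → ℝ → ℂ) (D D' : (ℝ → ℂ) → (ℝ → ℂ) → ℝ → ℂ) (C : ℝ) :
    Prop where
  isProfile : ∀ {v q}, IsProfile v q → IsProfile (T v) (D v q)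
  isProfile' : ∀ {v q}, IsProfile v q → IsProfile (T' v) (D' v q)
  map_sub : ∀ v w, T (fun x => v x - w x) = fun x => T v x - T w x
  norm_le : ∀ {v q}, IsProfile v q → profileNorm (T' v) (D' v q) ≤ C * profileNorm v q
  adjoint : ∀ {v q w p}, IsProfile v q → IsProfile w p →
    massPairing (T v) w = massPairing v (T' w)

namespace IsProfileSolution

variable {β γ σ : ℝ} {I : Set ℝ} {v q : ℝ → ℝ → ℂ}

theorem eventually_profileNorm_le (h : IsProfileSolution β γ σ I v q) {t : ℝ} (ht : t ∈ I) :
    ∀ᶠ s in 𝓝[I] t, profileNorm (v s) (q s) ≤ profileNorm (v t) (q t) + 1 := by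
  filter_upwards [(h.tendsto t ht).eventually (gt_mem_nhds one_pos), self_mem_nhdsWithin]
    with s hs hsI
  have := profileNorm_le_add (h.isProfile s hsI) (h.isProfile t ht)
  linarith

/-- Mean value inequality for s ↦ ⟨v(s), w⟩, whose derivative is bounded by the energy pairing. One
neighbourhood and one constant serve all w, so w may later depend on s. -/
theorem lipschitz (h : IsProfileSolution β γ σ I v q) (hI : I.OrdConnected) (hβ0 : 0 ≤ β)
    (hβ2 : β ≤ 2) (hσ : 0 ≤ σ) {t : ℝ} (ht : t ∈ I) :
    ∃ K : ℝ, 0 ≤ K ∧ ∀ᶠ s in 𝓝[I] t, ∀ w p, IsProfile w p →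
      ‖massPairing (fun x => v s x - v t x) w‖ ≤ K * profileNorm w p * |s - t| := by
  set N := profileNorm (v t) (q t) + 1 with hN
  have hN0 : 0 ≤ N := add_nonneg (profileNorm_nonneg _ _) zero_le_one
  obtain ⟨η, hη, hball⟩ := Metric.mem_nhdsWithin_iff.1 (h.eventually_profileNorm_le ht)
  have hE : ∀ s ∈ Metric.ball t η ∩ I, ∀ w p, IsProfile w p →
      ‖-Complex.I * energyPairing β γ σ (v s) (q s) w p‖ ≤
        (1 + |γ| + 2 * N ^ σ) * N * profileNorm w p := fun s hs w p hw => by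
    rw [norm_mul, norm_neg, Complex.norm_I, one_mul]
    refine (norm_energyPairing_le hβ0 hβ2 hσ (h.isProfile s hs.2) hw).trans ?_
    have h1 : profileNorm (v s) (q s) ≤ N := hball hs
    have h2 := profileNorm_nonneg (v s) (q s)
    have h3 := profileNorm_nonneg w p
    gcongr
  refine ⟨(1 + |γ| + 2 * N ^ σ) * N, by positivity, ?_⟩
  filter_upwards [inter_mem_nhdsWithin I (Metric.ball_mem_nhds t hη), self_mem_nhdsWithin]
    with s hs hsI w p hw
  -- The mean value inequality needs a convex set; here it is an interval, possibly one-sided at t.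
  have hconv : Convex ℝ (Metric.ball t η ∩ I) := (convex_ball t η).inter hI.convex
  have := hconv.norm_image_sub_le_of_norm_hasDerivWithin_le
    (fun r hr => (h.equation w p hw r hr.2).mono inter_subset_right)
    (fun r hr => hE r hr w p hw) (x := t) (y := s) ⟨Metric.mem_ball_self hη, ht⟩ ⟨hs.2, hs.1⟩
  rwa [← massPairing_sub_left (h.isProfile s hsI) (h.isProfile t ht) hw] at this

/-- The time derivative of a quadratic expression in a solution. -/
theorem hasDerivWithinAt_quadratic (h : IsProfileSolution β γ σ I v q) (hI : I.OrdConnected)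
    (hβ0 : 0 ≤ β) (hβ2 : β ≤ 2) (hσ : 0 ≤ σ) {T T' : (ℝ → ℂ) → ℝ → ℂ}
    {D D' : (ℝ → ℂ) → (ℝ → ℂ) → ℝ → ℂ} {C : ℝ} (hT : IsAdjointPair T T' D D' C)
    {t : ℝ} (ht : t ∈ I) :
    HasDerivWithinAt (fun s => massPairing (T (v s)) (v s))
      (-Complex.I * energyPairing β γ σ (v t) (q t) (T' (v t)) (D' (v t) (q t)) +
        conj (-Complex.I * energyPairing β γ σ (v t) (q t) (T (v t)) (D (v t) (q t)))) I t := by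
  obtain ⟨K, hK0, hK⟩ := h.lipschitz hI hβ0 hβ2 hσ ht
  have hvt := h.isProfile t ht
  have d1 := h.equation _ _ (hT.isProfile' hvt) t ht
  have d2 := (h.equation _ _ (hT.isProfile hvt) t ht).star
  -- The quadratic remainder: the Lipschitz bound gives K |s - t| times the profile norm of T'(v(s)
  -- - v(t)), which tends to 0 by continuity in H¹.
  have d3 : HasDerivWithinAt (fun s => massPairing (fun x => v s x - v t x)
      (T' (fun x => v s x - v t x))) 0 I t := by
    rw [hasDerivWithinAt_iff_isLittleO]
    have h0 : massPairing (fun x => v t x - v t x) (T' (fun x => v t x - v t x)) = 0 := by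
      simp [massPairing, pair, expMul]
    simp only [h0, sub_zero, smul_zero]
    have hsm : Tendsto (fun s => K * (C * profileNorm (fun x => v s x - v t x)
        (fun x => q s x - q t x))) (𝓝[I] t) (𝓝 0) := by
      simpa using ((h.tendsto t ht).const_mul C).const_mul K
    refine Asymptotics.isLittleO_iff.2 fun c hc => ?_
    filter_upwards [hK, hsm.eventually (gt_mem_nhds hc), self_mem_nhdsWithin] with s hs hs' hsI
    have hsub := (h.isProfile s hsI).sub hvt
    refine (hs _ _ (hT.isProfile' hsub)).trans ?_
    rw [Real.norm_eq_abs]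
    refine mul_le_mul_of_nonneg_right (le_trans ?_ hs'.le) (abs_nonneg _)
    exact mul_le_mul_of_nonneg_left (hT.norm_le hsub) hK0
  -- Polarisation: ⟨T v(s), v(s)⟩ is two terms linear in v(s), plus the remainder, minus the
  -- constant ⟨T v(t), v(t)⟩.
  have hsum := ((d1.add d2).add d3).sub_const (massPairing (T (v t)) (v t))
  rw [add_zero] at hsum
  refine hsum.congr_of_mem (fun s hs => ?_) ht
  have hvs := h.isProfile s hs
  have hsub := hvs.sub hvt
  have e1 : massPairing (fun x => v s x - v t x) (T' (fun x => v s x - v t x)) =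
      massPairing (T (fun x => v s x - v t x)) (fun x => v s x - v t x) :=
    (hT.adjoint hsub hsub).symm
  have e2 := hT.adjoint hvs hvt
  have e3 : star (massPairing (v s) (T (v t))) = massPairing (T (v t)) (v s) :=
    massPairing_conj _ _
  simp only [Pi.add_apply]
  rw [e1, hT.map_sub, massPairing_sub_left (hT.isProfile hvs) (hT.isProfile hvt) hsub,
    massPairing_sub_right hvs hvt (hT.isProfile hvs),
    massPairing_sub_right hvs hvt (hT.isProfile hvt), e3, ← e2]
  ring

end IsProfileSolution

/-! ### Multipliers and translations as operators on profiles -/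

/-- `m` is a `C²` function with bounded derivatives `m'`, `m''` and vanishes on `(X, ∞)`. -/
structure IsCutoff (m m' m'' : ℝ → ℝ) (X C : ℝ) : Prop where
  hasDerivAt : ∀ x, HasDerivAt m (m' x) x
  hasDerivAt' : ∀ x, HasDerivAt m' (m'' x) x
  continuous_deriv2 : Continuous m''
  le : ∀ x, |m x| ≤ C
  le' : ∀ x, |m' x| ≤ C
  le'' : ∀ x, |m'' x| ≤ C
  eq_zero : ∀ x, X < x → m x = 0
  eq_zero' : ∀ x, X < x → m' x = 0

theorem IsCutoff.continuous {m m' m'' : ℝ → ℝ} {X C : ℝ} (hm : IsCutoff m m' m'' X C) :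
    Continuous m :=
  continuous_iff_continuousAt.2 fun x => (hm.hasDerivAt x).continuousAt

theorem IsCutoff.continuous_deriv {m m' m'' : ℝ → ℝ} {X C : ℝ} (hm : IsCutoff m m' m'' X C) :
    Continuous m' :=
  continuous_iff_continuousAt.2 fun x => (hm.hasDerivAt' x).continuousAt

theorem profileNorm_ofReal_mul_le {m m' : ℝ → ℝ} {v q : ℝ → ℂ} {C : ℝ} (h : IsProfile v q)
    (hm : Continuous m) (hm' : Continuous m') (hC : ∀ x, |m x| ≤ C) (hC' : ∀ x, |m' x| ≤ C) :
    profileNorm (fun x => (m x : ℂ) * v x) (fun x => (m' x : ℂ) * v x + (m x : ℂ) * q x) ≤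
      2 * C * profileNorm v q := by
  have hC0 : 0 ≤ C := (abs_nonneg _).trans (hC 0)
  have h1 := l2_ofReal_mul_le hC h.memLp
  have h2 := (l2_add_le (memLp_ofReal_mul hm' hC' h.memLp)
    (memLp_ofReal_mul hm hC h.memLp_deriv)).trans
      (add_le_add (l2_ofReal_mul_le hC' h.memLp) (l2_ofReal_mul_le hC h.memLp_deriv))
  have h3 := l2_ofReal_mul_le hC h.memLp_exp
  have e : expMul (fun x => (m x : ℂ) * v x) = fun x => (m x : ℂ) * expMul v x := by
    ext x; simp only [expMul]; ring
  unfold profileNorm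
  rw [e]
  have := mul_nonneg hC0 (l2_nonneg (expMul v))
  have := mul_nonneg hC0 (l2_nonneg q)
  linarith

/-- Only the weighted component fails to be translation invariant; it picks up the factor e^(-δ). -/
theorem profileNorm_comp_add_right_le {v q : ℝ → ℂ} (h : IsProfile v q) (δ : ℝ) :
    profileNorm (fun x => v (x + δ)) (fun x => q (x + δ)) ≤
      (1 + Real.exp (-δ)) * profileNorm v q := by
  have h3 : l2 (expMul fun x => v (x + δ)) ≤ Real.exp (-δ) * l2 (expMul v) := by
    rw [← l2_comp_add_right h.memLp_exp δ]
    refine l2_le_of_le_mul (Real.exp_pos _).le (memLp_comp_add_right h.memLp_exp δ) fun x => ?_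
    rw [norm_expMul, norm_expMul, ← mul_assoc, ← Real.exp_add]
    simp
  unfold profileNorm
  rw [l2_comp_add_right h.memLp, l2_comp_add_right h.memLp_deriv]
  have := Real.exp_pos (-δ)
  nlinarith [l2_nonneg v, l2_nonneg q, l2_nonneg (expMul v), mul_nonneg this.le (l2_nonneg v),
    mul_nonneg this.le (l2_nonneg q)]

theorem profileNorm_const_mul_le {v q : ℝ → ℂ} (h : IsProfile v q) {a : ℝ} (ha : 0 ≤ a) :
    profileNorm (fun x => (a : ℂ) * v x) (fun x => (a : ℂ) * q x) ≤ a * profileNorm v q := by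
  have hC : ∀ x : ℝ, |(fun _ => a) x| ≤ a := fun x => (abs_of_nonneg ha).le
  have h1 := l2_ofReal_mul_le hC h.memLp
  have h2 := l2_ofReal_mul_le hC h.memLp_deriv
  have h3 := l2_ofReal_mul_le hC h.memLp_exp
  have e : expMul (fun x => (a : ℂ) * v x) = fun x => (a : ℂ) * expMul v x := by
    ext x; simp only [expMul]; ring
  unfold profileNorm
  rw [e]
  linarith

theorem massPairing_ofReal_mul (m : ℝ → ℝ) (v w : ℝ → ℂ) :
    massPairing (fun x => (m x : ℂ) * v x) w = massPairing v (fun x => (m x : ℂ) * w x) := by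
  rw [massPairing, massPairing, pair, pair]
  congr 1; ext x; simp [expMul]; ring

/-- Multiplication by a real function. -/
theorem isAdjointPair_ofReal_mul {m m' : ℝ → ℝ} {C : ℝ} (hm : ∀ x, HasDerivAt m (m' x) x)
    (hm' : Continuous m') (hC : ∀ x, |m x| ≤ C) (hC' : ∀ x, |m' x| ≤ C) :
    IsAdjointPair (fun v x => (m x : ℂ) * v x) (fun v x => (m x : ℂ) * v x)
      (fun v q x => (m' x : ℂ) * v x + (m x : ℂ) * q x)
      (fun v q x => (m' x : ℂ) * v x + (m x : ℂ) * q x) (2 * C) where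
  isProfile h := h.ofReal_mul hm hm' hC hC'
  isProfile' h := h.ofReal_mul hm hm' hC hC'
  map_sub v w := by ext x; ring
  norm_le h := profileNorm_ofReal_mul_le h
    (continuous_iff_continuousAt.2 fun x => (hm x).continuousAt) hm' hC hC'
  adjoint _ _ := massPairing_ofReal_mul m _ _

/-- The operator `v ↦ m v(· + δ)` and its adjoint. -/
theorem isAdjointPair_mul_translate {m m' m'' : ℝ → ℝ} {X C : ℝ} (hm : IsCutoff m m' m'' X C)
    (δ : ℝ) :
    IsAdjointPair (fun v x => (m x : ℂ) * v (x + δ))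
      (fun v x => (Real.exp (-2 * δ) : ℂ) * ((m (x + -δ) : ℂ) * v (x + -δ)))
      (fun v q x => (m' x : ℂ) * v (x + δ) + (m x : ℂ) * q (x + δ))
      (fun v q x => (Real.exp (-2 * δ) : ℂ) *
        ((m' (x + -δ) : ℂ) * v (x + -δ) + (m (x + -δ) : ℂ) * q (x + -δ)))
      (Real.exp (-2 * δ) * ((1 + Real.exp (- -δ)) * (2 * C))) where
  isProfile h := (h.comp_add_right δ).ofReal_mul hm.hasDerivAt hm.continuous_deriv hm.le hm.le'
  isProfile' h := ((h.ofReal_mul hm.hasDerivAt hm.continuous_deriv hm.le hm.le').comp_add_right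
    (-δ)).const_mul _
  map_sub v w := by ext x; ring
  norm_le h := by
    have h1 := h.ofReal_mul hm.hasDerivAt hm.continuous_deriv hm.le hm.le'
    refine (profileNorm_const_mul_le (h1.comp_add_right (-δ)) (Real.exp_pos _).le).trans ?_
    rw [mul_assoc]
    refine mul_le_mul_of_nonneg_left ?_ (Real.exp_pos _).le
    refine (profileNorm_comp_add_right_le h1 (-δ)).trans ?_
    rw [mul_assoc]
    exact mul_le_mul_of_nonneg_left (profileNorm_ofReal_mul_le h hm.continuous
      hm.continuous_deriv hm.le hm.le') (by positivity)
  adjoint {v q w p} _ _ := by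
    rw [massPairing, massPairing, pair, pair,
      ← integral_add_right_eq_self (fun x => expMul v x * conj (expMul _ x)) δ]
    congr 1; ext x
    simp only [expMul, map_mul, Complex.conj_ofReal, add_neg_cancel_right]
    -- The mass pairing carries the weight e^(2x). The factor e^(-2δ) in the adjoint compensates for
    -- shifting this weight.
    have e : Real.exp (x + δ) * Real.exp (-2 * δ) * Real.exp (x + δ) =
        Real.exp x * Real.exp x := by
      rw [← Real.exp_add, ← Real.exp_add, ← Real.exp_add]; ring_nf
    have e' : (Real.exp (x + δ) * Real.exp (-2 * δ) * Real.exp (x + δ) : ℂ) =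
        Real.exp x * Real.exp x := by exact_mod_cast e
    linear_combination (-(m x : ℂ) * v (x + δ) * conj (w x)) * e'

/-! ### The rate of change of the approximate momentum -/

/-- The nonlinearity in logarithmic variables, cut off at `X`. -/
def cutNonlinearity (β σ X : ℝ) (v : ℝ → ℂ) : ℝ → ℂ :=
  (Iic X).indicator fun x => ((Real.exp (β * x) * ‖v x‖ ^ σ : ℝ) : ℂ) * v x

section cutNonlinearity

variable {β γ σ X : ℝ} {v q w p : ℝ → ℂ}

theorem norm_cutNonlinearity_le (hβ : 0 ≤ β) (hσ : 0 ≤ σ) (hv : IsProfile v q) (x : ℝ) :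
    ‖cutNonlinearity β σ X v x‖ ≤ Real.exp (β * X) * profileNorm v q ^ σ * ‖v x‖ := by
  by_cases hx : x ∈ Iic X
  · rw [cutNonlinearity, indicator_of_mem hx, norm_mul, Complex.norm_real,
      Real.norm_of_nonneg (by positivity)]
    have h1 : Real.exp (β * x) ≤ Real.exp (β * X) :=
      Real.exp_le_exp.2 (mul_le_mul_of_nonneg_left hx hβ)
    have h2 : ‖v x‖ ^ σ ≤ profileNorm v q ^ σ :=
      Real.rpow_le_rpow (norm_nonneg _) (hv.norm_le x) hσ
    gcongr
  · rw [cutNonlinearity, indicator_of_notMem hx, norm_zero]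
    have := profileNorm_nonneg v q
    positivity

theorem memLp_cutNonlinearity (hβ : 0 ≤ β) (hσ : 0 ≤ σ) (hv : IsProfile v q) :
    MemLp (cutNonlinearity β σ X v) 2 volume := by
  refine hv.memLp.of_le_mul ?_ (ae_of_all _ (norm_cutNonlinearity_le hβ hσ hv))
  refine AEStronglyMeasurable.indicator ?_ measurableSet_Iic
  exact ((Complex.continuous_ofReal.comp (continuous_nonlinear_weight hσ hv.prim.continuous)).mul
    hv.prim.continuous).aestronglyMeasurable

/-- To the left of X the exponential weight is bounded, so the nonlinearity can be treated as an L²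
function. Test functions vanishing beyond X do not see the cutoff. -/
theorem l2_cutNonlinearity_le (hβ : 0 ≤ β) (hσ : 0 ≤ σ) (hv : IsProfile v q) :
    l2 (cutNonlinearity β σ X v) ≤ Real.exp (β * X) * profileNorm v q ^ σ * l2 v :=
  l2_le_of_le_mul (mul_nonneg (Real.exp_pos _).le (Real.rpow_nonneg (profileNorm_nonneg _ _) _))
    hv.memLp (norm_cutNonlinearity_le hβ hσ hv)

theorem energyPairing_eq_pair (hw : ∀ x, X < x → w x = 0) :
    energyPairing β γ σ v q w p =
      pair q p + γ * pair v w - pair (cutNonlinearity β σ X v) w := by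
  rw [energyPairing]
  congr 1
  rw [pair]
  congr 1; ext x
  by_cases hx : x ∈ Iic X
  · rw [cutNonlinearity, indicator_of_mem hx]; ring
  · rw [hw x (not_le.1 hx)]; simp

end cutNonlinearity

theorem pair_comp_add_left_eq (f g : ℝ → ℂ) (δ : ℝ) :
    pair f (fun x => g (x + -δ)) = pair (fun x => f (x + δ)) g := by
  rw [← pair_comp_add_right f _ δ]
  simp

/-- The rate of change of the difference quotient approximation of the virial derivative. -/
def approxRate (β γ σ : ℝ) (m m' : ℝ → ℝ) (δ : ℝ) (v q : ℝ → ℂ) : ℝ :=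
  2 / δ * (energyPairing β γ σ v q (fun x => (m x : ℂ) * v (x + δ))
      (fun x => (m' x : ℂ) * v (x + δ) + (m x : ℂ) * q (x + δ)) -
    energyPairing β γ σ v q
      (fun x => (Real.exp (-2 * δ) : ℂ) * ((m (x + -δ) : ℂ) * v (x + -δ)))
      (fun x => (Real.exp (-2 * δ) : ℂ) *
        ((m' (x + -δ) : ℂ) * v (x + -δ) + (m (x + -δ) : ℂ) * q (x + -δ)))).re

/-- The second time derivative of the virial in terms of pairings. -/
def pairRate (β γ σ X : ℝ) (m m' m'' : ℝ → ℝ) (v q : ℝ → ℂ) : ℝ :=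
  2 * (pair (fun x => (m' x : ℂ) * q x) q + pair q (fun x => (m'' x : ℂ) * v x + (m' x : ℂ) * q x)
    + 2 * pair q (fun x => (m' x : ℂ) * v x) + 2 * pair (fun x => (m x : ℂ) * q x) q
    + γ * (2 * pair (fun x => (m x : ℂ) * v x) v)
    - (pair (fun x => (m x : ℂ) * cutNonlinearity β σ (X + 1) v x) q
      + pair (cutNonlinearity β σ (X + 1) v) (fun x => (m' x : ℂ) * v x + (m x : ℂ) * q x)
      + 2 * pair (cutNonlinearity β σ (X + 1) v) (fun x => (m x : ℂ) * v x))).re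

section rate

variable {β γ σ X C : ℝ} {m m' m'' : ℝ → ℝ} {v q : ℝ → ℂ}

/-- The shift by δ and its adjoint produce conjugate pairings of m q and m v with their translates.
In the real part of the difference these cancel except for the factor 1 - e^(-2δ), which is of order
δ. In the other terms the increment falls on v, m v or m' v, each of which has an L² derivative.
Hence division by δ never requires a second derivative of v or a derivative of the nonlinearity. -/
theorem approxRate_eq (hm : IsCutoff m m' m'' X C) (hβ : 0 ≤ β) (hσ : 0 ≤ σ) (hv : IsProfile v q)
    {δ : ℝ} (hδ : 0 < δ) (hδ1 : δ ≤ 1) :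
    approxRate β γ σ m m' δ v q =
      2 * (diffQuot δ (fun x => (m' x : ℂ) * q x) v
        + (Real.exp (-2 * δ) : ℂ) * diffQuot (-δ) q (fun x => (m' x : ℂ) * v x)
        + ((1 - Real.exp (-2 * δ)) / δ : ℝ) * pair q (fun x => (m' x : ℂ) * v x)
        + ((1 - Real.exp (-2 * δ)) / δ : ℝ) * pair (fun x => (m x : ℂ) * q x) (fun x => q (x + δ))
        + γ * (((1 - Real.exp (-2 * δ)) / δ : ℝ) *
            pair (fun x => (m x : ℂ) * v x) (fun x => v (x + δ)))
        - (diffQuot δ (fun x => (m x : ℂ) * cutNonlinearity β σ (X + 1) v x) v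
          + (Real.exp (-2 * δ) : ℂ) *
              diffQuot (-δ) (cutNonlinearity β σ (X + 1) v) (fun x => (m x : ℂ) * v x)
          + ((1 - Real.exp (-2 * δ)) / δ : ℝ) *
              pair (cutNonlinearity β σ (X + 1) v) (fun x => (m x : ℂ) * v x))).re := by
  set g := cutNonlinearity β σ (X + 1) v with hgdef
  have hg : MemLp g 2 volume := memLp_cutNonlinearity hβ hσ hv
  have hmc := hm.continuous
  have hm'c := hm.continuous_deriv
  have hmv := memLp_ofReal_mul hmc hm.le hv.memLp
  have hmq := memLp_ofReal_mul hmc hm.le hv.memLp_deriv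
  have hm'v := memLp_ofReal_mul hm'c hm.le' hv.memLp
  have hm'q := memLp_ofReal_mul hm'c hm.le' hv.memLp_deriv
  have hmg := memLp_ofReal_mul hmc hm.le hg
  have hτv := memLp_comp_add_right hv.memLp δ
  have hτq := memLp_comp_add_right hv.memLp_deriv δ
  have b1 : energyPairing β γ σ v q (fun x => (m x : ℂ) * v (x + δ))
      (fun x => (m' x : ℂ) * v (x + δ) + (m x : ℂ) * q (x + δ)) =
      (pair (fun x => (m' x : ℂ) * q x) (fun x => v (x + δ))
        + pair (fun x => (m x : ℂ) * q x) (fun x => q (x + δ)))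
      + γ * pair (fun x => (m x : ℂ) * v x) (fun x => v (x + δ))
      - pair (fun x => (m x : ℂ) * g x) (fun x => v (x + δ)) := by
    -- The cutoff is at X + 1 rather than X because the adjoint shifts the support of m to the right
    -- by δ ≤ 1. The same cutoff then serves both pairings.
    rw [energyPairing_eq_pair (X := X + 1) (fun x hx => by rw [hm.eq_zero x (by linarith)]; simp),
      pair_add_right (memLp_ofReal_mul hm'c hm.le' hτv) (memLp_ofReal_mul hmc hm.le hτq)
        hv.memLp_deriv, pair_real_mul, pair_real_mul, pair_real_mul, pair_real_mul]
  have b2 : energyPairing β γ σ v q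
      (fun x => (Real.exp (-2 * δ) : ℂ) * ((m (x + -δ) : ℂ) * v (x + -δ)))
      (fun x => (Real.exp (-2 * δ) : ℂ) *
        ((m' (x + -δ) : ℂ) * v (x + -δ) + (m (x + -δ) : ℂ) * q (x + -δ))) =
      Real.exp (-2 * δ) * ((pair q (fun x => (m' (x + -δ) : ℂ) * v (x + -δ))
        + conj (pair (fun x => (m x : ℂ) * q x) (fun x => q (x + δ))))
      + γ * conj (pair (fun x => (m x : ℂ) * v x) (fun x => v (x + δ)))
      - pair g (fun x => (m (x + -δ) : ℂ) * v (x + -δ))) := by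
    rw [energyPairing_eq_pair (X := X + 1) (fun x hx => by
        rw [hm.eq_zero (x + -δ) (by linarith)]; simp),
      pair_smul_right, pair_smul_right, pair_smul_right,
      pair_add_right (memLp_comp_add_right hm'v (-δ)) (memLp_comp_add_right hmq (-δ))
        hv.memLp_deriv, pair_conj, pair_conj,
      pair_comp_add_left_eq q (fun x => (m x : ℂ) * q x),
      pair_comp_add_left_eq v (fun x => (m x : ℂ) * v x)]
    ring
  have hδ0 : (δ : ℂ) ≠ 0 := by exact_mod_cast hδ.ne'
  -- Each remaining translate is split into δ times a difference quotient and its value at δ = 0.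
  -- The values at δ = 0 combine with the factor 1 - e^(-2δ).
  have c1 : pair (fun x => (m' x : ℂ) * q x) (fun x => v (x + δ)) =
      δ * diffQuot δ (fun x => (m' x : ℂ) * q x) v + pair q (fun x => (m' x : ℂ) * v x) := by
    rw [diffQuot, pair_sub_right hτv hv.memLp hm'q, ← pair_real_mul m' q v]
    field_simp; ring
  have c2 : pair (fun x => (m x : ℂ) * g x) (fun x => v (x + δ)) =
      δ * diffQuot δ (fun x => (m x : ℂ) * g x) v + pair g (fun x => (m x : ℂ) * v x) := by
    rw [diffQuot, pair_sub_right hτv hv.memLp hmg, ← pair_real_mul m g v]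
    field_simp; ring
  have c3 : pair q (fun x => (m' (x + -δ) : ℂ) * v (x + -δ)) =
      -δ * diffQuot (-δ) q (fun x => (m' x : ℂ) * v x) + pair q (fun x => (m' x : ℂ) * v x) := by
    rw [diffQuot, pair_sub_right (memLp_comp_add_right hm'v (-δ)) hm'v hv.memLp_deriv]
    push_cast
    field_simp; ring
  have c4 : pair g (fun x => (m (x + -δ) : ℂ) * v (x + -δ)) =
      -δ * diffQuot (-δ) g (fun x => (m x : ℂ) * v x) + pair g (fun x => (m x : ℂ) * v x) := by
    rw [diffQuot, pair_sub_right (memLp_comp_add_right hmv (-δ)) hmv hg]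
    push_cast
    field_simp; ring
  rw [approxRate, b1, b2, c1, c2, c3, c4]
  simp only [Complex.add_re, Complex.sub_re, Complex.re_ofReal_mul, Complex.conj_re, neg_mul,
    Complex.neg_re]
  field_simp
  ring

theorem tendsto_one_sub_exp_div :
    Tendsto (fun δ : ℝ => (1 - Real.exp (-2 * δ)) / δ) (𝓝[≠] 0) (𝓝 2) := by
  have hd : HasDerivAt (fun δ : ℝ => 1 - Real.exp (-2 * δ)) 2 0 := by
    have := ((hasDerivAt_id (0 : ℝ)).const_mul (-2)).exp.const_sub 1
    simpa using this
  rw [hasDerivAt_iff_tendsto_slope_zero] at hd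
  refine hd.congr fun δ => ?_
  simp [div_eq_inv_mul]

/-- Every difference quotient tends to the pairing with the true derivative and (1 - e^(-2δ))/δ
tends to 2, which accounts for the factors 2 in `pairRate`. -/
theorem tendsto_approxRate (hm : IsCutoff m m' m'' X C) (hβ : 0 ≤ β) (hσ : 0 ≤ σ)
    (hv : IsProfile v q) :
    Tendsto (fun δ => approxRate β γ σ m m' δ v q) (𝓝[>] 0)
      (𝓝 (pairRate β γ σ X m m' m'' v q)) := by
  set g := cutNonlinearity β σ (X + 1) v with hgdef
  have hg : MemLp g 2 volume := memLp_cutNonlinearity hβ hσ hv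
  have hmc := hm.continuous
  have hm'c := hm.continuous_deriv
  have hmv := memLp_ofReal_mul hmc hm.le hv.memLp
  have hmq := memLp_ofReal_mul hmc hm.le hv.memLp_deriv
  have hm'v := memLp_ofReal_mul hm'c hm.le' hv.memLp
  have hm'q := memLp_ofReal_mul hm'c hm.le' hv.memLp_deriv
  have hm''v := memLp_ofReal_mul hm.continuous_deriv2 hm.le'' hv.memLp
  have hmg := memLp_ofReal_mul hmc hm.le hg
  have hle : 𝓝[>] (0 : ℝ) ≤ 𝓝[≠] 0 := nhdsWithin_mono _ fun x hx => ne_of_gt hx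
  have hneg : Tendsto (fun δ : ℝ => -δ) (𝓝[>] 0) (𝓝[≠] 0) := by
    refine tendsto_nhdsWithin_iff.2 ⟨?_, ?_⟩
    · have : Tendsto (fun δ : ℝ => -δ) (𝓝 0) (𝓝 (-0)) := continuous_neg.tendsto 0
      rw [neg_zero] at this
      exact this.mono_left nhdsWithin_le_nhds
    · filter_upwards [self_mem_nhdsWithin] with δ hδ
      simpa using ne_of_gt hδ
  have hc : Tendsto (fun δ : ℝ => (((1 - Real.exp (-2 * δ)) / δ : ℝ) : ℂ)) (𝓝[>] 0) (𝓝 2) := by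
    have := (Complex.continuous_ofReal.tendsto 2).comp (tendsto_one_sub_exp_div.mono_left hle)
    simpa only [Complex.ofReal_ofNat, Function.comp_def] using this
  have he : Tendsto (fun δ : ℝ => (Real.exp (-2 * δ) : ℂ)) (𝓝[>] 0) (𝓝 1) := by
    have : Continuous fun δ : ℝ => (Real.exp (-2 * δ) : ℂ) := by fun_prop
    have := this.tendsto 0
    simp only [mul_zero, Real.exp_zero, Complex.ofReal_one] at this
    exact this.mono_left nhdsWithin_le_nhds
  have hpair : ∀ {f r : ℝ → ℂ}, MemLp f 2 volume → MemLp r 2 volume →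
      Tendsto (fun δ : ℝ => pair f (fun x => r (x + δ))) (𝓝[>] 0) (𝓝 (pair f r)) :=
    fun hf hr => by
      have := (continuous_pair_comp_add hf hr).tendsto 0
      simp only [add_zero] at this
      exact this.mono_left nhdsWithin_le_nhds
  have pv := hv.prim
  have t1 := (tendsto_diffQuot pv hm'q hv.memLp_deriv).mono_left hle
  have t2 := he.mul ((tendsto_diffQuot (pv.ofReal_mul hm.hasDerivAt' hm.continuous_deriv2)
    hv.memLp_deriv (hm''v.add hm'q)).comp hneg)
  have t3 := hc.mul_const (pair q (fun x => (m' x : ℂ) * v x))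
  have t4 := hc.mul (hpair hmq hv.memLp_deriv)
  have t5 := (hc.mul (hpair hmv hv.memLp)).const_mul (γ : ℂ)
  have t6 := (tendsto_diffQuot pv hmg hv.memLp_deriv).mono_left hle
  have t7 := he.mul ((tendsto_diffQuot (pv.ofReal_mul hm.hasDerivAt hm'c)
    hg (hm'v.add hmq)).comp hneg)
  have t8 := hc.mul_const (pair g (fun x => (m x : ℂ) * v x))
  have := ((Complex.continuous_re.tendsto _).comp
    (((((t1.add t2).add t3).add t4).add t5).sub ((t6.add t7).add t8))).const_mul 2
  simp only [one_mul] at this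
  refine this.congr' ?_
  filter_upwards [Ioc_mem_nhdsGT (zero_lt_one' ℝ)] with δ hδ
  rw [approxRate_eq hm hβ hσ hv hδ.1 hδ.2]
  rfl

/-- The dominating constant for the passage δ → 0 under the time integral. It depends on the profile
only through a bound for its norm. -/
theorem exists_approxRate_le (hm : IsCutoff m m' m'' X C) (hβ : 0 ≤ β) (hσ : 0 ≤ σ) (N : ℝ) :
    ∃ B : ℝ, ∀ v q : ℝ → ℂ, IsProfile v q → profileNorm v q ≤ N → ∀ δ : ℝ, 0 < δ → δ ≤ 1 →
      |approxRate β γ σ m m' δ v q| ≤ B := by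
  -- A bound for the L² norm of the cut-off nonlinearity.
  set G := Real.exp (β * (X + 1)) * N ^ σ * N with hG
  refine ⟨2 * (C * N * N + 1 * (N * (C * N + C * N)) + 2 * (N * (C * N)) + 2 * (C * N * N)
    + |γ| * (2 * (C * N * N)) + (C * G * N + 1 * (G * (C * N + C * N)) + 2 * (G * (C * N)))),
    fun v q hv hN δ hδ hδ1 => ?_⟩
  set g := cutNonlinearity β σ (X + 1) v with hgdef
  have hg : MemLp g 2 volume := memLp_cutNonlinearity hβ hσ hv
  have hN0 : 0 ≤ N := (profileNorm_nonneg _ _).trans hN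
  have hC0 : 0 ≤ C := (abs_nonneg _).trans (hm.le 0)
  have hG0 : 0 ≤ G := by positivity
  have nv : l2 v ≤ N := (l2_le_profileNorm v q).trans hN
  have nq : l2 q ≤ N := (l2_deriv_le_profileNorm v q).trans hN
  have ng : l2 g ≤ G := by
    refine (l2_cutNonlinearity_le hβ hσ hv).trans ?_
    have := profileNorm_nonneg v q
    have := l2_nonneg v
    rw [hG]
    gcongr
  have hmc := hm.continuous
  have hm'c := hm.continuous_deriv
  have hmv := memLp_ofReal_mul hmc hm.le hv.memLp
  have hmq := memLp_ofReal_mul hmc hm.le hv.memLp_deriv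
  have hm'v := memLp_ofReal_mul hm'c hm.le' hv.memLp
  have hm'q := memLp_ofReal_mul hm'c hm.le' hv.memLp_deriv
  have hm''v := memLp_ofReal_mul hm.continuous_deriv2 hm.le'' hv.memLp
  have hmg := memLp_ofReal_mul hmc hm.le hg
  have nmv := (l2_ofReal_mul_le hm.le hv.memLp).trans (mul_le_mul_of_nonneg_left nv hC0)
  have nmq := (l2_ofReal_mul_le hm.le hv.memLp_deriv).trans (mul_le_mul_of_nonneg_left nq hC0)
  have nm'v := (l2_ofReal_mul_le hm.le' hv.memLp).trans (mul_le_mul_of_nonneg_left nv hC0)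
  have nm'q := (l2_ofReal_mul_le hm.le' hv.memLp_deriv).trans (mul_le_mul_of_nonneg_left nq hC0)
  have nm''v := (l2_ofReal_mul_le hm.le'' hv.memLp).trans (mul_le_mul_of_nonneg_left nv hC0)
  have nmg := (l2_ofReal_mul_le hm.le hg).trans (mul_le_mul_of_nonneg_left ng hC0)
  have hc : ‖(((1 - Real.exp (-2 * δ)) / δ : ℝ) : ℂ)‖ ≤ 2 := by
    rw [Complex.norm_real, Real.norm_eq_abs, abs_div, abs_of_pos hδ, div_le_iff₀ hδ,
      abs_of_nonneg (by rw [sub_nonneg]; exact Real.exp_le_one_iff.2 (by linarith))]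
    linarith [Real.add_one_le_exp (-2 * δ)]
  have he : ‖(Real.exp (-2 * δ) : ℂ)‖ ≤ 1 := by
    rw [Complex.norm_real, Real.norm_of_nonneg (Real.exp_pos _).le]
    exact Real.exp_le_one_iff.2 (by linarith)
  have hmul : ∀ {a z : ℂ} {A Z : ℝ}, ‖a‖ ≤ A → ‖z‖ ≤ Z → ‖a * z‖ ≤ A * Z := fun ha hz => by
    rw [norm_mul]
    exact mul_le_mul ha hz (norm_nonneg _) ((norm_nonneg _).trans ha)
  have hpr : ∀ {f r : ℝ → ℂ} {A B : ℝ}, MemLp f 2 volume → MemLp r 2 volume → l2 f ≤ A →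
      l2 r ≤ B → ‖pair f r‖ ≤ A * B := fun hf hr hA hB =>
    (norm_pair_le hf hr).trans (mul_le_mul hA hB (l2_nonneg _) ((l2_nonneg _).trans hA))
  have hdq : ∀ {f u r : ℝ → ℂ} {A B : ℝ} (d : ℝ), IsPrimitive u r → MemLp f 2 volume →
      MemLp r 2 volume → l2 f ≤ A → l2 r ≤ B → ‖diffQuot d f u‖ ≤ A * B :=
    fun d hu hf hr hA hB =>
    (norm_diffQuot_le hu hf hr d).trans
      (mul_le_mul hA hB (l2_nonneg _) ((l2_nonneg _).trans hA))
  have pv := hv.prim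
  have t1 := hdq δ pv hm'q hv.memLp_deriv nm'q nq
  have t2 := hmul he (hdq (-δ) (pv.ofReal_mul hm.hasDerivAt' hm.continuous_deriv2)
    hv.memLp_deriv (hm''v.add hm'q) nq ((l2_add_le hm''v hm'q).trans (add_le_add nm''v nm'q)))
  have t3 := hmul hc (hpr hv.memLp_deriv hm'v nq nm'v)
  have t4 := hmul hc (hpr hmq (memLp_comp_add_right hv.memLp_deriv δ) nmq
    ((l2_comp_add_right hv.memLp_deriv δ).trans_le nq))
  have t5 := hmul (a := (γ : ℂ)) (A := |γ|) (by rw [Complex.norm_real, Real.norm_eq_abs])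
    (hmul hc (hpr hmv (memLp_comp_add_right hv.memLp δ) nmv
    ((l2_comp_add_right hv.memLp δ).trans_le nv)))
  have t6 := hdq δ pv hmg hv.memLp_deriv nmg nq
  have t7 := hmul he (hdq (-δ) (pv.ofReal_mul hm.hasDerivAt hm'c)
    hg (hm'v.add hmq) ng ((l2_add_le hm'v hmq).trans (add_le_add nm'v nmq)))
  have t8 := hmul hc (hpr hg hmv ng nmv)
  rw [approxRate_eq hm hβ hσ hv hδ hδ1, abs_mul, abs_two]
  refine mul_le_mul_of_nonneg_left ((Complex.abs_re_le_norm _).trans ?_) two_pos.le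
  refine (norm_sub_le _ _).trans (add_le_add ?_ ?_)
  · refine norm_add_le_of_le (norm_add_le_of_le (norm_add_le_of_le (norm_add_le_of_le t1 ?_) t3) t4) t5
    exact t2
  · exact norm_add_le_of_le (norm_add_le_of_le t6 t7) t8

end rate

/-! ### Continuity estimates for the integrals in the virial rate -/

/-- The tangent line inequality for the convex function t ↦ t^p, obtained by scaling from
Bernoulli's inequality at b/a. -/
theorem rpow_sub_rpow_le {a b p : ℝ} (ha : 0 ≤ a) (hb : 0 ≤ b) (hp : 1 ≤ p) :
    a ^ p - b ^ p ≤ p * a ^ (p - 1) * (a - b) := by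
  rcases ha.eq_or_lt with rfl | ha
  · rw [Real.zero_rpow (by linarith)]
    rcases hp.eq_or_lt with rfl | hp
    · simp
    · rw [Real.zero_rpow (by linarith)]
      have := Real.rpow_nonneg hb p
      simp [this]
  have h1 := one_add_mul_self_le_rpow_one_add (s := b / a - 1) (p := p)
    (by have := div_nonneg hb ha.le; linarith) hp
  rw [add_sub_cancel, Real.div_rpow hb ha.le, le_div_iff₀ (Real.rpow_pos_of_pos ha p)] at h1
  have h2 : a ^ p = a ^ (p - 1) * a := by
    rw [← Real.rpow_add_one ha.ne']; ring_nf
  have h3 : (1 + p * (b / a - 1)) * a ^ p = a ^ p + p * a ^ (p - 1) * (b - a) := by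
    rw [h2]; field_simp
  rw [h3] at h1
  linarith

theorem abs_rpow_sub_rpow_le {a b N σ : ℝ} (ha : 0 ≤ a) (hb : 0 ≤ b) (haN : a ≤ N) (hbN : b ≤ N)
    (hσ : 0 < σ) :
    |a ^ (σ + 2) - b ^ (σ + 2)| ≤ (σ + 2) * N ^ σ * ((a + b) * |a - b|) := by
  have key : ∀ {a b : ℝ}, 0 ≤ a → 0 ≤ b → a ≤ N → b ≤ N →
      a ^ (σ + 2) - b ^ (σ + 2) ≤ (σ + 2) * N ^ σ * ((a + b) * |a - b|) := by
    intro a b ha hb haN hbN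
    refine (rpow_sub_rpow_le ha hb (by linarith)).trans ?_
    have h1 : a ^ (σ + 2 - 1) = a ^ σ * a := by
      rw [show σ + 2 - 1 = σ + 1 by ring, Real.rpow_add_one' ha (by positivity)]
    rw [h1]
    have h2 : a ^ σ ≤ N ^ σ := Real.rpow_le_rpow ha haN hσ.le
    have h3 : 0 ≤ a ^ σ := Real.rpow_nonneg ha σ
    have h4 := le_abs_self (a - b)
    have h5 := abs_nonneg (a - b)
    have hN := ha.trans haN
    calc (σ + 2) * (a ^ σ * a) * (a - b) ≤ (σ + 2) * (a ^ σ * a) * |a - b| := by gcongr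
      _ ≤ (σ + 2) * (N ^ σ * (a + b)) * |a - b| := by gcongr; linarith
      _ = _ := by ring
  rw [abs_le]
  refine ⟨?_, key ha hb haN hbN⟩
  have := key hb ha hbN haN
  rw [abs_sub_comm b a, add_comm b a] at this
  linarith

theorem integrable_mul_norm_sq {k : ℝ → ℝ} {C : ℝ} {f : ℝ → ℂ} (hk : Continuous k)
    (hC : ∀ x, |k x| ≤ C) (hf : MemLp f 2 volume) : Integrable fun x => k x * ‖f x‖ ^ 2 := by
  refine ((integrable_norm_mul hf hf).const_mul C).mono'
    (hk.aestronglyMeasurable.mul (hf.1.norm.pow 2)) (ae_of_all _ fun x => ?_)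
  rw [norm_mul, Real.norm_eq_abs, norm_pow, norm_norm, pow_two]
  exact mul_le_mul_of_nonneg_right (hC x) (by positivity)

theorem pair_mul_self (k : ℝ → ℝ) (f : ℝ → ℂ) :
    pair (fun x => (k x : ℂ) * f x) f = ((∫ x, k x * ‖f x‖ ^ 2 : ℝ) : ℂ) := by
  rw [pair, ← integral_complex_ofReal]
  congr 1; ext x
  rw [mul_assoc, Complex.mul_conj, Complex.normSq_eq_norm_sq]
  push_cast; ring

theorem abs_integral_mul_norm_sq_sub_le {k : ℝ → ℝ} {C : ℝ} {f g : ℝ → ℂ} (hk : Continuous k)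
    (hC : ∀ x, |k x| ≤ C) (hf : MemLp f 2 volume) (hg : MemLp g 2 volume) :
    |(∫ x, k x * ‖f x‖ ^ 2) - ∫ x, k x * ‖g x‖ ^ 2| ≤
      C * (l2 (fun x => f x - g x) * (l2 f + l2 g)) := by
  have hfg : MemLp (fun x => f x - g x) 2 volume := hf.sub hg
  rw [← integral_sub (integrable_mul_norm_sq hk hC hf) (integrable_mul_norm_sq hk hC hg),
    ← Real.norm_eq_abs]
  have hi := ((integrable_norm_mul hfg hf).add (integrable_norm_mul hfg hg)).const_mul C
  refine (norm_integral_le_of_norm_le hi (ae_of_all _ fun x => ?_)).trans ?_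
  · rw [← mul_sub, norm_mul, Real.norm_eq_abs, Real.norm_eq_abs, Pi.add_apply]
    have h1 : |‖f x‖ ^ 2 - ‖g x‖ ^ 2| ≤ ‖f x - g x‖ * ‖f x‖ + ‖f x - g x‖ * ‖g x‖ := by
      rw [sq_sub_sq, abs_mul, abs_of_nonneg (by positivity), ← mul_add, mul_comm]
      exact mul_le_mul_of_nonneg_right (abs_norm_sub_norm_le _ _) (by positivity)
    exact mul_le_mul (hC x) h1 (abs_nonneg _) ((abs_nonneg _).trans (hC x))
  · rw [integral_const_mul]
    refine mul_le_mul_of_nonneg_left ?_ ((abs_nonneg _).trans (hC 0))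
    simp only [Pi.add_apply]
    rw [integral_add (integrable_norm_mul hfg hf) (integrable_norm_mul hfg hg), mul_add]
    exact add_le_add (integral_norm_mul_le hfg hf) (integral_norm_mul_le hfg hg)

section nonlinear

variable {β σ C : ℝ} {k : ℝ → ℝ} {v q w p : ℝ → ℂ}

theorem norm_rpow_add_two (hσ : 0 < σ) (z : ℂ) : ‖z‖ ^ (σ + 2) = ‖z‖ ^ σ * (‖z‖ * ‖z‖) := by
  rw [Real.rpow_add' (norm_nonneg _) (by positivity), ← pow_two, ← Real.rpow_natCast ‖z‖ 2]
  norm_num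

theorem integrable_exp_mul_norm_rpow (hβ0 : 0 ≤ β) (hβ2 : β ≤ 2) (hσ : 0 < σ)
    (hv : IsProfile v q) : Integrable fun x => Real.exp (β * x) * ‖v x‖ ^ (σ + 2) := by
  refine ((integrable_profile_mul hv hv).const_mul (profileNorm v q ^ σ)).mono' ?_
    (ae_of_all _ fun x => ?_)
  · exact (continuous_nonlinear_weight (by linarith) hv.prim.continuous).aestronglyMeasurable
  · rw [Real.norm_of_nonneg (by positivity), norm_rpow_add_two hσ, ← mul_assoc]
    exact norm_nonlinear_le hβ0 hβ2 hσ.le hv.norm_le v v x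

theorem integrable_mul_exp_mul_norm_rpow (hβ0 : 0 ≤ β) (hβ2 : β ≤ 2) (hσ : 0 < σ)
    (hk : Continuous k) (hC : ∀ x, |k x| ≤ C) (hv : IsProfile v q) :
    Integrable fun x => k x * (Real.exp (β * x) * ‖v x‖ ^ (σ + 2)) :=
  (integrable_exp_mul_norm_rpow hβ0 hβ2 hσ hv).bdd_mul hk.aestronglyMeasurable
    (ae_of_all _ fun x => (Real.norm_eq_abs (k x)).trans_le (hC x))

theorem abs_integral_nonlinear_sub_le (hβ0 : 0 ≤ β) (hβ2 : β ≤ 2) (hσ : 0 < σ)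
    (hk : Continuous k) (hC : ∀ x, |k x| ≤ C) (hv : IsProfile v q) (hw : IsProfile w p) {N : ℝ}
    (hvN : profileNorm v q ≤ N) (hwN : profileNorm w p ≤ N) :
    |(∫ x, k x * (Real.exp (β * x) * ‖v x‖ ^ (σ + 2))) -
        ∫ x, k x * (Real.exp (β * x) * ‖w x‖ ^ (σ + 2))| ≤
      C * ((σ + 2) * N ^ σ * (2 * (N * profileNorm (fun x => v x - w x) (fun x => q x - p x)) +
        2 * (N * profileNorm (fun x => v x - w x) (fun x => q x - p x)))) := by
  have hvw := hv.sub hw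
  have hN0 : 0 ≤ N := (profileNorm_nonneg _ _).trans hvN
  have hC0 : 0 ≤ C := (abs_nonneg _).trans (hC 0)
  rw [← integral_sub (integrable_mul_exp_mul_norm_rpow hβ0 hβ2 hσ hk hC hv)
    (integrable_mul_exp_mul_norm_rpow hβ0 hβ2 hσ hk hC hw), ← Real.norm_eq_abs]
  have hi := (((integrable_profile_mul hv hvw).add (integrable_profile_mul hw hvw)).const_mul
    ((σ + 2) * N ^ σ)).const_mul C
  refine (norm_integral_le_of_norm_le hi (ae_of_all _ fun x => ?_)).trans ?_
  · rw [← mul_sub, ← mul_sub, norm_mul, norm_mul, Real.norm_of_nonneg (Real.exp_pos _).le,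
      Real.norm_eq_abs, Real.norm_eq_abs, Pi.add_apply]
    refine mul_le_mul (hC x) ?_ (by positivity) hC0
    have h1 := abs_rpow_sub_rpow_le (norm_nonneg (v x)) (norm_nonneg (w x))
      ((hv.norm_le x).trans hvN) ((hw.norm_le x).trans hwN) hσ
    have h2 : |‖v x‖ - ‖w x‖| ≤ ‖v x - w x‖ := abs_norm_sub_norm_le _ _
    have h3 := exp_mul_le_one_add hβ0 hβ2 x
    calc Real.exp (β * x) * |‖v x‖ ^ (σ + 2) - ‖w x‖ ^ (σ + 2)|
        ≤ (1 + Real.exp x * Real.exp x) *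
          ((σ + 2) * N ^ σ * ((‖v x‖ + ‖w x‖) * ‖v x - w x‖)) := by
          refine mul_le_mul h3 (h1.trans ?_) (abs_nonneg _) (by positivity)
          gcongr
      _ = _ := by
          simp only [norm_expMul]
          ring
  · rw [integral_const_mul, integral_const_mul]
    refine mul_le_mul_of_nonneg_left (mul_le_mul_of_nonneg_left ?_ (by positivity)) hC0
    simp only [Pi.add_apply]
    rw [integral_add (integrable_profile_mul hv hvw) (integrable_profile_mul hw hvw)]
    have h0 := profileNorm_nonneg (fun x => v x - w x) (fun x => q x - p x)
    refine add_le_add ((integral_profile_mul_le hv hvw).trans ?_)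
      ((integral_profile_mul_le hw hvw).trans ?_)
    · gcongr
    · gcongr

end nonlinear

/-! ### Integration by parts in space -/

/-- The second time derivative of the virial in logarithmic variables. -/
def virialRate (β γ σ : ℝ) (m m' m'' m''' : ℝ → ℝ) (v q : ℝ → ℂ) : ℝ :=
  (∫ x, 4 * (m x + m' x) * ‖q x‖ ^ 2)
    + (∫ x, (4 * γ * m x - (m''' x + 2 * m'' x)) * ‖v x‖ ^ 2)
    - ∫ x, (2 * (m' x + 2 * m x) - 4 / (σ + 2) * (β * m x + m' x)) *
        (Real.exp (β * x) * ‖v x‖ ^ (σ + 2))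

section rate

variable {β γ σ X C : ℝ} {m m' m'' m''' : ℝ → ℝ} {v q : ℝ → ℂ}

/-- Integrate the derivative of (m'' + 2 m') |v|² over the line. This third derivative of the
multiplier is the reason for assuming θ to be C⁴. -/
theorem integral_cutoff_re (hm : IsCutoff m m' m'' X C) (hm3 : ∀ x, HasDerivAt m'' (m''' x) x)
    (hm3c : Continuous m''') (hm3C : ∀ x, |m''' x| ≤ C) (hv : IsProfile v q) :
    (pair q (fun x => (m'' x : ℂ) * v x) + 2 * pair q (fun x => (m' x : ℂ) * v x)).re =
      - (1 / 2) * ∫ x, (m''' x + 2 * m'' x) * ‖v x‖ ^ 2 := by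
  have hm'v := memLp_ofReal_mul hm.continuous_deriv hm.le' hv.memLp
  have hm''v := memLp_ofReal_mul hm.continuous_deriv2 hm.le'' hv.memLp
  set k : ℝ → ℝ := fun x => m'' x + 2 * m' x with hk
  set k' : ℝ → ℝ := fun x => m''' x + 2 * m'' x with hk'
  have hd : ∀ x, HasDerivAt k (k' x) x := fun x => (hm3 x).add ((hm.hasDerivAt' x).const_mul 2)
  have hkc : Continuous k := continuous_iff_continuousAt.2 fun x => (hd x).continuousAt
  have hk'c : Continuous k' := hm3c.add (hm.continuous_deriv2.const_mul 2)
  have hkC : ∀ x, |k x| ≤ 3 * C := fun x => by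
    have h1 := abs_add_le (m'' x) (2 * m' x)
    rw [abs_mul, abs_two] at h1
    simp only [hk]
    linarith [hm.le'' x, hm.le' x]
  have hk'C : ∀ x, |k' x| ≤ 3 * C := fun x => by
    have h1 := abs_add_le (m''' x) (2 * m'' x)
    rw [abs_mul, abs_two] at h1
    simp only [hk']
    linarith [hm.le'' x, hm3C x]
  have hp := hv.prim.norm_sq.real_mul hd hk'c
  have i1 := integrable_mul_norm_sq hkc hkC hv.memLp
  have i2 := integrable_mul_norm_sq hk'c hk'C hv.memLp
  have i3' := integrable_pair hv.memLp_deriv (memLp_ofReal_mul hkc hkC hv.memLp)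
  have e3 : ∀ x, k x * (2 * (q x * conj (v x)).re) = 2 * (q x * conj ((k x : ℂ) * v x)).re := by
    intro x; simp; ring
  have i3 : Integrable fun x => k x * (2 * (q x * conj (v x)).re) := by
    refine (i3'.re.const_mul 2).congr (ae_of_all _ fun x => ?_)
    exact (e3 x).symm
  have h0 := hp.integral_eq_zero i1 (i2.add i3)
  rw [integral_add i2 i3] at h0
  simp only [e3] at h0
  rw [integral_const_mul] at h0
  have hre : ∫ x, (q x * conj ((k x : ℂ) * v x)).re = (pair q (fun x => (k x : ℂ) * v x)).re :=
    integral_re i3'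
  have hsum : pair q (fun x => (k x : ℂ) * v x) =
      pair q (fun x => (m'' x : ℂ) * v x) + 2 * pair q (fun x => (m' x : ℂ) * v x) := by
    have := pair_add_right hm''v (hm'v.const_mul ((2 : ℝ) : ℂ)) hv.memLp_deriv
    rw [pair_smul_right] at this
    simp only [Complex.ofReal_ofNat] at this
    rw [← this]
    congr 1; ext x; simp [hk]; ring
  rw [hre, hsum] at h0
  linarith

/-- Integrate the derivative of m e^(βx) |v|^(σ+2) over the line. This turns the one term pairing
the nonlinearity with v' into a multiple of the potential energy density. -/
theorem integral_cutoff_nonlinear (hm : IsCutoff m m' m'' X C) (hβ0 : 0 ≤ β) (hβ2 : β ≤ 2)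
    (hσ : 0 < σ) (hv : IsProfile v q) :
    (pair (cutNonlinearity β σ (X + 1) v) (fun x => (m x : ℂ) * q x)).re =
      - (1 / (σ + 2)) * ∫ x, (β * m x + m' x) * (Real.exp (β * x) * ‖v x‖ ^ (σ + 2)) := by
  have hg : MemLp (cutNonlinearity β σ (X + 1) v) 2 volume := memLp_cutNonlinearity hβ0 hσ.le hv
  have hmq := memLp_ofReal_mul hm.continuous hm.le hv.memLp_deriv
  have hC0 : 0 ≤ C := (abs_nonneg _).trans (hm.le 0)
  have hmd : ∀ x, HasDerivAt (fun x => m x * Real.exp (β * x))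
      (m' x * Real.exp (β * x) + m x * (β * Real.exp (β * x))) x := fun x => by
    have h1 : HasDerivAt (fun x => Real.exp (β * x)) (β * Real.exp (β * x)) x := by
      have := ((hasDerivAt_id x).const_mul β).exp
      simp only [id, mul_one] at this
      rwa [mul_comm] at this
    exact (hm.hasDerivAt x).mul h1
  have hmdc : Continuous fun x => m' x * Real.exp (β * x) + m x * (β * Real.exp (β * x)) := by
    have := hm.continuous; have := hm.continuous_deriv; fun_prop
  have hp := (hv.prim.norm_rpow (p := σ + 2) (by linarith)).real_mul hmd hmdc
  have i1 := integrable_mul_exp_mul_norm_rpow hβ0 hβ2 hσ hm.continuous hm.le hv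
  have hkC : ∀ x, |β * m x + m' x| ≤ 3 * C := fun x => by
    have h1 := abs_add_le (β * m x) (m' x)
    rw [abs_mul, abs_of_nonneg hβ0] at h1
    have h2 := mul_le_mul hβ2 (hm.le x) (abs_nonneg _) two_pos.le
    linarith [hm.le' x]
  have hkc : Continuous fun x => β * m x + m' x := by
    have := hm.continuous; have := hm.continuous_deriv; fun_prop
  have i2 := integrable_mul_exp_mul_norm_rpow hβ0 hβ2 hσ hkc hkC hv
  have i3' := integrable_pair hg hmq
  -- Beyond X + 1 both sides vanish because m does, so the cutoff in the nonlinearity is invisible.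
  have e3 : ∀ x, m x * Real.exp (β * x) * ((σ + 2) * (‖v x‖ ^ (σ + 2 - 2) * (q x * conj (v x)).re)) =
      (σ + 2) * (cutNonlinearity β σ (X + 1) v x * conj ((m x : ℂ) * q x)).re := by
    intro x
    by_cases hx : x ∈ Iic (X + 1)
    · rw [cutNonlinearity, indicator_of_mem hx, add_sub_cancel_right]
      rw [map_mul, Complex.conj_ofReal]
      have : (((Real.exp (β * x) * ‖v x‖ ^ σ : ℝ) : ℂ) * v x * ((m x : ℂ) * conj (q x))) =
          ((Real.exp (β * x) * ‖v x‖ ^ σ * m x : ℝ) : ℂ) * conj (q x * conj (v x)) := by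
        push_cast; simp; ring
      rw [this, Complex.re_ofReal_mul, Complex.conj_re]
      ring
    · rw [hm.eq_zero x (by rw [mem_Iic] at hx; linarith)]; simp
  have i3 : Integrable fun x =>
      m x * Real.exp (β * x) * ((σ + 2) * (‖v x‖ ^ (σ + 2 - 2) * (q x * conj (v x)).re)) := by
    refine (i3'.re.const_mul (σ + 2)).congr (ae_of_all _ fun x => ?_)
    exact (e3 x).symm
  have i2' : Integrable fun x => (m' x * Real.exp (β * x) + m x * (β * Real.exp (β * x))) *
      ‖v x‖ ^ (σ + 2) := i2.congr (ae_of_all _ fun x => by simp only; ring)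
  have h0 := hp.integral_eq_zero (i1.congr (ae_of_all _ fun x => by simp only; ring))
    (i2'.add i3)
  rw [integral_add i2' i3] at h0
  simp only [e3] at h0
  rw [integral_const_mul] at h0
  have hre : ∫ x, (cutNonlinearity β σ (X + 1) v x * conj ((m x : ℂ) * q x)).re =
      (pair (cutNonlinearity β σ (X + 1) v) (fun x => (m x : ℂ) * q x)).re := integral_re i3'
  have e2 : ∫ x, (m' x * Real.exp (β * x) + m x * (β * Real.exp (β * x))) * ‖v x‖ ^ (σ + 2) =
      ∫ x, (β * m x + m' x) * (Real.exp (β * x) * ‖v x‖ ^ (σ + 2)) := by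
    congr 1; ext x; ring
  rw [hre, e2] at h0
  have hσ2 : σ + 2 ≠ 0 := by positivity
  rw [neg_mul, one_div_mul_eq_div, ← neg_div, eq_div_iff hσ2]
  linarith

theorem pair_cutNonlinearity_self {k : ℝ → ℝ} (hσ : 0 < σ) (hk : ∀ x, X < x → k x = 0) :
    pair (cutNonlinearity β σ X v) (fun x => (k x : ℂ) * v x) =
      ((∫ x, k x * (Real.exp (β * x) * ‖v x‖ ^ (σ + 2)) : ℝ) : ℂ) := by
  rw [pair, ← integral_complex_ofReal]
  congr 1; ext x
  by_cases hx : x ∈ Iic X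
  · rw [cutNonlinearity, indicator_of_mem hx, norm_rpow_add_two hσ, map_mul, Complex.conj_ofReal]
    have := Complex.mul_conj (v x)
    rw [Complex.normSq_eq_norm_sq] at this
    push_cast at this ⊢
    linear_combination (Complex.exp (β * x) * (‖v x‖ ^ σ : ℝ) * k x) * this
  · rw [hk x (not_le.1 hx)]; simp

theorem pairRate_eq (hm : IsCutoff m m' m'' X C) (hm3 : ∀ x, HasDerivAt m'' (m''' x) x)
    (hm3c : Continuous m''') (hm3C : ∀ x, |m''' x| ≤ C) (hβ0 : 0 ≤ β) (hβ2 : β ≤ 2)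
    (hσ : 0 < σ) (hv : IsProfile v q) :
    pairRate β γ σ X m m' m'' v q = virialRate β γ σ m m' m'' m''' v q := by
  have hg : MemLp (cutNonlinearity β σ (X + 1) v) 2 volume := memLp_cutNonlinearity hβ0 hσ.le hv
  have hmc := hm.continuous
  have hm'c := hm.continuous_deriv
  have hmq := memLp_ofReal_mul hmc hm.le hv.memLp_deriv
  have hm'v := memLp_ofReal_mul hm'c hm.le' hv.memLp
  have hm'q := memLp_ofReal_mul hm'c hm.le' hv.memLp_deriv
  have hm''v := memLp_ofReal_mul hm.continuous_deriv2 hm.le'' hv.memLp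
  have h1 := integral_cutoff_re hm hm3 hm3c hm3C hv
  have h2 := integral_cutoff_nonlinear hm hβ0 hβ2 hσ hv
  have i1 := integrable_mul_norm_sq hmc hm.le hv.memLp
  have i2 := integrable_mul_norm_sq hmc hm.le hv.memLp_deriv
  have i3 := integrable_mul_norm_sq hm'c hm.le' hv.memLp_deriv
  have i4 := integrable_mul_norm_sq hm.continuous_deriv2 hm.le'' hv.memLp
  have i5 := integrable_mul_norm_sq hm3c hm3C hv.memLp
  have i6 := integrable_mul_exp_mul_norm_rpow hβ0 hβ2 hσ hmc hm.le hv
  have i7 := integrable_mul_exp_mul_norm_rpow hβ0 hβ2 hσ hm'c hm.le' hv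
  have s1 : ∫ x, 4 * (m x + m' x) * ‖q x‖ ^ 2 =
      4 * (∫ x, m x * ‖q x‖ ^ 2) + 4 * ∫ x, m' x * ‖q x‖ ^ 2 := by
    rw [← integral_const_mul, ← integral_const_mul,
      ← integral_add (i2.const_mul 4) (i3.const_mul 4)]
    congr 1; ext x; ring
  have s2 : ∫ x, (m''' x + 2 * m'' x) * ‖v x‖ ^ 2 =
      (∫ x, m''' x * ‖v x‖ ^ 2) + 2 * ∫ x, m'' x * ‖v x‖ ^ 2 := by
    rw [← integral_const_mul, ← integral_add i5 (i4.const_mul 2)]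
    congr 1; ext x; ring
  have s3 : ∫ x, (4 * γ * m x - (m''' x + 2 * m'' x)) * ‖v x‖ ^ 2 =
      4 * γ * (∫ x, m x * ‖v x‖ ^ 2) - ((∫ x, m''' x * ‖v x‖ ^ 2)
        + 2 * ∫ x, m'' x * ‖v x‖ ^ 2) := by
    have i45 : Integrable fun x => m''' x * ‖v x‖ ^ 2 + 2 * (m'' x * ‖v x‖ ^ 2) :=
      i5.add (i4.const_mul 2)
    rw [← integral_const_mul, ← integral_const_mul, ← integral_add i5 (i4.const_mul 2),
      ← integral_sub (i1.const_mul (4 * γ)) i45]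
    congr 1; ext x; ring
  have s4 : ∫ x, (β * m x + m' x) * (Real.exp (β * x) * ‖v x‖ ^ (σ + 2)) =
      β * (∫ x, m x * (Real.exp (β * x) * ‖v x‖ ^ (σ + 2))) +
        ∫ x, m' x * (Real.exp (β * x) * ‖v x‖ ^ (σ + 2)) := by
    rw [← integral_const_mul, ← integral_add (i6.const_mul β) i7]
    congr 1; ext x; ring
  have s5 : ∫ x, (2 * (m' x + 2 * m x) - 4 / (σ + 2) * (β * m x + m' x)) *
        (Real.exp (β * x) * ‖v x‖ ^ (σ + 2)) =
      (4 - 4 / (σ + 2) * β) * (∫ x, m x * (Real.exp (β * x) * ‖v x‖ ^ (σ + 2))) +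
        (2 - 4 / (σ + 2)) * ∫ x, m' x * (Real.exp (β * x) * ‖v x‖ ^ (σ + 2)) := by
    rw [← integral_const_mul, ← integral_const_mul,
      ← integral_add (i6.const_mul _) (i7.const_mul _)]
    congr 1; ext x; ring
  rw [virialRate, s1, s3, s5, pairRate, pair_add_right hm''v hm'q hv.memLp_deriv,
    pair_add_right hm'v hmq hg, pair_real_mul m (cutNonlinearity β σ (X + 1) v) q,
    ← pair_real_mul m' q q, pair_mul_self, pair_mul_self, pair_mul_self,
    pair_cutNonlinearity_self hσ (fun x hx => hm.eq_zero x (by linarith)),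
    pair_cutNonlinearity_self hσ (fun x hx => hm.eq_zero' x (by linarith))]
  rw [s2] at h1
  rw [s4] at h2
  have c2 : (2 : ℂ) = ((2 : ℝ) : ℂ) := by norm_num
  rw [c2] at h1 ⊢
  simp only [Complex.add_re, Complex.sub_re, Complex.re_ofReal_mul, Complex.ofReal_re] at h1 ⊢
  -- The weight 4 of the nonlinear identity comes from the two terms of `pairRate` that pair m q
  -- with the nonlinearity, times the overall factor 2.
  linear_combination 2 * h1 - 4 * h2

end rate

/-! ### Time derivatives of the mass, the virial and the momentum -/

theorem im_pair_ofReal_mul (k : ℝ → ℝ) (f : ℝ → ℂ) :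
    (pair f (fun x => (k x : ℂ) * f x)).im = 0 := by
  rw [← pair_real_mul, pair_mul_self, Complex.ofReal_im]

/-- The potential and the nonlinearity pair to real numbers with k v, and so does the k v' part of
its derivative. Only the commutator with the kinetic term survives. -/
theorem im_energyPairing_ofReal_mul {β γ σ C : ℝ} {k k' : ℝ → ℝ} {v q : ℝ → ℂ}
    (hv : IsProfile v q) (hk : ∀ x, HasDerivAt k (k' x) x) (hk' : Continuous k')
    (hC : ∀ x, |k x| ≤ C) (hC' : ∀ x, |k' x| ≤ C) :
    (energyPairing β γ σ v q (fun x => (k x : ℂ) * v x)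
      (fun x => (k' x : ℂ) * v x + (k x : ℂ) * q x)).im =
      (pair q (fun x => (k' x : ℂ) * v x)).im := by
  have hkc : Continuous k := continuous_iff_continuousAt.2 fun x => (hk x).continuousAt
  have h1 : ∫ x, ((Real.exp (β * x) * ‖v x‖ ^ σ : ℝ) : ℂ) * (v x * conj ((k x : ℂ) * v x)) =
      ((∫ x, Real.exp (β * x) * ‖v x‖ ^ σ * (k x * ‖v x‖ ^ 2) : ℝ) : ℂ) := by
    rw [← integral_complex_ofReal]
    congr 1; ext x
    have := Complex.mul_conj (v x)
    rw [Complex.normSq_eq_norm_sq] at this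
    rw [map_mul, Complex.conj_ofReal]
    push_cast at this ⊢
    linear_combination (Complex.exp (β * x) * (‖v x‖ ^ σ : ℝ) * k x) * this
  rw [energyPairing, h1, pair_add_right (memLp_ofReal_mul hk' hC' hv.memLp)
    (memLp_ofReal_mul hkc hC hv.memLp_deriv) hv.memLp_deriv]
  simp only [Complex.sub_im, Complex.add_im, Complex.im_ofReal_mul, im_pair_ofReal_mul,
    Complex.ofReal_im]
  ring

/-- The fundamental theorem of calculus relative to I, with one-sided derivatives at endpoints
belonging to I. -/
theorem hasDerivWithinAt_of_sub_eq_integral {M F : ℝ → ℝ} {I : Set ℝ} (hI : I.OrdConnected)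
    (hF : ContinuousOn F I) (h : ∀ a ∈ I, ∀ b ∈ I, a ≤ b → M b - M a = ∫ s in a..b, F s)
    {t : ℝ} (ht : t ∈ I) : HasDerivWithinAt M (F t) I t := by
  have h' : ∀ a ∈ I, ∀ b ∈ I, M b - M a = ∫ s in a..b, F s := fun a ha b hb => by
    rcases le_total a b with hab | hab
    · exact h a ha b hb hab
    · rw [intervalIntegral.integral_symm, ← h b hb a ha hab]; ring
  rw [hasDerivWithinAt_iff_isLittleO]
  refine Asymptotics.isLittleO_iff.2 fun c hc => ?_
  obtain ⟨η, hη, hball⟩ := Metric.continuousWithinAt_iff.1 (hF t ht) c hc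
  filter_upwards [inter_mem_nhdsWithin I (Metric.ball_mem_nhds t hη)] with s hs
  have hsub : uIcc t s ⊆ I := hI.uIcc_subset ht hs.1
  have hi : IntervalIntegrable F volume t s := (hF.mono hsub).intervalIntegrable
  have e : M s - M t - (s - t) • F t = ∫ r in t..s, (F r - F t) := by
    rw [intervalIntegral.integral_sub hi intervalIntegrable_const, h' t ht s hs.1]
    simp
  rw [e, Real.norm_eq_abs (s - t)]
  refine intervalIntegral.norm_integral_le_of_norm_le_const fun r hr => ?_
  have hr' := uIoc_subset_uIcc hr
  refine (hball (hsub hr') ?_).le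
  have h1 := Set.abs_sub_left_of_mem_uIcc hr'
  have h2 := hs.2
  rw [Metric.mem_ball, Real.dist_eq] at h2
  rw [Real.dist_eq]
  exact h1.trans_lt h2

/-- Half of the first time derivative of the virial. -/
def momentum (m : ℝ → ℝ) (v q : ℝ → ℂ) : ℝ :=
  2 * (pair q (fun x => ((Real.exp (2 * x) * m x : ℝ) : ℂ) * v x)).im

/-- The factor e^(2x) is the weight of the mass pairing; it stays bounded because m vanishes beyond
X. -/
theorem IsCutoff.exp_mul_le {m m' m'' : ℝ → ℝ} {X C : ℝ} (hm : IsCutoff m m' m'' X C) (x : ℝ) :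
    |Real.exp (2 * x) * m x| ≤ Real.exp (2 * X) * C := by
  have hC0 : 0 ≤ C := (abs_nonneg _).trans (hm.le 0)
  rcases le_or_gt x X with hx | hx
  · rw [abs_mul, abs_of_pos (Real.exp_pos _)]
    exact mul_le_mul (Real.exp_le_exp.2 (by linarith)) (hm.le x) (abs_nonneg _) (Real.exp_pos _).le
  · rw [hm.eq_zero x hx]; simp only [mul_zero, abs_zero]; positivity

/-- The difference quotient approximation of `momentum`. -/
def approxMomentum (m : ℝ → ℝ) (δ : ℝ) (v : ℝ → ℂ) : ℝ :=
  2 / δ * (massPairing (fun x => (m x : ℂ) * v (x + δ)) v).im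

/-- At δ = 0 the pairing is real, so subtracting it leaves the imaginary part unchanged and produces
a difference quotient. -/
theorem tendsto_approxMomentum {m m' m'' : ℝ → ℝ} {X C : ℝ} {v q : ℝ → ℂ}
    (hm : IsCutoff m m' m'' X C) (hv : IsProfile v q) :
    Tendsto (fun δ => approxMomentum m δ v) (𝓝[>] 0) (𝓝 (momentum m v q)) := by
  set k : ℝ → ℝ := fun x => Real.exp (2 * x) * m x with hk
  have hkc : Continuous k := by have := hm.continuous; fun_prop
  have hkv := memLp_ofReal_mul hkc hm.exp_mul_le hv.memLp
  have hle : 𝓝[>] (0 : ℝ) ≤ 𝓝[≠] 0 := nhdsWithin_mono _ fun x hx => ne_of_gt hx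
  have h1 := (tendsto_diffQuot hv.prim hkv hv.memLp_deriv).mono_left hle
  have h2 := ((Complex.continuous_im.tendsto _).comp h1).const_mul (-2)
  have e1 : momentum m v q = -2 * (pair (fun x => (k x : ℂ) * v x) q).im := by
    rw [momentum, ← pair_conj q, Complex.conj_im]; ring
  rw [e1]
  refine h2.congr' ?_
  filter_upwards [self_mem_nhdsWithin] with δ hδ
  have hδ0 : δ ≠ 0 := ne_of_gt hδ
  have e2 : massPairing (fun x => (m x : ℂ) * v (x + δ)) v =
      conj (pair (fun x => (k x : ℂ) * v x) (fun x => v (x + δ))) := by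
    rw [pair_conj, massPairing, pair, pair]
    congr 1; ext x
    have : Real.exp x * Real.exp x = Real.exp (2 * x) := by rw [← Real.exp_add]; ring_nf
    simp only [expMul, hk, map_mul, Complex.conj_ofReal, ← this]
    push_cast; ring
  have e3 : (pair (fun x => (k x : ℂ) * v x) v).im = 0 := by
    rw [pair_mul_self, Complex.ofReal_im]
  simp only [Function.comp]
  rw [approxMomentum, e2, diffQuot, pair_sub_right (memLp_comp_add_right hv.memLp δ) hv.memLp hkv,
    Complex.conj_im, ← Complex.ofReal_inv, Complex.im_ofReal_mul, Complex.sub_im, e3]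
  ring

namespace IsProfileSolution

variable {β γ σ X C : ℝ} {I : Set ℝ} {v q : ℝ → ℝ → ℂ} {m m' m'' m''' : ℝ → ℝ}

theorem tendsto_profileNorm (h : IsProfileSolution β γ σ I v q) {t : ℝ} (ht : t ∈ I) :
    Tendsto (fun s => profileNorm (v s) (q s)) (𝓝[I] t) (𝓝 (profileNorm (v t) (q t))) := by
  rw [tendsto_iff_norm_sub_tendsto_zero]
  refine squeeze_zero' (Eventually.of_forall fun _ => norm_nonneg _) ?_ (h.tendsto t ht)
  filter_upwards [self_mem_nhdsWithin] with s hs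
  have h1 := profileNorm_le_add (h.isProfile s hs) (h.isProfile t ht)
  have h2 := profileNorm_le_add (h.isProfile t ht) (h.isProfile s hs)
  rw [profileNorm_sub_comm] at h2
  rw [Real.norm_eq_abs, abs_le]
  constructor <;> linarith

theorem continuousOn_profileNorm (h : IsProfileSolution β γ σ I v q) :
    ContinuousOn (fun s => profileNorm (v s) (q s)) I := fun _ ht => h.tendsto_profileNorm ht

/-- Take T to be the identity, a multiplier with zero derivative: the commutator term is zero and
the derivative of the mass vanishes. -/
theorem mass_eq (h : IsProfileSolution β γ σ I v q) (hI : I.OrdConnected) (hβ0 : 0 ≤ β)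
    (hβ2 : β ≤ 2) (hσ : 0 ≤ σ) {s t : ℝ} (hs : s ∈ I) (ht : t ∈ I) :
    massPairing (v s) (v s) = massPairing (v t) (v t) := by
  have hT : IsAdjointPair _ _ _ _ (2 * 1) := isAdjointPair_ofReal_mul (m := fun _ => 1)
    (m' := fun _ => 0) (C := 1) (fun x => hasDerivAt_const x 1) continuous_const
    (fun x => by simp) (fun x => by simp)
  have hd : ∀ r ∈ I, HasDerivWithinAt (fun s => massPairing (v s) (v s)) 0 I r := fun r hr => by
    have h1 := h.hasDerivWithinAt_quadratic hI hβ0 hβ2 hσ hT hr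
    have h2 := im_energyPairing_ofReal_mul (β := β) (γ := γ) (σ := σ) (h.isProfile r hr)
      (k := fun _ => 1) (k' := fun _ => 0) (C := 1)
      (fun x => hasDerivAt_const x 1) continuous_const (fun x => by simp) (fun x => by simp)
    simp only [Complex.ofReal_one, one_mul, Complex.ofReal_zero, zero_mul, zero_add] at h1 h2
    convert h1 using 1
    have h3 : (pair (q r) fun _ => 0).im = 0 := by simp [pair]
    rw [h3] at h2
    apply Complex.ext
    · simp [h2]
    · simp
  have := hI.convex.norm_image_sub_le_of_norm_hasDerivWithin_le (C := 0) hd (by simp) ht hs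
  rw [zero_mul] at this
  exact sub_eq_zero.1 (norm_le_zero_iff.1 this)

theorem hasDerivWithinAt_virial (h : IsProfileSolution β γ σ I v q) (hI : I.OrdConnected)
    (hβ0 : 0 ≤ β) (hβ2 : β ≤ 2) (hσ : 0 ≤ σ) (hm : IsCutoff m m' m'' X C) {φ : ℝ → ℝ} {B : ℝ}
    (hφ : ∀ x, HasDerivAt φ (Real.exp (2 * x) * m x) x) (hB : ∀ x, |φ x| ≤ B) {t : ℝ}
    (ht : t ∈ I) :
    HasDerivWithinAt (fun s => (massPairing (fun x => (φ x : ℂ) * v s x) (v s)).re)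
      (momentum m (v t) (q t)) I t := by
  have hkc : Continuous fun x => Real.exp (2 * x) * m x := by have := hm.continuous; fun_prop
  have hB' : ∀ x, |φ x| ≤ max B (Real.exp (2 * X) * C) := fun x => (hB x).trans (le_max_left _ _)
  have hk' : ∀ x, |Real.exp (2 * x) * m x| ≤ max B (Real.exp (2 * X) * C) := fun x =>
    (hm.exp_mul_le x).trans (le_max_right _ _)
  have h1 := h.hasDerivWithinAt_quadratic hI hβ0 hβ2 hσ (isAdjointPair_ofReal_mul hφ hkc hB' hk') ht
  have h2 := im_energyPairing_ofReal_mul (β := β) (γ := γ) (σ := σ) (h.isProfile t ht)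
    hφ hkc hB' hk'
  have h3 := Complex.reCLM.hasFDerivAt.comp_hasDerivWithinAt t h1
  refine h3.congr_deriv ?_
  rw [momentum, ← h2]
  simp
  ring

theorem hasDerivWithinAt_approxMomentum (h : IsProfileSolution β γ σ I v q) (hI : I.OrdConnected)
    (hβ0 : 0 ≤ β) (hβ2 : β ≤ 2) (hσ : 0 ≤ σ) (hm : IsCutoff m m' m'' X C) (δ : ℝ) {t : ℝ}
    (ht : t ∈ I) :
    HasDerivWithinAt (fun s => approxMomentum m δ (v s))
      (approxRate β γ σ m m' δ (v t) (q t)) I t := by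
  have h1 := h.hasDerivWithinAt_quadratic hI hβ0 hβ2 hσ (isAdjointPair_mul_translate hm δ) ht
  have h3 := (Complex.imCLM.hasFDerivAt.comp_hasDerivWithinAt t h1).const_mul (2 / δ)
  refine h3.congr_deriv ?_
  rw [approxRate]
  congr 1
  simp only [Complex.imCLM_apply, Complex.add_im, Complex.conj_im, Complex.sub_re,
    neg_mul, Complex.neg_im, Complex.I_mul_im]
  ring

/-- The approximate momentum is differentiable in time for each δ > 0. Its increments are integrals
of `approxRate`, and dominated convergence lets δ tend to 0 on both sides. -/
theorem momentum_sub_eq (h : IsProfileSolution β γ σ I v q) (hI : I.OrdConnected)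
    (hβ0 : 0 ≤ β) (hβ2 : β ≤ 2) (hσ : 0 ≤ σ) (hm : IsCutoff m m' m'' X C) {a b : ℝ}
    (ha : a ∈ I) (hb : b ∈ I) (hab : a ≤ b) :
    momentum m (v b) (q b) - momentum m (v a) (q a) =
      ∫ s in a..b, pairRate β γ σ X m m' m'' (v s) (q s) := by
  have hsub : Icc a b ⊆ I := hI.out ha hb
  obtain ⟨N, hN⟩ := (isCompact_Icc (a := a) (b := b)).exists_bound_of_continuousOn
    (h.continuousOn_profileNorm.mono hsub)
  obtain ⟨B, hB⟩ := exists_approxRate_le (γ := γ) hm hβ0 hσ N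
  have hbound : ∀ δ : ℝ, 0 < δ → δ ≤ 1 → ∀ s ∈ Icc a b,
      ‖approxRate β γ σ m m' δ (v s) (q s)‖ ≤ B := fun δ hδ hδ1 s hs =>
    hB _ _ (h.isProfile s (hsub hs)) ((le_abs_self _).trans (hN s hs)) δ hδ hδ1
  have hd : ∀ δ : ℝ, ∀ s ∈ Ioo a b, HasDerivAt (fun s => approxMomentum m δ (v s))
      (approxRate β γ σ m m' δ (v s) (q s)) s := fun δ s hs =>
    (h.hasDerivWithinAt_approxMomentum hI hβ0 hβ2 hσ hm δ
      (hsub (Ioo_subset_Icc_self hs))).hasDerivAt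
      (mem_of_superset (Icc_mem_nhds hs.1 hs.2) hsub)
  -- Measurability in time is free because the function is a derivative in the interior of [a, b].
  have hmeas : ∀ δ : ℝ, AEStronglyMeasurable
      (fun s => approxRate β γ σ m m' δ (v s) (q s)) (volume.restrict (Ioc a b)) := fun δ => by
    rw [← restrict_Ioo_eq_restrict_Ioc]
    refine (measurable_deriv (fun s => approxMomentum m δ (v s))).aestronglyMeasurable.congr ?_
    refine (ae_restrict_iff' measurableSet_Ioo).2 (ae_of_all _ fun s hs => ?_)
    exact (hd δ s hs).deriv
  have hint : ∀ δ : ℝ, 0 < δ → δ ≤ 1 → IntervalIntegrable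
      (fun s => approxRate β γ σ m m' δ (v s) (q s)) volume a b := fun δ hδ hδ1 => by
    rw [intervalIntegrable_iff_integrableOn_Ioc_of_le hab]
    refine (integrable_const B).mono' (hmeas δ) ?_
    exact (ae_restrict_iff' measurableSet_Ioc).2 (ae_of_all _ fun s hs =>
      hbound δ hδ hδ1 s (Ioc_subset_Icc_self hs))
  have hFTC : ∀ δ : ℝ, 0 < δ → δ ≤ 1 → ∫ s in a..b, approxRate β γ σ m m' δ (v s) (q s) =
      approxMomentum m δ (v b) - approxMomentum m δ (v a) := fun δ hδ hδ1 => by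
    refine intervalIntegral.integral_eq_sub_of_hasDerivAt_of_le hab ?_ (hd δ) (hint δ hδ hδ1)
    exact fun s hs => ((h.hasDerivWithinAt_approxMomentum hI hβ0 hβ2 hσ hm δ
      (hsub hs)).continuousWithinAt).mono hsub
  have hlim : Tendsto (fun δ => ∫ s in a..b, approxRate β γ σ m m' δ (v s) (q s)) (𝓝[>] 0)
      (𝓝 (∫ s in a..b, pairRate β γ σ X m m' m'' (v s) (q s))) := by
    refine intervalIntegral.tendsto_integral_filter_of_dominated_convergence (fun _ => B)
      ?_ ?_ intervalIntegrable_const ?_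
    · refine Eventually.of_forall fun δ => ?_
      rw [uIoc_of_le hab]; exact hmeas δ
    · filter_upwards [Ioc_mem_nhdsGT (zero_lt_one' ℝ)] with δ hδ
      refine ae_of_all _ fun s hs => hbound δ hδ.1 hδ.2 s ?_
      rw [uIoc_of_le hab] at hs; exact Ioc_subset_Icc_self hs
    · refine ae_of_all _ fun s hs => ?_
      rw [uIoc_of_le hab] at hs
      exact tendsto_approxRate hm hβ0 hσ (h.isProfile s (hsub (Ioc_subset_Icc_self hs)))
  have hlim' := (tendsto_approxMomentum hm (h.isProfile b hb)).sub
    (tendsto_approxMomentum hm (h.isProfile a ha))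
  refine tendsto_nhds_unique hlim' (hlim.congr' ?_)
  filter_upwards [Ioc_mem_nhdsGT (zero_lt_one' ℝ)] with δ hδ
  exact hFTC δ hδ.1 hδ.2

theorem continuousOn_integral_norm_sq (h : IsProfileSolution β γ σ I v q) {k : ℝ → ℝ} {B : ℝ}
    (hk : Continuous k) (hB : ∀ x, |k x| ≤ B) :
    ContinuousOn (fun s => ∫ x, k x * ‖v s x‖ ^ 2) I := by
  intro t ht
  have hvt := h.isProfile t ht
  have hB0 : 0 ≤ B := (abs_nonneg _).trans (hB 0)
  rw [ContinuousWithinAt, tendsto_iff_norm_sub_tendsto_zero]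
  have hlim := (((h.tendsto t ht).mul ((h.tendsto_profileNorm ht).add_const
    (profileNorm (v t) (q t))))).const_mul B
  rw [zero_mul, mul_zero] at hlim
  refine squeeze_zero' (Eventually.of_forall fun _ => norm_nonneg _) ?_ hlim
  filter_upwards [self_mem_nhdsWithin] with s hs
  refine (abs_integral_mul_norm_sq_sub_le hk hB (h.isProfile s hs).memLp hvt.memLp).trans ?_
  refine mul_le_mul_of_nonneg_left ?_ hB0
  exact mul_le_mul (l2_le_profileNorm _ _) (add_le_add (l2_le_profileNorm _ _)
    (l2_le_profileNorm _ _)) (add_nonneg (l2_nonneg _) (l2_nonneg _)) (profileNorm_nonneg _ _)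

theorem continuousOn_integral_deriv_norm_sq (h : IsProfileSolution β γ σ I v q) {k : ℝ → ℝ}
    {B : ℝ} (hk : Continuous k) (hB : ∀ x, |k x| ≤ B) :
    ContinuousOn (fun s => ∫ x, k x * ‖q s x‖ ^ 2) I := by
  intro t ht
  have hvt := h.isProfile t ht
  have hB0 : 0 ≤ B := (abs_nonneg _).trans (hB 0)
  rw [ContinuousWithinAt, tendsto_iff_norm_sub_tendsto_zero]
  have hlim := (((h.tendsto t ht).mul ((h.tendsto_profileNorm ht).add_const
    (profileNorm (v t) (q t))))).const_mul B
  rw [zero_mul, mul_zero] at hlim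
  refine squeeze_zero' (Eventually.of_forall fun _ => norm_nonneg _) ?_ hlim
  filter_upwards [self_mem_nhdsWithin] with s hs
  refine (abs_integral_mul_norm_sq_sub_le hk hB (h.isProfile s hs).memLp_deriv
    hvt.memLp_deriv).trans ?_
  refine mul_le_mul_of_nonneg_left ?_ hB0
  exact mul_le_mul (l2_deriv_le_profileNorm _ _) (add_le_add (l2_deriv_le_profileNorm _ _)
    (l2_deriv_le_profileNorm _ _)) (add_nonneg (l2_nonneg _) (l2_nonneg _))
    (profileNorm_nonneg _ _)

theorem continuousOn_integral_nonlinear (h : IsProfileSolution β γ σ I v q) (hβ0 : 0 ≤ β)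
    (hβ2 : β ≤ 2) (hσ : 0 < σ) {k : ℝ → ℝ} {B : ℝ} (hk : Continuous k) (hB : ∀ x, |k x| ≤ B) :
    ContinuousOn (fun s => ∫ x, k x * (Real.exp (β * x) * ‖v s x‖ ^ (σ + 2))) I := by
  intro t ht
  have hvt := h.isProfile t ht
  set N := profileNorm (v t) (q t) + 1 with hN
  rw [ContinuousWithinAt, tendsto_iff_norm_sub_tendsto_zero]
  have h1 := ((h.tendsto t ht).const_mul N).const_mul 2
  have hlim := ((h1.add h1).const_mul ((σ + 2) * N ^ σ)).const_mul B
  simp only [mul_zero, add_zero] at hlim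
  refine squeeze_zero' (Eventually.of_forall fun _ => norm_nonneg _) ?_ hlim
  filter_upwards [self_mem_nhdsWithin, h.eventually_profileNorm_le ht] with s hs hs'
  exact abs_integral_nonlinear_sub_le hβ0 hβ2 hσ hk hB (h.isProfile s hs) hvt hs'
    (le_add_of_nonneg_right zero_le_one)

theorem continuousOn_virialRate (h : IsProfileSolution β γ σ I v q) (hβ0 : 0 ≤ β)
    (hβ2 : β ≤ 2) (hσ : 0 < σ) (hm : IsCutoff m m' m'' X C) (hm3c : Continuous m''')
    (hm3C : ∀ x, |m''' x| ≤ C) :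
    ContinuousOn (fun s => virialRate β γ σ m m' m'' m''' (v s) (q s)) I := by
  have hmc := hm.continuous
  have hm'c := hm.continuous_deriv
  have hm''c := hm.continuous_deriv2
  -- The coefficients in `virialRate` are fixed linear combinations of m and its derivatives, hence
  -- bounded.
  have lin : ∀ a b : ℝ, ∀ {x y : ℝ}, |x| ≤ C → |y| ≤ C → |a * x + b * y| ≤ (|a| + |b|) * C :=
    fun a b x y hx hy => by
      refine (abs_add_le _ _).trans ?_
      rw [abs_mul, abs_mul, add_mul]
      exact add_le_add (mul_le_mul_of_nonneg_left hx (abs_nonneg _))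
        (mul_le_mul_of_nonneg_left hy (abs_nonneg _))
  refine ((h.continuousOn_integral_deriv_norm_sq (B := (|4| + |4|) * C) (by fun_prop)
    fun x => ?_).add (h.continuousOn_integral_norm_sq (B := (|4 * γ| + |0|) * C + (|-1| + |-2|) * C)
      (by fun_prop) fun x => ?_)).sub
    (h.continuousOn_integral_nonlinear hβ0 hβ2 hσ
      (B := (|4 - 4 / (σ + 2) * β| + |2 - 4 / (σ + 2)|) * C) (by fun_prop) fun x => ?_)
  · rw [mul_add]; exact lin _ _ (hm.le x) (hm.le' x)
  · have := (abs_add_le _ _).trans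
      (add_le_add (lin (4 * γ) 0 (hm.le x) (hm.le x)) (lin (-1) (-2) (hm3C x) (hm.le'' x)))
    refine le_trans (le_of_eq ?_) this
    congr 1; ring
  · refine le_trans (le_of_eq ?_)
      (lin (4 - 4 / (σ + 2) * β) (2 - 4 / (σ + 2)) (hm.le x) (hm.le' x))
    congr 1; ring

theorem hasDerivWithinAt_momentum (h : IsProfileSolution β γ σ I v q) (hI : I.OrdConnected)
    (hβ0 : 0 ≤ β) (hβ2 : β ≤ 2) (hσ : 0 < σ) (hm : IsCutoff m m' m'' X C)
    (hm3 : ∀ x, HasDerivAt m'' (m''' x) x) (hm3c : Continuous m''') (hm3C : ∀ x, |m''' x| ≤ C)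
    {t : ℝ} (ht : t ∈ I) :
    HasDerivWithinAt (fun s => momentum m (v s) (q s))
      (virialRate β γ σ m m' m'' m''' (v t) (q t)) I t := by
  refine hasDerivWithinAt_of_sub_eq_integral hI
    (h.continuousOn_virialRate hβ0 hβ2 hσ hm hm3c hm3C) (fun a ha b hb hab => ?_) ht
  rw [h.momentum_sub_eq hI hβ0 hβ2 hσ.le hm ha hb hab]
  refine intervalIntegral.integral_congr fun s hs => ?_
  exact pairRate_eq hm hm3 hm3c hm3C hβ0 hβ2 hσ (h.isProfile s (hI.uIcc_subset ha hb hs))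

end IsProfileSolution

/-! ### The truncated weight as a function of the logarithmic radius -/

/-- The profile `y ↦ θ(e^y)`. -/
def logProfile (θ : ℝ → ℝ) (y : ℝ) : ℝ := θ (Real.exp y)

/-- `θ'(r) / r` as a function of `y = log r`. -/
def logSlope (θ : ℝ → ℝ) (y : ℝ) : ℝ := Real.exp (-2 * y) * deriv (logProfile θ) y

namespace IsVirialProfile

variable {θ : ℝ → ℝ}

theorem contDiffAt (hθ : IsVirialProfile θ) {r : ℝ} (hr : 0 < r) : ContDiffAt ℝ 4 θ r :=
  (hθ.contDiffOn r hr.le).contDiffAt (Ici_mem_nhds hr)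

theorem contDiff_logProfile (hθ : IsVirialProfile θ) : ContDiff ℝ 4 (logProfile θ) :=
  contDiff_iff_contDiffAt.2 fun y =>
    (hθ.contDiffAt (Real.exp_pos y)).comp y Real.contDiff_exp.contDiffAt

theorem contDiff_logSlope (hθ : IsVirialProfile θ) : ContDiff ℝ 3 (logSlope θ) := by
  have h1 : ContDiff ℝ 3 (deriv (logProfile θ)) := by
    have := hθ.contDiff_logProfile
    rw [show (4 : WithTop ℕ∞) = 3 + 1 by norm_num, contDiff_succ_iff_deriv] at this
    exact this.2.2
  have h2 : ContDiff ℝ 3 fun y : ℝ => Real.exp (-2 * y) := by fun_prop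
  exact h2.mul h1

theorem contDiff_deriv_logSlope (hθ : IsVirialProfile θ) : ContDiff ℝ 2 (deriv (logSlope θ)) := by
  have := hθ.contDiff_logSlope
  rw [show (3 : WithTop ℕ∞) = 2 + 1 by norm_num, contDiff_succ_iff_deriv] at this
  exact this.2.2

theorem contDiff_deriv2_logSlope (hθ : IsVirialProfile θ) :
    ContDiff ℝ 1 (deriv (deriv (logSlope θ))) := by
  have := hθ.contDiff_deriv_logSlope
  rw [show (2 : WithTop ℕ∞) = 1 + 1 by norm_num, contDiff_succ_iff_deriv] at this
  exact this.2.2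

theorem continuous_deriv3_logSlope (hθ : IsVirialProfile θ) :
    Continuous (deriv (deriv (deriv (logSlope θ)))) :=
  hθ.contDiff_deriv2_logSlope.continuous_deriv le_rfl

theorem logSlope_of_neg (hθ : IsVirialProfile θ) {y : ℝ} (hy : y < 0) : logSlope θ y = 2 := by
  have h1 : logProfile θ =ᶠ[𝓝 y] fun y => Real.exp (2 * y) := by
    filter_upwards [gt_mem_nhds hy] with z hz
    rw [logProfile, hθ.eq_sq _ (Real.exp_pos z).le (Real.exp_le_one_iff.2 hz.le), ← Real.exp_nat_mul]
    norm_num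
  have h2 : HasDerivAt (fun y => Real.exp (2 * y)) (Real.exp (2 * y) * 2) y := by
    simpa using ((hasDerivAt_id y).const_mul 2).exp
  rw [logSlope, h1.deriv_eq, h2.deriv, ← mul_assoc, ← Real.exp_add]
  simp

theorem logSlope_of_gt (hθ : IsVirialProfile θ) {y : ℝ} (hy : Real.log 2 < y) :
    logSlope θ y = 0 := by
  obtain ⟨k, hk⟩ := hθ.eq_const
  have h1 : logProfile θ =ᶠ[𝓝 y] fun _ => k := by
    filter_upwards [lt_mem_nhds hy] with z hz
    rw [logProfile, hk _ ((Real.log_le_iff_le_exp two_pos).1 hz.le)]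
  rw [logSlope, h1.deriv_eq, deriv_const, mul_zero]

/-- θ'(r)/r is locally constant for r < 1 and for r > 2. So after rescaling the derivatives of the
cutoff live in R ≤ |x| ≤ 2R. -/
theorem deriv_logSlope_eq (hθ : IsVirialProfile θ) {y : ℝ} (hy : y < 0 ∨ Real.log 2 < y) :
    deriv (logSlope θ) y = 0 ∧ deriv (deriv (logSlope θ)) y = 0 ∧
      deriv (deriv (deriv (logSlope θ))) y = 0 := by
  have key : ∃ a : ℝ, logSlope θ =ᶠ[𝓝 y] fun _ => a := by
    rcases hy with hy | hy
    · refine ⟨2, ?_⟩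
      filter_upwards [gt_mem_nhds hy] with z hz using hθ.logSlope_of_neg hz
    · refine ⟨0, ?_⟩
      filter_upwards [lt_mem_nhds hy] with z hz using hθ.logSlope_of_gt hz
  obtain ⟨a, ha⟩ := key
  have h1 := ha.deriv
  have h2 := h1.deriv
  have h3 := h2.deriv
  refine ⟨?_, ?_, ?_⟩
  · rw [h1.eq_of_nhds]; simp
  · rw [h2.eq_of_nhds]; simp
  · rw [h3.eq_of_nhds]; simp

theorem _root_.INLS.exists_bound_of_support {f : ℝ → ℝ} (hf : Continuous f) {A : ℝ}
    (hA : ∀ y, y < 0 ∨ Real.log 2 < y → |f y| ≤ A) : ∃ B, ∀ y, |f y| ≤ B := by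
  obtain ⟨B, hB⟩ := (isCompact_Icc (a := (0 : ℝ)) (b := Real.log 2)).exists_bound_of_continuousOn
    hf.continuousOn
  refine ⟨max A B, fun y => ?_⟩
  by_cases hy : y < 0 ∨ Real.log 2 < y
  · exact (hA y hy).trans (le_max_left _ _)
  · push Not at hy
    exact (hB y hy).trans (le_max_right _ _)

theorem exists_logSlope_bound (hθ : IsVirialProfile θ) : ∃ C, 0 ≤ C ∧ ∀ y, |logSlope θ y| ≤ C ∧
    |deriv (logSlope θ) y| ≤ C ∧ |deriv (deriv (logSlope θ)) y| ≤ C ∧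
      |deriv (deriv (deriv (logSlope θ))) y| ≤ C := by
  obtain ⟨A, hA⟩ := exists_bound_of_support hθ.contDiff_logSlope.continuous (A := 2)
    fun y hy => by
      rcases hy with hy | hy
      · rw [hθ.logSlope_of_neg hy]; simp
      · rw [hθ.logSlope_of_gt hy]; simp
  obtain ⟨A1, hA1⟩ := exists_bound_of_support hθ.contDiff_deriv_logSlope.continuous (A := 0)
    fun y hy => by rw [(hθ.deriv_logSlope_eq hy).1, abs_zero]
  obtain ⟨A2, hA2⟩ := exists_bound_of_support hθ.contDiff_deriv2_logSlope.continuous (A := 0)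
    fun y hy => by rw [(hθ.deriv_logSlope_eq hy).2.1, abs_zero]
  obtain ⟨A3, hA3⟩ := exists_bound_of_support hθ.continuous_deriv3_logSlope (A := 0)
    fun y hy => by rw [(hθ.deriv_logSlope_eq hy).2.2, abs_zero]
  have h0 := (abs_nonneg _).trans (hA 0)
  have h1 := (abs_nonneg _).trans (hA1 0)
  have h2 := (abs_nonneg _).trans (hA2 0)
  have h3 := (abs_nonneg _).trans (hA3 0)
  refine ⟨A + A1 + A2 + A3, by positivity, fun y => ⟨?_, ?_, ?_, ?_⟩⟩
  · linarith [hA y]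
  · linarith [hA1 y]
  · linarith [hA2 y]
  · linarith [hA3 y]

theorem exists_logProfile_bound (hθ : IsVirialProfile θ) : ∃ B, ∀ y, |logProfile θ y| ≤ B := by
  obtain ⟨k, hk⟩ := hθ.eq_const
  refine exists_bound_of_support hθ.contDiff_logProfile.continuous (A := max 1 |k|)
    fun y hy => ?_
  rcases hy with hy | hy
  · have h1 := Real.exp_le_one_iff.2 hy.le
    rw [logProfile, hθ.eq_sq _ (Real.exp_pos y).le h1, abs_of_nonneg (by positivity)]
    exact (pow_le_one₀ (Real.exp_pos y).le h1).trans (le_max_left _ _)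
  · rw [logProfile, hk _ ((Real.log_le_iff_le_exp two_pos).1 hy.le)]
    exact le_max_right _ _

/-- The left side is θ''(r) at r = e^y: differentiating θ'(e^y) e^(-y) gives θ'' - θ'/r. -/
theorem logSlope_add_deriv_le (hθ : IsVirialProfile θ) (y : ℝ) :
    logSlope θ y + deriv (logSlope θ) y ≤ 2 := by
  set r := Real.exp y with hr
  have hr0 : 0 < r := Real.exp_pos y
  have hθ' : ∀ z > 0, HasDerivAt θ (deriv θ z) z := fun z hz =>
    ((hθ.contDiffAt hz).differentiableAt (by norm_num)).hasDerivAt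
  have hlp : ∀ z, deriv (logProfile θ) z = deriv θ (Real.exp z) * Real.exp z := fun z =>
    ((hθ' _ (Real.exp_pos z)).comp z (Real.hasDerivAt_exp z)).deriv
  have hls : logSlope θ = fun z => deriv θ (Real.exp z) * Real.exp (-z) := by
    ext z
    rw [logSlope, hlp, mul_left_comm, ← Real.exp_add]
    ring_nf
  have hcd : ContDiffAt ℝ 3 (deriv θ) r := (hθ.contDiffAt hr0).derivWithin (by norm_num)
  have hd2 : HasDerivAt (deriv θ) (deriv (deriv θ) r) r :=
    (hcd.differentiableAt (by norm_num)).hasDerivAt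
  have hle : deriv (deriv θ) r ≤ 2 := by
    have h1 := hθ.deriv_two_le r hr0.le
    rw [iteratedDerivWithin_succ, derivWithin_of_mem_nhds (Ici_mem_nhds hr0)] at h1
    have h2 : iteratedDerivWithin 1 θ (Ici 0) =ᶠ[𝓝 r] deriv θ := by
      filter_upwards [lt_mem_nhds hr0] with z hz
      rw [iteratedDerivWithin_one, derivWithin_of_mem_nhds (Ici_mem_nhds hz)]
    rwa [h2.deriv_eq] at h1
  have hd3 : HasDerivAt (logSlope θ) (deriv (deriv θ) r - deriv θ r * Real.exp (-y)) y := by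
    rw [hls]
    have h1 := (hd2.comp y (Real.hasDerivAt_exp y)).mul (hasDerivAt_neg y).exp
    refine h1.congr_deriv ?_
    have h2 : Real.exp y * Real.exp (-y) = 1 := by rw [← Real.exp_add]; simp
    rw [← hr] at h2 ⊢
    simp only [Function.comp, ← hr]
    linear_combination deriv (deriv θ) r * h2
  rw [hd3.deriv, hls]
  simp only [← hr]
  linarith

/-- This is the bound θ'' ≤ 2 integrated: e^y (2 - θ'/r) is nondecreasing, since its derivative is
e^y (2 - θ''), and it vanishes for y < 0. -/
theorem logSlope_le (hθ : IsVirialProfile θ) (y : ℝ) : logSlope θ y ≤ 2 := by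
  rcases lt_or_ge y 0 with hy | hy
  · exact (hθ.logSlope_of_neg hy).le
  have hd : ∀ z, HasDerivAt (fun z => Real.exp z * (2 - logSlope θ z))
      (Real.exp z * (2 - (logSlope θ z + deriv (logSlope θ) z))) z := fun z => by
    have h1 := (hθ.contDiff_logSlope.differentiable (by norm_num) z).hasDerivAt
    refine ((Real.hasDerivAt_exp z).mul (h1.const_sub 2)).congr_deriv ?_
    ring
  have hmono : Monotone fun z => Real.exp z * (2 - logSlope θ z) :=
    monotone_of_deriv_nonneg (fun z => (hd z).differentiableAt) fun z => by
      rw [(hd z).deriv]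
      exact mul_nonneg (Real.exp_pos z).le (by linarith [hθ.logSlope_add_deriv_le z])
  have h1 := hmono (show (-1 : ℝ) ≤ y by linarith)
  simp only [hθ.logSlope_of_neg (show (-1 : ℝ) < 0 by norm_num), sub_self, mul_zero] at h1
  have h2 := nonneg_of_mul_nonneg_right h1 (Real.exp_pos y)
  linarith

end IsVirialProfile

/-! ### The virial estimate on the line -/

/-- The cutoff `φ_R'(r) / r` for the truncated weight, as a function of `log r`. -/
def virialCutoff (θ : ℝ → ℝ) (R : ℝ) (x : ℝ) : ℝ := logSlope θ (x - Real.log R)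

section estimate

variable {θ : ℝ → ℝ} {β γ σ C R : ℝ} {v q : ℝ → ℂ}

theorem isCutoff_virialCutoff (hθ : IsVirialProfile θ)
    (hC : ∀ y, |logSlope θ y| ≤ C ∧ |deriv (logSlope θ) y| ≤ C ∧
      |deriv (deriv (logSlope θ)) y| ≤ C ∧ |deriv (deriv (deriv (logSlope θ))) y| ≤ C) (R : ℝ) :
    IsCutoff (virialCutoff θ R) (fun x => deriv (logSlope θ) (x - Real.log R))
      (fun x => deriv (deriv (logSlope θ)) (x - Real.log R)) (Real.log 2 + Real.log R) C where
  hasDerivAt x := (hθ.contDiff_logSlope.differentiable (by norm_num) _).hasDerivAt.comp_sub_const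
    x (Real.log R)
  hasDerivAt' x := (hθ.contDiff_deriv_logSlope.differentiable (by norm_num) _).hasDerivAt.comp_sub_const
    x (Real.log R)
  continuous_deriv2 := hθ.contDiff_deriv2_logSlope.continuous.comp (continuous_sub_right _)
  le x := (hC _).1
  le' x := (hC _).2.1
  le'' x := (hC _).2.2.1
  eq_zero x hx := hθ.logSlope_of_gt (by linarith)
  eq_zero' x hx := (hθ.deriv_logSlope_eq (Or.inr (by linarith))).1

/-- The integrand factors as (e^x |v|²)^(σ/2) e^(-ex) (e^x |v|)². Radial decay bounds the first
factor, x ≥ log R the second, and the third is the mass density. -/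
theorem norm_rpow_le_of_log_le (hσ : 0 < σ) (hR : 0 < R) (hv : IsProfile v q) {e : ℝ}
    (he : e = σ / 2 + 2 - β) (he0 : 0 ≤ e) {x : ℝ} (hx : Real.log R ≤ x) :
    Real.exp (β * x) * ‖v x‖ ^ (σ + 2) ≤
      (2 * (l2 q * l2 (expMul v))) ^ (σ / 2) * R ^ (-e) * ‖expMul v x‖ ^ 2 := by
  have h1 := hv.exp_mul_norm_sq_le x
  have h2 : (Real.exp x * ‖v x‖ ^ 2) ^ (σ / 2) ≤ (2 * (l2 q * l2 (expMul v))) ^ (σ / 2) :=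
    Real.rpow_le_rpow (by positivity) h1 (by positivity)
  have h3 : (Real.exp x * ‖v x‖ ^ 2) ^ (σ / 2) = Real.exp (σ / 2 * x) * ‖v x‖ ^ σ := by
    rw [Real.mul_rpow (Real.exp_pos x).le (by positivity), ← Real.exp_mul, ← Real.rpow_natCast,
      ← Real.rpow_mul (norm_nonneg _), mul_comm x]
    congr 2
    push_cast; ring
  have h4 : Real.exp (-e * x) ≤ R ^ (-e) := by
    rw [Real.rpow_def_of_pos hR]
    exact Real.exp_le_exp.2 (by nlinarith)
  rw [norm_rpow_add_two hσ, norm_expMul]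
  have h5 : Real.exp (β * x) * (‖v x‖ ^ σ * (‖v x‖ * ‖v x‖)) =
      (Real.exp (σ / 2 * x) * ‖v x‖ ^ σ) * Real.exp (-e * x) * (Real.exp x * ‖v x‖) ^ 2 := by
    have : Real.exp (β * x) = Real.exp (σ / 2 * x) * Real.exp (-e * x) * Real.exp x ^ 2 := by
      rw [← Real.exp_add, ← Real.exp_nat_mul, ← Real.exp_add, he]
      congr 1; push_cast; ring
    rw [this]; ring
  rw [h5, ← h3]
  have h6 : 0 ≤ 2 * (l2 q * l2 (expMul v)) :=
    mul_nonneg two_pos.le (mul_nonneg (l2_nonneg _) (l2_nonneg _))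
  gcongr

/-- Weighted arithmetic–geometric mean with weights σ/4 and 1 - σ/4. The second entry is chosen so
that its weighted power supplies R^(-e) and cancels the power of ε. -/
theorem young_rpow {a ε : ℝ} (ha : 0 ≤ a) (hε : 0 < ε) (hR : 0 < R) (hσ : 0 < σ) (hσ4 : σ < 4)
    (e : ℝ) : a ^ (σ / 2) * R ^ (-e) ≤
      ε * a ^ 2 + ε ^ (-(σ / (4 - σ))) * R ^ (-(4 * e / (4 - σ))) := by
  have h4 : 0 < 4 - σ := by linarith
  have hw1 : 0 ≤ σ / 4 := by positivity
  have hw2 : 0 ≤ 1 - σ / 4 := by linarith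
  set Y := ε ^ (-(σ / (4 - σ))) * R ^ (-(4 * e / (4 - σ))) with hY
  have hY0 : 0 ≤ Y := by positivity
  have hX0 : 0 ≤ ε * a ^ 2 := by positivity
  have h := Real.geom_mean_le_arith_mean2_weighted hw1 hw2 hX0 hY0 (by ring)
  have e1 : (ε * a ^ 2) ^ (σ / 4) = ε ^ (σ / 4) * a ^ (σ / 2) := by
    rw [Real.mul_rpow hε.le (by positivity), ← Real.rpow_natCast a, ← Real.rpow_mul ha]
    congr 2; push_cast; ring
  have e2 : Y ^ (1 - σ / 4) = ε ^ (-(σ / 4)) * R ^ (-e) := by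
    rw [hY, Real.mul_rpow (by positivity) (by positivity), ← Real.rpow_mul hε.le,
      ← Real.rpow_mul hR.le]
    congr 2 <;> field_simp
  have e3 : ε ^ (σ / 4) * ε ^ (-(σ / 4)) = 1 := by
    rw [← Real.rpow_add hε]; simp
  rw [e1, e2] at h
  calc a ^ (σ / 2) * R ^ (-e) = ε ^ (σ / 4) * a ^ (σ / 2) * (ε ^ (-(σ / 4)) * R ^ (-e)) := by
        linear_combination -(a ^ (σ / 2) * R ^ (-e)) * e3
    _ ≤ σ / 4 * (ε * a ^ 2) + (1 - σ / 4) * Y := h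
    _ ≤ ε * a ^ 2 + Y := by nlinarith

/-- The virial estimate in logarithmic variables. -/
theorem virialRate_le (hθ : IsVirialProfile θ)
    (hC : ∀ y, |logSlope θ y| ≤ C ∧ |deriv (logSlope θ) y| ≤ C ∧
      |deriv (deriv (logSlope θ)) y| ≤ C ∧ |deriv (deriv (deriv (logSlope θ))) y| ≤ C)
    (hβ0 : 0 ≤ β) (hβ2 : β ≤ 2) (hγ : 0 ≤ γ) (hσ : 0 < σ) (hσ4 : σ < 4) (hR : 0 < R)
    (hv : IsProfile v q) {e ε : ℝ} (he : e = σ / 2 + 2 - β) (hε : 0 < ε) :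
    virialRate β γ σ (virialCutoff θ R) (fun x => deriv (logSlope θ) (x - Real.log R))
      (fun x => deriv (deriv (logSlope θ)) (x - Real.log R))
      (fun x => deriv (deriv (deriv (logSlope θ))) (x - Real.log R)) v q ≤
    8 * (l2 q ^ 2 + γ * l2 v ^ 2)
      - (8 - 8 * β / (σ + 2)) * (∫ x, Real.exp (β * x) * ‖v x‖ ^ (σ + 2))
      + 3 * C * R ^ (-2 : ℝ) * l2 (expMul v) ^ 2
      + (8 + 8 * β / (σ + 2) + 6 * C + 4 / (σ + 2) * (3 * C)) *
        (2 ^ (σ / 2) * (l2 (expMul v) ^ 2) ^ (σ / 4 + 1)) *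
        (ε * l2 q ^ 2 + ε ^ (-(σ / (4 - σ))) * R ^ (-(4 * e / (4 - σ)))) := by
  have he0 : 0 ≤ e := by rw [he]; linarith
  have hm := isCutoff_virialCutoff hθ hC R
  set m := virialCutoff θ R with hmdef
  set m' : ℝ → ℝ := fun x => deriv (logSlope θ) (x - Real.log R) with hm'def
  set m'' : ℝ → ℝ := fun x => deriv (deriv (logSlope θ)) (x - Real.log R) with hm''def
  set m''' : ℝ → ℝ := fun x => deriv (deriv (deriv (logSlope θ))) (x - Real.log R) with hm'''def
  have hm3c : Continuous m''' := hθ.continuous_deriv3_logSlope.comp (continuous_sub_right _)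
  have hm3C : ∀ x, |m''' x| ≤ C := fun x => (hC _).2.2.2
  have hmc := hm.continuous
  have hm'c := hm.continuous_deriv
  have hm''c := hm.continuous_deriv2
  have hC0 : 0 ≤ C := (abs_nonneg _).trans (hm.le 0)
  have hσ2 : 0 < σ + 2 := by linarith
  -- Inside the ball of radius R the weight is |x|² and the integrands coincide with those of the
  -- untruncated identity.
  have hleft : ∀ x, x < Real.log R → m x = 2 ∧ m' x = 0 ∧ m'' x = 0 ∧ m''' x = 0 := fun x hx =>
    ⟨hθ.logSlope_of_neg (by linarith), hθ.deriv_logSlope_eq (Or.inl (by linarith))⟩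
  set Λ := 8 - 8 * β / (σ + 2) with hΛ
  set K := 8 + 8 * β / (σ + 2) + 6 * C + 4 / (σ + 2) * (3 * C) with hK
  have hK0 : 0 ≤ K := by positivity
  have hqq := (memLp_two_iff_integrable_sq_norm hv.memLp_deriv.1).1 hv.memLp_deriv
  have hvv := hv.integrable_norm_sq
  have hee := (memLp_two_iff_integrable_sq_norm hv.memLp_exp.1).1 hv.memLp_exp
  have b1 : ∫ x, 4 * (m x + m' x) * ‖q x‖ ^ 2 ≤ 8 * l2 q ^ 2 := by
    rw [l2_sq hv.memLp_deriv, ← integral_const_mul]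
    refine integral_mono (integrable_mul_norm_sq (k := fun x => 4 * (m x + m' x)) (C := 8 * C)
      (by fun_prop) (fun x => ?_) hv.memLp_deriv) (hqq.const_mul 8) fun x => ?_
    · have := abs_add_le (m x) (m' x)
      rw [abs_mul, abs_of_pos four_pos]
      linarith [hm.le x, hm.le' x]
    · have := hθ.logSlope_add_deriv_le (x - Real.log R)
      have h2 : m x + m' x ≤ 2 := this
      dsimp only
      nlinarith [sq_nonneg ‖q x‖]
  have hR2 : ∀ x, Real.log R ≤ x → 1 ≤ R ^ (-2 : ℝ) * Real.exp x ^ 2 := fun x hx => by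
    have h1 : R ≤ Real.exp x := (Real.log_le_iff_le_exp hR).1 hx
    rw [Real.rpow_neg hR.le, ← div_eq_inv_mul, le_div_iff₀ (by positivity), one_mul]
    have : R ^ (2 : ℝ) = R ^ 2 := by norm_cast
    rw [this]
    gcongr
  have b2 : ∫ x, (4 * γ * m x - (m''' x + 2 * m'' x)) * ‖v x‖ ^ 2 ≤
      8 * γ * l2 v ^ 2 + 3 * C * R ^ (-2 : ℝ) * l2 (expMul v) ^ 2 := by
    rw [l2_sq hv.memLp, l2_sq hv.memLp_exp, ← integral_const_mul, ← integral_const_mul,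
      ← integral_add (hvv.const_mul _) (hee.const_mul _)]
    refine integral_mono (integrable_mul_norm_sq
      (k := fun x => 4 * γ * m x - (m''' x + 2 * m'' x)) (C := 4 * γ * C + 3 * C)
      (by fun_prop) (fun x => ?_) hv.memLp) ((hvv.const_mul _).add (hee.const_mul _)) fun x => ?_
    · have h1 := abs_sub (4 * γ * m x) (m''' x + 2 * m'' x)
      have h2 := abs_add_le (m''' x) (2 * m'' x)
      rw [abs_mul 2, abs_two] at h2
      rw [abs_mul (4 * γ), abs_of_nonneg (by positivity : 0 ≤ 4 * γ)] at h1
      have h3 := mul_le_mul_of_nonneg_left (hm.le x) (by positivity : 0 ≤ 4 * γ)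
      linarith [hm.le'' x, hm3C x]
    · dsimp only
      have hml : m x ≤ 2 := hθ.logSlope_le _
      have h1 : 4 * γ * m x * ‖v x‖ ^ 2 ≤ 8 * γ * ‖v x‖ ^ 2 := by
        refine mul_le_mul_of_nonneg_right ?_ (by positivity)
        nlinarith
      have h2 : -(m''' x + 2 * m'' x) * ‖v x‖ ^ 2 ≤ 3 * C * R ^ (-2 : ℝ) * ‖expMul v x‖ ^ 2 := by
        rcases lt_or_ge x (Real.log R) with hx | hx
        · obtain ⟨-, -, h3, h4⟩ := hleft x hx
          rw [h3, h4]
          simp only [mul_zero, add_zero, neg_zero, zero_mul]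
          positivity
        · have h3 : -(m''' x + 2 * m'' x) ≤ 3 * C := by
            linarith [(abs_le.1 (hm.le'' x)).1, (abs_le.1 (hm3C x)).1]
          rw [norm_expMul, mul_pow]
          calc -(m''' x + 2 * m'' x) * ‖v x‖ ^ 2 ≤ 3 * C * ‖v x‖ ^ 2 := by gcongr
            _ = 3 * C * ‖v x‖ ^ 2 * 1 := by ring
            _ ≤ 3 * C * ‖v x‖ ^ 2 * (R ^ (-2 : ℝ) * Real.exp x ^ 2) := by
                gcongr; exact hR2 x hx
            _ = _ := by ring
      linarith
  have hnl := integrable_exp_mul_norm_rpow hβ0 hβ2 hσ hv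
  have b3 : -∫ x, (2 * (m' x + 2 * m x) - 4 / (σ + 2) * (β * m x + m' x)) *
        (Real.exp (β * x) * ‖v x‖ ^ (σ + 2)) ≤
      -(Λ * ∫ x, Real.exp (β * x) * ‖v x‖ ^ (σ + 2)) +
        K * ((2 * (l2 q * l2 (expMul v))) ^ (σ / 2) * R ^ (-e)) * l2 (expMul v) ^ 2 := by
    have hkb : ∀ x, |2 * (m' x + 2 * m x) - 4 / (σ + 2) * (β * m x + m' x)| ≤
        6 * C + 4 / (σ + 2) * (3 * C) := fun x => by
      have h1 := abs_sub (2 * (m' x + 2 * m x)) (4 / (σ + 2) * (β * m x + m' x))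
      have h2 := abs_add_le (m' x) (2 * m x)
      have h3 := abs_add_le (β * m x) (m' x)
      rw [abs_mul, abs_two] at h2
      rw [abs_mul, abs_of_nonneg hβ0] at h3
      rw [abs_mul 2, abs_two, abs_mul (4 / (σ + 2)),
        abs_of_nonneg (by positivity : 0 ≤ 4 / (σ + 2))] at h1
      have h4 : β * |m x| ≤ 2 * C := mul_le_mul hβ2 (hm.le x) (abs_nonneg _) two_pos.le
      have h5 : |β * m x + m' x| ≤ 3 * C := by linarith [hm.le' x]
      have h6 := mul_le_mul_of_nonneg_left h5 (by positivity : 0 ≤ 4 / (σ + 2))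
      linarith [hm.le x, hm.le' x]
    have i1 := integrable_mul_exp_mul_norm_rpow (σ := σ) hβ0 hβ2 hσ
      (k := fun x => 2 * (m' x + 2 * m x) - 4 / (σ + 2) * (β * m x + m' x))
      (by fun_prop) hkb hv
    have i2 : Integrable fun x => -(Λ * (Real.exp (β * x) * ‖v x‖ ^ (σ + 2))) :=
      (hnl.const_mul Λ).neg
    rw [l2_sq hv.memLp_exp, ← integral_neg, ← integral_const_mul, ← integral_const_mul,
      ← integral_neg, ← integral_add i2 (hee.const_mul _)]
    refine integral_mono i1.neg (i2.add (hee.const_mul _)) fun x => ?_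
    dsimp only
    have hω : 0 ≤ Real.exp (β * x) * ‖v x‖ ^ (σ + 2) := by positivity
    have hl2 : 0 ≤ l2 q * l2 (expMul v) := mul_nonneg (l2_nonneg _) (l2_nonneg _)
    rcases lt_or_ge x (Real.log R) with hx | hx
    · obtain ⟨h1, h2, -, -⟩ := hleft x hx
      have h3 : 2 * (m' x + 2 * m x) - 4 / (σ + 2) * (β * m x + m' x) = Λ := by
        rw [h1, h2, hΛ]; ring
      rw [h3]
      exact le_add_of_nonneg_right (by positivity)
    · have h1 := norm_rpow_le_of_log_le hσ hR hv he he0 hx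
      -- Λ is the coefficient for the weight |x|². K adds a bound for |Λ| to a bound for the
      -- truncated coefficient, so no sign information is needed outside the ball.
      have h2 : Λ - (2 * (m' x + 2 * m x) - 4 / (σ + 2) * (β * m x + m' x)) ≤ K := by
        have h3 := (abs_le.1 (hkb x)).1
        have h4 : 0 ≤ 8 * β / (σ + 2) := by positivity
        rw [hΛ, hK]
        linarith
      have h5 : (Λ - (2 * (m' x + 2 * m x) - 4 / (σ + 2) * (β * m x + m' x))) *
          (Real.exp (β * x) * ‖v x‖ ^ (σ + 2)) ≤
          K * ((2 * (l2 q * l2 (expMul v))) ^ (σ / 2) * R ^ (-e) * ‖expMul v x‖ ^ 2) :=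
        mul_le_mul h2 h1 hω hK0
      linarith
  have b4 : (2 * (l2 q * l2 (expMul v))) ^ (σ / 2) * R ^ (-e) * l2 (expMul v) ^ 2 ≤
      2 ^ (σ / 2) * (l2 (expMul v) ^ 2) ^ (σ / 4 + 1) *
        (ε * l2 q ^ 2 + ε ^ (-(σ / (4 - σ))) * R ^ (-(4 * e / (4 - σ)))) := by
    have hE := l2_nonneg (expMul v)
    have hQ := l2_nonneg q
    have h1 := young_rpow hQ hε hR hσ hσ4 e
    -- Collects all powers of the mass, so that Young's inequality acts only on the norm of q.
    have h2 : (2 * (l2 q * l2 (expMul v))) ^ (σ / 2) * R ^ (-e) * l2 (expMul v) ^ 2 =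
        2 ^ (σ / 2) * (l2 (expMul v) ^ 2) ^ (σ / 4 + 1) * (l2 q ^ (σ / 2) * R ^ (-e)) := by
      have h3 : (l2 (expMul v) ^ 2) ^ (σ / 4 + 1) =
          l2 (expMul v) ^ (σ / 2) * l2 (expMul v) ^ 2 := by
        rw [Real.rpow_add_one' (by positivity) (by positivity), ← Real.rpow_natCast,
          ← Real.rpow_mul hE]
        congr 2; push_cast; ring
      rw [h3, Real.mul_rpow two_pos.le (by positivity), Real.mul_rpow hQ hE]
      ring
    rw [h2]
    exact mul_le_mul_of_nonneg_left h1 (by positivity)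
  have b5 := mul_le_mul_of_nonneg_left b4 hK0
  rw [virialRate]
  linarith

end estimate

/-! ### Logarithmic polar coordinates -/

/-- The logarithmic radius on `ℝ^d`. -/
def logNorm {d : ℕ} (x : Space d) : ℝ := Real.log ‖x‖

/-- The surface area of the unit sphere of `ℝ^d`. -/
def sphereArea (d : ℕ) : ℝ := d * volume.real (Metric.ball (0 : Space d) 1)

section logNorm

variable {d : ℕ}

theorem measurable_logNorm : Measurable (logNorm : Space d → ℝ) :=
  Real.measurable_log.comp measurable_norm

theorem exp_logNorm {x : Space d} (hx : 0 < ‖x‖) (a : ℝ) :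
    Real.exp (a * logNorm x) = ‖x‖ ^ a := by
  rw [logNorm, mul_comm, Real.rpow_def_of_pos hx]

variable [NeZero d]

instance : Nontrivial (Space d) := by
  have : Nonempty (Fin d) := ⟨0⟩
  infer_instance

theorem sphereArea_pos : 0 < sphereArea d := by
  have : 0 < volume.real (Metric.ball (0 : Space d) 1) :=
    ENNReal.toReal_pos (Metric.measure_ball_pos _ _ one_pos).ne' measure_ball_lt_top.ne
  have hd : (0 : ℝ) < d := by exact_mod_cast Nat.pos_of_ne_zero (NeZero.ne d)
  exact mul_pos hd this

variable {E : Type*} [NormedAddCommGroup E] [NormedSpace ℝ E]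

/-- Polar coordinates followed by r = e^y: the density r^(d-1) dr becomes e^(dy) dy. -/
theorem integrable_comp_logNorm {F : ℝ → E} :
    Integrable (fun x : Space d => F (logNorm x)) ↔
      Integrable (fun y => Real.exp (d * y) • F y) := by
  have h1 := integrable_fun_norm_addHaar (volume : Measure (Space d)) (f := fun r => F (Real.log r))
  have h2 := integrableOn_image_iff_integrableOn_abs_deriv_smul (s := univ) MeasurableSet.univ
    (fun x _ => (Real.hasDerivAt_exp x).hasDerivWithinAt) Real.exp_injective.injOn
    (fun r => r ^ (Module.finrank ℝ (Space d) - 1) • F (Real.log r))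
  rw [image_univ, Real.range_exp] at h2
  refine h1.trans (h2.trans ?_)
  rw [integrableOn_univ]
  refine integrable_congr (ae_of_all _ fun y => ?_)
  simp only [Real.log_exp, abs_of_pos (Real.exp_pos _), smul_smul, finrank_euclideanSpace_fin]
  rw [← pow_succ', Nat.sub_add_cancel (Nat.pos_of_ne_zero (NeZero.ne d)), ← Real.exp_nat_mul]

theorem integral_comp_logNorm (F : ℝ → E) :
    ∫ x : Space d, F (logNorm x) = sphereArea d • ∫ y, Real.exp (d * y) • F y := by
  have h1 := integral_fun_norm_addHaar (volume : Measure (Space d)) (fun r => F (Real.log r))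
  have h2 := integral_image_eq_integral_abs_deriv_smul (s := univ) MeasurableSet.univ
    (fun x _ => (Real.hasDerivAt_exp x).hasDerivWithinAt) Real.exp_injective.injOn
    (fun r => r ^ (Module.finrank ℝ (Space d) - 1) • F (Real.log r))
  rw [image_univ, Real.range_exp] at h2
  refine h1.trans ?_
  rw [h2, finrank_euclideanSpace_fin, ← Nat.cast_smul_eq_nsmul ℝ, smul_smul, sphereArea,
    setIntegral_univ]
  congr 1
  refine integral_congr_ae (ae_of_all _ fun y => ?_)
  simp only [Real.log_exp, abs_of_pos (Real.exp_pos _), smul_smul]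
  rw [← pow_succ', Nat.sub_add_cancel (Nat.pos_of_ne_zero (NeZero.ne d)), ← Real.exp_nat_mul]

theorem ae_comp_logNorm_iff {P : ℝ → Prop} :
    (∀ᵐ x : Space d, P (logNorm x)) ↔ ∀ᵐ y, P y := by
  -- The exceptional set need not be measurable. Null sets are detected through integrability and
  -- vanishing of this indicator, for which the change of variables is available.
  set F : ℝ → ℝ := {y | ¬P y}.indicator (fun _ => 1) with hF
  have hF0 : ∀ y, F y = 0 ↔ P y := fun y => by by_cases hy : P y <;> simp [hF, hy]
  have hFn : ∀ y, 0 ≤ F y := indicator_nonneg (by simp)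
  have hI := integral_comp_logNorm (d := d) F
  have hG0 : ∀ y, Real.exp (d * y) • F y = 0 ↔ P y := fun y => by
    rw [smul_eq_zero, or_iff_right (Real.exp_pos _).ne', hF0]
  constructor
  · intro h
    have h1 : (fun x : Space d => F (logNorm x)) =ᵐ[volume] 0 :=
      h.mono fun x hx => (hF0 _).2 hx
    have h2 := integrable_comp_logNorm.1 ((integrable_zero _ _ _).congr h1.symm)
    rw [integral_congr_ae h1, Pi.zero_def, integral_zero, eq_comm, smul_eq_zero,
      or_iff_right sphereArea_pos.ne'] at hI
    exact ((integral_eq_zero_iff_of_nonneg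
      (fun y => smul_nonneg (Real.exp_pos _).le (hFn y)) h2).1 hI).mono fun y hy => (hG0 y).1 hy
  · intro h
    have h1 : (fun y => Real.exp (d * y) • F y) =ᵐ[volume] 0 :=
      h.mono fun y hy => (hG0 y).2 hy
    have h2 := integrable_comp_logNorm.2 ((integrable_zero _ _ _).congr h1.symm)
    rw [integral_congr_ae h1, Pi.zero_def, integral_zero, smul_zero,
      integral_eq_zero_iff_of_nonneg (fun x => hFn _) h2] at hI
    exact hI.mono fun x hx => (hF0 _).1 hx

/-- The logarithmic radius is quasi measure preserving. -/
theorem quasiMeasurePreserving_logNorm :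
    Measure.QuasiMeasurePreserving (logNorm : Space d → ℝ) volume volume := by
  refine ⟨measurable_logNorm, Measure.AbsolutelyContinuous.mk fun s hs h0 => ?_⟩
  rw [Measure.map_apply measurable_logNorm hs]
  have := (ae_comp_logNorm_iff (d := d) (P := fun y => y ∉ s)).2 (by simpa [ae_iff] using h0)
  simpa [ae_iff, preimage] using this

theorem ae_pos_norm : ∀ᵐ x : Space d, 0 < ‖x‖ := by
  filter_upwards [(measure_eq_zero_iff_ae_notMem.1 (measure_singleton (0 : Space d)))] with x hx
  exact norm_pos_iff.2 hx

/-- `F(log |x|)` is square integrable on `ℝ^d` if and only if `e^{dy/2} F(y)` is. -/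
theorem memLp_comp_logNorm_iff {F : ℝ → E} (hF : AEStronglyMeasurable F volume) :
    MemLp (fun x : Space d => F (logNorm x)) 2 volume ↔
      Integrable (fun y => Real.exp (d * y) * ‖F y‖ ^ 2) := by
  have h : AEStronglyMeasurable (fun x : Space d => F (logNorm x)) volume :=
    hF.comp_quasiMeasurePreserving quasiMeasurePreserving_logNorm
  rw [memLp_two_iff_integrable_sq_norm h]
  exact integrable_comp_logNorm (F := fun y => ‖F y‖ ^ 2)

/-- If `F(log |x|)` is locally integrable then `F` is measurable. -/
theorem aestronglyMeasurable_of_comp_logNorm {F : ℝ → E}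
    (h : ∀ r, IntegrableOn (fun x : Space d => F (logNorm x)) (Metric.ball 0 r)) :
    AEStronglyMeasurable F volume := by
  have h1 : ∀ n : ℕ, AEStronglyMeasurable F (volume.restrict (Iio (n : ℝ))) := by
    intro n
    have h2 : Integrable (fun x : Space d => (Iio (n : ℝ)).indicator F (logNorm x)) := by
      have h3 := ((integrable_indicator_iff measurableSet_ball).2 (h (Real.exp n)))
      refine h3.congr ?_
      filter_upwards [ae_pos_norm] with x hx
      have : logNorm x ∈ Iio (n : ℝ) ↔ x ∈ Metric.ball (0 : Space d) (Real.exp n) := by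
        rw [mem_Iio, logNorm, Real.log_lt_iff_lt_exp hx, mem_ball_zero_iff]
      by_cases hxb : x ∈ Metric.ball (0 : Space d) (Real.exp n)
      · rw [indicator_of_mem hxb, indicator_of_mem (this.2 hxb)]
      · rw [indicator_of_notMem hxb, indicator_of_notMem (fun h => hxb (this.1 h))]
    have h4 := (integrable_comp_logNorm.1 h2).aestronglyMeasurable
    have h5 : AEStronglyMeasurable ((Iio (n : ℝ)).indicator F) volume := by
      have h6 : Continuous fun y : ℝ => Real.exp (-(d * y)) := by fun_prop
      refine (h6.aestronglyMeasurable.smul h4).congr (ae_of_all _ fun y => ?_)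
      simp only [Pi.smul_apply', smul_smul]
      rw [← Real.exp_add, neg_add_cancel, Real.exp_zero, one_smul]
    exact (aestronglyMeasurable_indicator_iff measurableSet_Iio).1 h5
  have h2 : (⋃ n : ℕ, Iio (n : ℝ)) = univ :=
    eq_univ_of_forall fun y => mem_iUnion.2 (exists_nat_gt y)
  rw [← Measure.restrict_univ (μ := volume), ← h2]
  exact aestronglyMeasurable_iUnion_iff.2 h1

end logNorm

/-! ### Weak gradients of radial functions -/

/-- The vector field `p(log |x|) x / |x|`. -/
def radialField {d : ℕ} (p : ℝ → ℂ) (x : Space d) : EuclideanSpace ℂ (Fin d) :=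
  WithLp.toLp 2 fun j => p (logNorm x) * ((x j / ‖x‖ : ℝ) : ℂ)

section

variable {d : ℕ} {p F F' : ℝ → ℂ}

theorem radialField_apply (p : ℝ → ℂ) (x : Space d) (j : Fin d) :
    radialField p x j = p (logNorm x) * ((x j / ‖x‖ : ℝ) : ℂ) := rfl

theorem abs_apply_div_norm_le (x : Space d) (j : Fin d) : |x j / ‖x‖| ≤ 1 := by
  rw [abs_div, abs_norm]
  exact div_le_one_of_le₀ (by simpa using PiLp.norm_apply_le x j) (norm_nonneg x)

theorem hasFDerivAt_logNorm {x : Space d} (hx : x ≠ 0) :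
    HasFDerivAt (logNorm : Space d → ℝ) ((‖x‖ ^ 2)⁻¹ • innerSL ℝ x) x := by
  have h1 : (logNorm : Space d → ℝ) = fun y => (1 / 2) * Real.log (‖y‖ ^ 2) := by
    ext y; rw [Real.log_pow, logNorm]; push_cast; ring
  have h2 : ‖x‖ ^ 2 ≠ 0 := by simpa using hx
  rw [h1]
  have h3 := (((hasStrictFDerivAt_norm_sq x).hasFDerivAt).log h2).const_mul (1 / 2)
  refine h3.congr_fderiv ?_
  ext y
  simp
  ring

theorem contDiffAt_logNorm {n : ℕ∞ω} {x : Space d} (hx : x ≠ 0) :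
    ContDiffAt ℝ n (logNorm : Space d → ℝ) x :=
  (contDiffAt_norm ℝ hx).log (norm_ne_zero_iff.2 hx)

theorem logNorm_le_iff {x : Space d} (hx : 0 < ‖x‖) {B : ℝ} :
    logNorm x ≤ B ↔ ‖x‖ ≤ Real.exp B := Real.log_le_iff_le_exp hx

variable [NeZero d]

/-- Integration by parts for a radial function which is constant near the origin. -/
theorem integral_comp_logNorm_mul_fderiv (hF : ∀ y, HasDerivAt F (F' y) y) (hF' : Continuous F')
    {a : ℝ} (ha : ∀ y ≤ a, F' y = 0) {ψ : Space d → ℝ} (hψ : ContDiff ℝ ∞ ψ)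
    (hψc : HasCompactSupport ψ) (j : Fin d) :
    Integrable (fun x => F (logNorm x) *
      ((fderiv ℝ ψ x (EuclideanSpace.single j 1) : ℝ) : ℂ)) ∧
    ∫ x, F (logNorm x) * ((fderiv ℝ ψ x (EuclideanSpace.single j 1) : ℝ) : ℂ) =
      -∫ x, radialField (fun y => Real.exp (-y) * F' y) x j * (ψ x : ℂ) := by
  classical
  set e : Space d := EuclideanSpace.single j 1
  set f : Space d → ℂ := fun x => if ‖x‖ < Real.exp a then F a else F (logNorm x) with hf
  have hFa : ∀ y ≤ a, F y = F a := by
    intro y hy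
    have h1 := intervalIntegral.integral_eq_sub_of_hasDerivAt (fun z _ => hF z)
      (hF'.intervalIntegrable y a)
    rw [intervalIntegral.integral_congr (g := fun _ => (0 : ℂ))] at h1
    · simp only [intervalIntegral.integral_zero] at h1
      exact (sub_eq_zero.1 h1.symm).symm
    · intro z hz
      rw [uIcc_of_le hy] at hz
      exact ha z hz.2
  have hfeq : ∀ x : Space d, x ≠ 0 → f x = F (logNorm x) := by
    intro x hx
    by_cases h : ‖x‖ < Real.exp a
    · simp only [hf, if_pos h]
      exact (hFa _ ((logNorm_le_iff (norm_pos_iff.2 hx)).2 h.le)).symm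
    · simp only [hf, if_neg h]
  have hf0 : f =ᶠ[𝓝 0] fun _ => F a := by
    filter_upwards [Metric.ball_mem_nhds (0 : Space d) (Real.exp_pos a)] with x hx
    simp only [hf, if_pos (mem_ball_zero_iff.1 hx)]
  have hfx : ∀ x : Space d, x ≠ 0 → f =ᶠ[𝓝 x] fun y => F (logNorm y) := fun x hx => by
    filter_upwards [isOpen_ne.mem_nhds hx] with y hy using hfeq y hy
  have hFC : ContDiff ℝ 1 F := by
    rw [contDiff_one_iff_deriv]
    refine ⟨fun y => (hF y).differentiableAt, ?_⟩
    rwa [funext fun y => (hF y).deriv]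
  have hfC : ContDiff ℝ 1 f := by
    rw [contDiff_iff_contDiffAt]
    intro x
    by_cases hx : x = 0
    · subst hx
      exact contDiffAt_const.congr_of_eventuallyEq hf0
    · exact (hFC.contDiffAt.comp x (contDiffAt_logNorm hx)).congr_of_eventuallyEq (hfx x hx)
  have hfd : ∀ x : Space d, x ≠ 0 →
      fderiv ℝ f x e = radialField (fun y => Real.exp (-y) * F' y) x j := by
    intro x hx
    have h1 : HasFDerivAt f _ x :=
      ((hF (logNorm x)).hasFDerivAt.comp x (hasFDerivAt_logNorm hx)).congr_of_eventuallyEq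
        (hfx x hx)
    have hx' : 0 < ‖x‖ := norm_pos_iff.2 hx
    have h2 : Real.exp (-logNorm x) = ‖x‖⁻¹ := by rw [Real.exp_neg, logNorm, Real.exp_log hx']
    rw [h1.fderiv, radialField_apply, h2]
    have : inner ℝ x e = x j := by simp [e, EuclideanSpace.inner_single_right]
    simp [this]
    field_simp
  set Ψ : Space d → ℂ := fun x => (ψ x : ℂ)
  have hΨd : ∀ x, HasFDerivAt Ψ (Complex.ofRealCLM.comp (fderiv ℝ ψ x)) x := fun x =>
    Complex.ofRealCLM.hasFDerivAt.comp x
      ((hψ.differentiable (by simp)) x).hasFDerivAt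
  have hΨe : ∀ x, fderiv ℝ Ψ x e = ((fderiv ℝ ψ x e : ℝ) : ℂ) := fun x => by
    rw [(hΨd x).fderiv]; simp
  have hΨc : Continuous Ψ := Complex.continuous_ofReal.comp hψ.continuous
  have hΨs : HasCompactSupport Ψ := hψc.comp_left (g := fun r : ℝ => (r : ℂ)) (by simp)
  have hdc : Continuous fun x => fderiv ℝ ψ x e :=
    (hψ.continuous_fderiv (by simp)).clm_apply continuous_const
  have hds : HasCompactSupport fun x => fderiv ℝ ψ x e := hψc.fderiv_apply ℝ e
  have hdΨs : HasCompactSupport fun x => fderiv ℝ Ψ x e := by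
    rw [funext hΨe]; exact hds.comp_left (g := fun r : ℝ => (r : ℂ)) (by simp)
  have hdΨc : Continuous fun x => fderiv ℝ Ψ x e := by
    rw [funext hΨe]; exact Complex.continuous_ofReal.comp hdc
  have hi1 : Integrable (fun x => f x * fderiv ℝ Ψ x e) :=
    (hfC.continuous.mul hdΨc).integrable_of_hasCompactSupport hdΨs.mul_left
  have key := integral_mul_fderiv_eq_neg_fderiv_mul_of_integrable (𝕜 := ℂ) (f := f) (g := Ψ)
    (v := e) (μ := volume)
    ((((hfC.continuous_fderiv one_ne_zero).clm_apply continuous_const).mul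
      hΨc).integrable_of_hasCompactSupport hΨs.mul_left) hi1
    ((hfC.continuous.mul hΨc).integrable_of_hasCompactSupport hΨs.mul_left)
    (fun x _ => (hfC.differentiable one_ne_zero) x) (fun x _ => (hΨd x).differentiableAt)
  have hae : (fun x => f x * fderiv ℝ Ψ x e) =ᵐ[volume]
      fun x => F (logNorm x) * ((fderiv ℝ ψ x e : ℝ) : ℂ) := by
    filter_upwards [ae_pos_norm (d := d)] with x hx
    rw [hfeq x (norm_pos_iff.1 hx), hΨe]
  refine ⟨hi1.congr hae, ?_⟩
  rw [← integral_congr_ae hae, key, neg_inj]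
  refine integral_congr_ae ?_
  filter_upwards [ae_pos_norm (d := d)] with x hx
  rw [hfd x (norm_pos_iff.1 hx)]

/-- A bound for integrals over a ball of radius `e^B` in logarithmic polar coordinates. -/
theorem integral_comp_logNorm_mul_le {D : ℝ → ℂ} {B : ℝ}
    (hD : IntegrableOn (fun y => (Real.exp (d * y) : ℂ) * D y) (Iic B)) {χ : Space d → ℂ}
    (hχ : AEStronglyMeasurable χ volume) {M : ℝ} (hM : ∀ x, ‖χ x‖ ≤ M)
    (hχB : ∀ x, Real.exp B < ‖x‖ → χ x = 0) :
    Integrable (fun x => D (logNorm x) * χ x) ∧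
    ‖∫ x, D (logNorm x) * χ x‖ ≤
      M * (sphereArea d * ∫ y in Iic B, ‖(Real.exp (d * y) : ℂ) * D y‖) := by
  have h1 : Integrable (fun y => Real.exp (d * y) • (Iic B).indicator D y) := by
    refine ((integrable_indicator_iff measurableSet_Iic).2 hD).congr (ae_of_all _ fun y => ?_)
    by_cases hy : y ∈ Iic B <;> simp [hy]
  have h2 : Integrable (fun x : Space d => (Iic B).indicator D (logNorm x)) :=
    integrable_comp_logNorm.2 h1
  have hae : ∀ᵐ x : Space d, (Iic B).indicator D (logNorm x) * χ x = D (logNorm x) * χ x := by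
    filter_upwards [ae_pos_norm (d := d)] with x hx
    by_cases hxB : logNorm x ∈ Iic B
    · rw [indicator_of_mem hxB]
    · rw [hχB x (lt_of_not_ge fun h => hxB ((logNorm_le_iff hx).2 h)), mul_zero, mul_zero]
  have h3 : Integrable (fun x => (Iic B).indicator D (logNorm x) * χ x) :=
    h2.mul_bdd hχ (ae_of_all _ hM)
  refine ⟨h3.congr hae, ?_⟩
  rw [← integral_congr_ae hae]
  have h4 := integral_comp_logNorm (d := d) (fun y => ‖(Iic B).indicator D y‖)
  calc ‖∫ x, (Iic B).indicator D (logNorm x) * χ x‖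
      ≤ ∫ x, ‖(Iic B).indicator D (logNorm x) * χ x‖ := norm_integral_le_integral_norm _
    _ ≤ ∫ x : Space d, M * ‖(Iic B).indicator D (logNorm x)‖ := by
        refine integral_mono h3.norm (h2.norm.const_mul M) fun x => ?_
        simp only [norm_mul]
        rw [mul_comm]
        exact mul_le_mul_of_nonneg_right (hM x) (norm_nonneg _)
    _ = _ := by
        rw [integral_const_mul, h4, ← integral_indicator measurableSet_Iic, smul_eq_mul]
        congr 3
        ext y
        by_cases hy : y ∈ Iic B
        · simp only [indicator_of_mem hy, norm_mul, smul_eq_mul]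
          rw [Complex.norm_real, Real.norm_of_nonneg (Real.exp_pos _).le]
        · simp [hy]

/-- The distributional gradient of a radial function is the radial derivative times `x / |x|`,
including across the origin. -/
theorem isWeakGradient_radialField (hF : IsPrimitive F (fun z => (Real.exp z : ℂ) * p z))
    (hp : ∀ B, IntegrableOn (fun z => (Real.exp (d * z) : ℂ) * p z) (Iic B)) :
    IsWeakGradient (fun x : Space d => F (logNorm x)) (radialField p) := by
  intro ψ hψ hψc j
  set e : Space d := EuclideanSpace.single j 1
  have hdc : Continuous fun x => fderiv ℝ ψ x e :=
    (hψ.continuous_fderiv (by simp)).clm_apply continuous_const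
  have hds : HasCompactSupport fun x => fderiv ℝ ψ x e := hψc.fderiv_apply ℝ e
  obtain ⟨M₁, hM₁⟩ := hψ.continuous.bounded_above_of_compact_support hψc
  obtain ⟨M₂, hM₂⟩ := hdc.bounded_above_of_compact_support hds
  set M := max M₁ M₂
  have hM0 : 0 ≤ M := ((norm_nonneg _).trans (hM₁ 0)).trans (le_max_left _ _)
  obtain ⟨r, hr⟩ := hψc.isCompact.isBounded.subset_closedBall (0 : Space d)
  -- The test function is supported in a ball of radius r, and r < e^r, so B = r is a valid bound
  -- for log |x| on the support.
  set B := r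
  have hrB : r < Real.exp B := by linarith [Real.add_one_le_exp r]
  have hψ0 : ∀ x, Real.exp B < ‖x‖ → ψ x = 0 := fun x hx => by
    refine image_eq_zero_of_notMem_tsupport fun h => ?_
    have := mem_closedBall_zero_iff.1 (hr h)
    linarith
  have hdψ0 : ∀ x, Real.exp B < ‖x‖ → fderiv ℝ ψ x e = 0 := fun x hx => by
    have : x ∉ tsupport (fderiv ℝ ψ) := fun h => by
      have := mem_closedBall_zero_iff.1 (hr (tsupport_fderiv_subset ℝ h))
      linarith
    rw [image_eq_zero_of_notMem_tsupport this]; rfl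
  set χ₁ : Space d → ℂ := fun x => ((fderiv ℝ ψ x e : ℝ) : ℂ)
  set χ₂ : Space d → ℂ := fun x => ((x j / ‖x‖ : ℝ) : ℂ) * (ψ x : ℂ)
  have hχ₁ : AEStronglyMeasurable χ₁ volume :=
    (Complex.continuous_ofReal.comp hdc).aestronglyMeasurable
  have hχ₂ : AEStronglyMeasurable χ₂ volume := by
    refine AEStronglyMeasurable.mul ?_
      (Complex.continuous_ofReal.comp hψ.continuous).aestronglyMeasurable
    refine (Measurable.aestronglyMeasurable ?_)
    exact Complex.measurable_ofReal.comp
      (((by fun_prop : Continuous fun x : Space d => x j).measurable).div measurable_norm)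
  have hχ₁M : ∀ x, ‖χ₁ x‖ ≤ M := fun x => by
    simp only [χ₁, Complex.norm_real]; exact (hM₂ x).trans (le_max_right _ _)
  have hχ₂M : ∀ x, ‖χ₂ x‖ ≤ M := fun x => by
    simp only [χ₂, norm_mul, Complex.norm_real, Real.norm_eq_abs (x j / ‖x‖)]
    calc _ ≤ 1 * M₁ := mul_le_mul (abs_apply_div_norm_le x j) (hM₁ x) (norm_nonneg _) zero_le_one
      _ ≤ M := by rw [one_mul]; exact le_max_left _ _
  have hχ₁0 : ∀ x, Real.exp B < ‖x‖ → χ₁ x = 0 := fun x hx => by simp [χ₁, hdψ0 x hx]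
  have hχ₂0 : ∀ x, Real.exp B < ‖x‖ → χ₂ x = 0 := fun x hx => by simp [χ₂, hψ0 x hx]
  have hgχ : ∀ (p : ℝ → ℂ) x, radialField p x j * (ψ x : ℂ) = p (logNorm x) * χ₂ x :=
    fun p x => by rw [radialField_apply, mul_assoc]
  simp only [hgχ]
  have hd : (1 : ℝ) ≤ d := by exact_mod_cast Nat.pos_of_ne_zero (NeZero.ne d)
  have hκ := sphereArea_pos (d := d)
  have hexp : ∀ a b : ℝ, (Real.exp a : ℂ) * (Real.exp b : ℂ) = (Real.exp (a + b) : ℂ) :=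
    fun a b => by rw [← Complex.ofReal_mul, ← Real.exp_add]
  have hnexp : ∀ a : ℝ, ‖(Real.exp a : ℂ)‖ = Real.exp a := fun a => by
    rw [Complex.norm_real, Real.norm_of_nonneg (Real.exp_pos _).le]
  set P : ℝ → ℂ := (Iic B).indicator fun z => (Real.exp (d * z) : ℂ) * p z
  have hP : Integrable P := (integrable_indicator_iff measurableSet_Iic).2 (hp B)
  suffices h : ∀ ε > 0, ‖(∫ x, F (logNorm x) * χ₁ x) + ∫ x, p (logNorm x) * χ₂ x‖ ≤
      (M * (sphereArea d * Real.exp B) + M * sphereArea d) * ε by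
    rw [← add_eq_zero_iff_eq_neg, ← norm_le_zero_iff]
    refine ge_of_tendsto (x := 𝓝[>] (0 : ℝ)) ?_ (eventually_nhdsWithin_of_forall h)
    have : Tendsto (fun ε : ℝ => (M * (sphereArea d * Real.exp B) + M * sphereArea d) * ε) (𝓝 0)
      (𝓝 ((M * (sphereArea d * Real.exp B) + M * sphereArea d) * 0)) :=
      tendsto_id.const_mul _
    rw [mul_zero] at this
    exact this.mono_left nhdsWithin_le_nhds
  intro ε hε
  -- Approximating in the weighted L¹ norm replaces p by a function vanishing near y = -∞, for which
  -- the previous integration by parts across the origin is classical.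
  obtain ⟨Q, hQs, hQε, hQc, hQi⟩ := hP.exists_hasCompactSupport_integral_sub_le hε
  set P' : ℝ → ℂ := fun z => (Real.exp (-(d * z)) : ℂ) * Q z
  set G : ℝ → ℂ := fun y => F B + ∫ z in B..y, (Real.exp z : ℂ) * P' z
  have hGc : Continuous fun z => (Real.exp z : ℂ) * P' z := by
    simp only [P']; fun_prop
  have hG : ∀ y, HasDerivAt G ((Real.exp y : ℂ) * P' y) y := fun y =>
    (intervalIntegral.integral_hasDerivAt_right (hGc.intervalIntegrable _ _)
      (hGc.stronglyMeasurableAtFilter _ _) hGc.continuousAt).const_add _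
  obtain ⟨a, ha⟩ : ∃ a, ∀ y ≤ a, Q y = 0 := by
    obtain ⟨a, ha⟩ := hQs.isCompact.bddBelow
    refine ⟨a - 1, fun y hy => image_eq_zero_of_notMem_tsupport fun h => ?_⟩
    linarith [ha h]
  obtain ⟨hGi, hGe⟩ := integral_comp_logNorm_mul_fderiv hG hGc (a := a)
    (fun y hy => by simp [P', ha y hy]) hψ hψc j
  have hGe' : ∫ x, G (logNorm x) * χ₁ x = -∫ x, P' (logNorm x) * χ₂ x := by
    rw [hGe]
    congr 2
    ext x
    rw [radialField_apply, mul_assoc, ← mul_assoc (Real.exp (-logNorm x) : ℂ), hexp,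
      neg_add_cancel, Real.exp_zero, Complex.ofReal_one, one_mul]
  have hPQ : ∀ z ∈ Iic B, (Real.exp (d * z) : ℂ) * (p z - P' z) = P z - Q z := by
    intro z hz
    simp only [P, P', indicator_of_mem hz, mul_sub]
    rw [← mul_assoc, hexp, add_neg_cancel, Real.exp_zero, Complex.ofReal_one, one_mul]
  have hPQi : IntegrableOn (fun z => ‖P z - Q z‖) (Iic B) := (hP.sub hQi).norm.integrableOn
  have hPQε : ∫ z in Iic B, ‖P z - Q z‖ ≤ ε :=
    (setIntegral_le_integral (hP.sub hQi).norm (ae_of_all _ fun _ => norm_nonneg _)).trans hQε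
  have hD₂ : IntegrableOn (fun z => (Real.exp (d * z) : ℂ) * (p z - P' z)) (Iic B) :=
    (hP.sub hQi).integrableOn.congr_fun (fun z hz => (hPQ z hz).symm) measurableSet_Iic
  have hFG : ∀ y ∈ Iic B, ‖(Real.exp (d * y) : ℂ) * (F y - G y)‖ ≤ ε * Real.exp y := by
    intro y hy
    have h1 : F y - G y = -∫ z in y..B, (Real.exp z : ℂ) * (p z - P' z) := by
      have h2 := hF.sub_eq y B
      simp only [mul_sub]
      rw [intervalIntegral.integral_sub (hF.intervalIntegrable y B)
        (hGc.intervalIntegrable y B), ← h2]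
      simp only [G]
      rw [intervalIntegral.integral_symm y B]
      ring
    -- F and G agree at B. For z ≥ y and d ≥ 1, e^z ≤ e^((1-d)y) e^(dz), so the difference is
    -- controlled by the weighted L¹ error. After multiplication by e^(dy) only ε e^y remains, which
    -- is integrable near the origin.
    have h2 : ‖F y - G y‖ ≤ Real.exp ((1 - d) * y) * ε := by
      rw [h1, norm_neg]
      refine (intervalIntegral.norm_integral_le_integral_norm hy).trans ?_
      rw [intervalIntegral.integral_of_le hy]
      calc ∫ z in Ioc y B, ‖(Real.exp z : ℂ) * (p z - P' z)‖
          ≤ ∫ z in Ioc y B, Real.exp ((1 - d) * y) * ‖P z - Q z‖ := by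
            refine setIntegral_mono_on ?_ ((hPQi.mono_set Ioc_subset_Iic_self).const_mul _)
              measurableSet_Ioc fun z hz => ?_
            · simp only [mul_sub]
              exact ((hF.intervalIntegrable y B).sub (hGc.intervalIntegrable y B)).1.norm
            · rw [← hPQ z hz.2, norm_mul, norm_mul, hnexp, hnexp, ← mul_assoc, ← Real.exp_add]
              gcongr
              nlinarith [hz.1]
        _ = Real.exp ((1 - d) * y) * ∫ z in Ioc y B, ‖P z - Q z‖ := integral_const_mul _ _
        _ ≤ _ := by
            gcongr
            exact (setIntegral_mono_set hPQi (ae_of_all _ fun _ => norm_nonneg _)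
              Ioc_subset_Iic_self.eventuallyLE).trans hPQε
    rw [norm_mul, hnexp]
    calc _ ≤ Real.exp (d * y) * (Real.exp ((1 - d) * y) * ε) := by gcongr
      _ = _ := by rw [← mul_assoc, ← Real.exp_add, mul_comm]; congr 2; ring
  have hGcont : Continuous G := continuous_iff_continuousAt.2 fun y => (hG y).continuousAt
  have hei : IntegrableOn (fun y => ε * Real.exp y) (Iic B) := (integrableOn_exp_Iic B).const_mul ε
  have hD₁ : IntegrableOn (fun y => (Real.exp (d * y) : ℂ) * (F y - G y)) (Iic B) := by
    refine hei.mono' ?_ ((ae_restrict_iff' measurableSet_Iic).2 (ae_of_all _ hFG))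
    have : Continuous fun y => (Real.exp (d * y) : ℂ) * (F y - G y) := by
      have := hF.continuous
      fun_prop
    exact this.aestronglyMeasurable
  obtain ⟨hi₁, hb₁⟩ := integral_comp_logNorm_mul_le hD₁ hχ₁ hχ₁M hχ₁0
  obtain ⟨hi₂, hb₂⟩ := integral_comp_logNorm_mul_le hD₂ hχ₂ hχ₂M hχ₂0
  have hP'i : Integrable fun x => P' (logNorm x) * χ₂ x := by
    refine (integral_comp_logNorm_mul_le (D := P') (B := B) ?_ hχ₂ hχ₂M hχ₂0).1
    refine hQi.integrableOn.congr_fun (fun z hz => ?_) measurableSet_Iic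
    simp only [P']
    rw [← mul_assoc, hexp, add_neg_cancel, Real.exp_zero, Complex.ofReal_one, one_mul]
  have e₁ : ∫ x, F (logNorm x) * χ₁ x =
      (∫ x, (F (logNorm x) - G (logNorm x)) * χ₁ x) + ∫ x, G (logNorm x) * χ₁ x := by
    rw [← integral_add hi₁ hGi]; congr 1; ext x; ring
  have e₂ : ∫ x, p (logNorm x) * χ₂ x =
      (∫ x, (p (logNorm x) - P' (logNorm x)) * χ₂ x) + ∫ x, P' (logNorm x) * χ₂ x := by
    rw [← integral_add hi₂ hP'i]; congr 1; ext x; ring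
  rw [e₁, e₂, hGe']
  have b₁ : ∫ y in Iic B, ‖(Real.exp (d * y) : ℂ) * (F y - G y)‖ ≤ ε * Real.exp B := by
    refine (setIntegral_mono_on hD₁.norm hei measurableSet_Iic hFG).trans ?_
    rw [integral_const_mul, integral_exp_Iic]
  have b₂ : ∫ y in Iic B, ‖(Real.exp (d * y) : ℂ) * (p y - P' y)‖ ≤ ε := by
    refine le_trans (le_of_eq ?_) hPQε
    exact setIntegral_congr_fun measurableSet_Iic fun z hz => by simp only [hPQ z hz]
  calc _ = ‖(∫ x, (F (logNorm x) - G (logNorm x)) * χ₁ x) +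
          ∫ x, (p (logNorm x) - P' (logNorm x)) * χ₂ x‖ := by congr 1; ring
    _ ≤ M * (sphereArea d * (ε * Real.exp B)) + M * (sphereArea d * ε) := by
        refine (norm_add_le _ _).trans (add_le_add (hb₁.trans ?_) (hb₂.trans ?_)) <;> gcongr
    _ = _ := by ring

end

/-! ### Absolute continuity of radial functions in H¹ -/

theorem integrable_mul_of_memLp {X : Type*} {_ : MeasurableSpace X} {μ : Measure X} {f g : X → ℂ}
    (hf : MemLp f 2 μ) (hg : MemLp g 2 μ) : Integrable (fun x => f x * g x) μ :=
  hf.integrable_mul hg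

/-- A locally integrable function whose distributional derivative vanishes is constant. -/
theorem exists_ae_eq_const_of_integral_mul_deriv {D : ℝ → ℂ} (hD : LocallyIntegrable D)
    (h : ∀ η : ℝ → ℝ, ContDiff ℝ ∞ η → HasCompactSupport η → ∫ y, D y * ((deriv η y : ℝ) : ℂ) = 0) :
    ∃ c : ℂ, ∀ᵐ y, D y = c := by
  have hint : ∀ ζ : ℝ → ℝ, Continuous ζ → HasCompactSupport ζ →
      Integrable fun y => D y * (ζ y : ℂ) := fun ζ hζ hζc => by
    have := hD.integrable_smul_left_of_hasCompactSupport hζ hζc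
    refine this.congr (ae_of_all _ fun y => ?_)
    simp [mul_comm]
  set bump : ContDiffBump (0 : ℝ) := default
  set η₀ : ℝ → ℝ := bump.normed volume with hη₀
  have hη₀d : ContDiff ℝ ∞ η₀ := bump.contDiff_normed
  have hη₀c : HasCompactSupport η₀ := bump.hasCompactSupport_normed
  have hη₀i : ∫ y, η₀ y = 1 := bump.integral_normed
  set c : ℂ := ∫ y, D y * (η₀ y : ℂ) with hc
  refine ⟨c, ?_⟩
  have key : ∀ ζ : ℝ → ℝ, ContDiff ℝ ∞ ζ → HasCompactSupport ζ → ∫ y, ζ y • (D y - c) = 0 := by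
    intro ζ hζ hζc
    set a := ∫ y, ζ y
    -- Subtracting the multiple of a fixed bump that makes the integral zero turns ζ into the
    -- derivative of a test function.
    set g : ℝ → ℝ := fun y => ζ y - a * η₀ y
    have hgd : ContDiff ℝ ∞ g := hζ.sub (contDiff_const.mul hη₀d)
    have hgc : HasCompactSupport g := hζc.sub hη₀c.mul_left
    have hζi : Integrable ζ := hζ.continuous.integrable_of_hasCompactSupport hζc
    have hη₀I : Integrable η₀ := hη₀d.continuous.integrable_of_hasCompactSupport hη₀c
    have hgi : ∫ y, g y = 0 := by
      rw [integral_sub hζi (hη₀I.const_mul a), integral_const_mul, hη₀i, mul_one, sub_self]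
    obtain ⟨r, hr⟩ := hgc.isCompact.isBounded.subset_closedBall (0 : ℝ)
    have hg0 : ∀ y, r < |y| → g y = 0 := fun y hy =>
      image_eq_zero_of_notMem_tsupport fun hy' => by
        have := mem_closedBall_zero_iff.1 (hr hy')
        rw [Real.norm_eq_abs] at this; linarith
    set b := |r| + 1
    have hrb : r < b := by linarith [le_abs_self r]
    have hb0 : 0 < b := by positivity
    set η : ℝ → ℝ := fun y => ∫ z in (-b)..y, g z
    have hηd : ∀ y, HasDerivAt η (g y) y := fun y =>
      intervalIntegral.integral_hasDerivAt_right (hgd.continuous.intervalIntegrable _ _)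
        (hgd.continuous.stronglyMeasurableAtFilter _ _) hgd.continuous.continuousAt
    have hηs : ContDiff ℝ ∞ η := by
      rw [contDiff_infty_iff_deriv]
      exact ⟨fun y => (hηd y).differentiableAt, by rwa [funext fun y => (hηd y).deriv]⟩
    have hηc : HasCompactSupport η := by
      refine HasCompactSupport.of_support_subset_isCompact (isCompact_Icc (a := -b) (b := b)) ?_
      intro y hy
      by_contra hcon
      refine hy ?_
      rw [mem_Icc, not_and_or, not_le, not_le] at hcon
      rcases hcon with hcon | hcon
      · refine (intervalIntegral.integral_congr (g := fun _ => (0 : ℝ)) fun z hz => ?_).trans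
          (by simp)
        rw [uIcc_of_ge hcon.le] at hz
        exact hg0 z (lt_of_lt_of_le hrb (by rw [le_abs]; right; linarith [hz.2]))
      · rw [← hgi]
        refine intervalIntegral.integral_eq_integral_of_support_subset fun z hz => ?_
        by_contra hz'
        refine hz (hg0 z (lt_of_lt_of_le hrb ?_))
        rw [mem_Ioc, not_and_or, not_lt, not_le] at hz'
        rw [le_abs]
        rcases hz' with hz' | hz'
        · right; linarith
        · left; linarith
    have h1 := h η hηs hηc
    simp only [(hηd _).deriv] at h1
    have h2 : ∫ y, D y * (g y : ℂ) = (∫ y, D y * (ζ y : ℂ)) - a * c := by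
      rw [hc, ← integral_const_mul, ← integral_sub (hint ζ hζ.continuous hζc)
        ((hint η₀ hη₀d.continuous hη₀c).const_mul _)]
      congr 1; ext y; simp only [g]; push_cast; ring
    have h3 : ∫ y, ζ y • (D y - c) = (∫ y, D y * (ζ y : ℂ)) - a * c := by
      have h4 : (∫ y, (ζ y : ℂ) * c) = a * c := by
        rw [integral_mul_const, integral_complex_ofReal]
      have hζi' : Integrable fun y => (ζ y : ℂ) * c := hζi.ofReal.mul_const c
      rw [← h4, ← integral_sub (hint ζ hζ.continuous hζc) hζi']
      congr 1; ext y; rw [Complex.real_smul]; ring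
    rw [h3, ← h2, h1]
  have := ae_eq_zero_of_integral_contDiff_smul_eq_zero
    (hD.sub (continuous_const.locallyIntegrable (μ := volume) (f := fun _ : ℝ => c))) key
  exact this.mono fun y hy => sub_eq_zero.1 hy

section

variable {d : ℕ}

theorem memLp_apply {g : Space d → EuclideanSpace ℂ (Fin d)} (hg : MemLp g 2 volume) (j : Fin d) :
    MemLp (fun x => g x j) 2 volume :=
  (EuclideanSpace.proj j : EuclideanSpace ℂ (Fin d) →L[ℂ] ℂ).comp_memLp' hg

theorem memLp_ofReal_of_hasCompactSupport {ψ : Space d → ℝ} (hψ : Continuous ψ)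
    (hψc : HasCompactSupport ψ) : MemLp (fun x => (ψ x : ℂ)) 2 volume :=
  (hψ.memLp_of_hasCompactSupport hψc).ofReal

theorem memLp_fderiv_apply {ψ : Space d → ℝ} (hψ : ContDiff ℝ ∞ ψ) (hψc : HasCompactSupport ψ)
    (e : Space d) : MemLp (fun x => ((fderiv ℝ ψ x e : ℝ) : ℂ)) 2 volume :=
  memLp_ofReal_of_hasCompactSupport
    ((hψ.continuous_fderiv (by simp)).clm_apply continuous_const) (hψc.fderiv_apply ℝ e)

/-- Distributional gradients in `L²` are unique. -/
theorem IsWeakGradient.ae_eq {f f' : Space d → ℂ} {g g' : Space d → EuclideanSpace ℂ (Fin d)}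
    (h : IsWeakGradient f g) (h' : IsWeakGradient f' g') (hff' : f =ᵐ[volume] f')
    (hg : MemLp g 2 volume) (hg' : MemLp g' 2 volume) : g =ᵐ[volume] g' := by
  have key : ∀ j : Fin d, ∀ᵐ x, g x j - g' x j = 0 := by
    intro j
    refine ae_eq_zero_of_integral_contDiff_smul_eq_zero
      (((memLp_apply hg j).sub (memLp_apply hg' j)).locallyIntegrable (by norm_num)) ?_
    intro ψ hψ hψc
    have hψ2 := memLp_ofReal_of_hasCompactSupport hψ.continuous hψc
    have h1 := h ψ hψ hψc j
    have h2 := h' ψ hψ hψc j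
    have h3 : ∫ x, f x * ((fderiv ℝ ψ x (EuclideanSpace.single j 1) : ℝ) : ℂ) =
        ∫ x, f' x * ((fderiv ℝ ψ x (EuclideanSpace.single j 1) : ℝ) : ℂ) :=
      integral_congr_ae (hff'.mono fun x hx => by simp only [hx])
    rw [h1, h2, neg_inj] at h3
    calc ∫ x, ψ x • (g x j - g' x j)
        = ∫ x, (g x j * (ψ x : ℂ) - g' x j * (ψ x : ℂ)) := by
          congr 1; ext x; rw [Complex.real_smul]; ring
      _ = 0 := by
          rw [integral_sub (integrable_mul_of_memLp (memLp_apply hg j) hψ2)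
            (integrable_mul_of_memLp (memLp_apply hg' j) hψ2), h3, sub_self]
  filter_upwards [ae_all_iff.2 key] with x hx
  ext j
  exact sub_eq_zero.1 (hx j)

theorem IsWeakGradient.sub {f f' : Space d → ℂ} {g g' : Space d → EuclideanSpace ℂ (Fin d)}
    (h : IsWeakGradient f g) (h' : IsWeakGradient f' g') (hf : MemLp f 2 volume)
    (hf' : MemLp f' 2 volume) (hg : MemLp g 2 volume) (hg' : MemLp g' 2 volume) :
    IsWeakGradient (f - f') (g - g') := by
  intro ψ hψ hψc j
  have hψ2 := memLp_ofReal_of_hasCompactSupport hψ.continuous hψc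
  have hdψ := memLp_fderiv_apply hψ hψc (EuclideanSpace.single j 1)
  simp only [Pi.sub_apply, PiLp.sub_apply, sub_mul]
  rw [integral_sub (integrable_mul_of_memLp hf hdψ) (integrable_mul_of_memLp hf' hdψ), h ψ hψ hψc j,
    h' ψ hψ hψc j, integral_sub (integrable_mul_of_memLp (memLp_apply hg j) hψ2)
      (integrable_mul_of_memLp (memLp_apply hg' j) hψ2)]
  ring

/-- The orthogonal projection onto radial functions in `L²`. -/
theorem exists_radial_projection {G : Space d → ℂ} (hG : MemLp G 2 volume) :
    ∃ p : ℝ → ℂ, AEStronglyMeasurable p volume ∧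
      MemLp (fun x : Space d => p (logNorm x)) 2 volume ∧
      ∀ Ψ : ℝ → ℂ, Continuous Ψ → MemLp (fun x : Space d => Ψ (logNorm x)) 2 volume →
        ∫ x, G x * Ψ (logNorm x) = ∫ x : Space d, p (logNorm x) * Ψ (logNorm x) := by
  set ν : Measure ℝ := (volume : Measure (Space d)).map logNorm
  have hmp : MeasurePreserving (logNorm : Space d → ℝ) volume ν := ⟨measurable_logNorm, rfl⟩
  set T : Lp ℂ 2 ν →L[ℂ] Lp ℂ 2 (volume : Measure (Space d)) :=
    (Lp.compMeasurePreservingₗᵢ ℂ logNorm hmp).toContinuousLinearMap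
  -- Composition with `logNorm` is an isometry from L² of the image measure; its adjoint recovers
  -- the radial part of G.
  set p : Lp ℂ 2 ν := ContinuousLinearMap.adjoint T (hG.toLp G)
  refine ⟨p, (Lp.stronglyMeasurable p).aestronglyMeasurable,
    (Lp.memLp p).comp_measurePreserving hmp, fun Ψ hΨ hΨ2 => ?_⟩
  have hΨν : MemLp (fun y => conj (Ψ y)) 2 ν :=
    (memLp_map_measure_iff (Complex.continuous_conj.comp hΨ).aestronglyMeasurable
      measurable_logNorm.aemeasurable).2 hΨ2.star
  have h1 := ContinuousLinearMap.adjoint_inner_right T (hΨν.toLp _) (hG.toLp G)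
  rw [L2.inner_def, L2.inner_def] at h1
  have e1 : ∫ y, inner ℂ ((hΨν.toLp _ : Lp ℂ 2 ν) y) (p y) ∂ν =
      ∫ x : Space d, p (logNorm x) * Ψ (logNorm x) := by
    rw [integral_congr_ae (g := fun y => p y * Ψ y) ?_]
    · exact integral_map (f := fun y => p y * Ψ y) measurable_logNorm.aemeasurable
        ((Lp.stronglyMeasurable p).aestronglyMeasurable.mul hΨ.aestronglyMeasurable)
    filter_upwards [hΨν.coeFn_toLp] with y hy
    rw [hy]; simp [mul_comm]
  have e2 : ∫ x, inner ℂ (T (hΨν.toLp _) x) ((hG.toLp G : Lp ℂ 2 volume) x) =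
      ∫ x, G x * Ψ (logNorm x) := by
    refine integral_congr_ae ?_
    have h2 : (T (hΨν.toLp _) : Space d → ℂ) =ᵐ[volume] (hΨν.toLp _ : Lp ℂ 2 ν) ∘ logNorm :=
      Lp.coeFn_compMeasurePreserving _ hmp
    have h3 := hmp.quasiMeasurePreserving.ae hΨν.coeFn_toLp
    filter_upwards [h2, h3, hG.coeFn_toLp] with x hx1 hx2 hx3
    rw [hx1, hx3, Function.comp, hx2]; simp
  rw [← e2, ← h1, e1]

section radialTest

variable {ζ : ℝ → ℝ} (hζ : ContDiff ℝ ∞ ζ) (hζc : HasCompactSupport ζ)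

include hζ hζc

theorem contDiff_radialTest (j : Fin d) : ContDiff ℝ ∞ fun x : Space d => ζ (logNorm x) * x j := by
  rw [contDiff_iff_contDiffAt]
  intro x
  by_cases hx : x = 0
  · obtain ⟨a, ha⟩ := hζc.isCompact.bddBelow
    refine (contDiffAt_const (c := (0 : ℝ))).congr_of_eventuallyEq ?_
    subst hx
    filter_upwards [Metric.ball_mem_nhds (0 : Space d) (Real.exp_pos (a - 1))] with y hy
    by_cases hy0 : y = 0
    · simp [hy0]
    · have h1 := (logNorm_le_iff (norm_pos_iff.2 hy0)).2 (mem_ball_zero_iff.1 hy).le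
      have h2 : ζ (logNorm y) = 0 := image_eq_zero_of_notMem_tsupport fun h => by linarith [ha h]
      simp only [h2, zero_mul]
  · exact (hζ.contDiffAt.comp x (contDiffAt_logNorm hx)).mul
      (by fun_prop : ContDiff ℝ ∞ fun x : Space d => x j).contDiffAt

omit hζ in
theorem hasCompactSupport_radialTest (j : Fin d) :
    HasCompactSupport fun x : Space d => ζ (logNorm x) * x j := by
  obtain ⟨b, hb⟩ := hζc.isCompact.bddAbove
  refine HasCompactSupport.of_support_subset_isCompact
    (isCompact_closedBall (0 : Space d) (Real.exp b)) fun x hx => ?_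
  have hx0 : x ≠ 0 := fun h => hx (by simp [h])
  have h1 : ζ (logNorm x) ≠ 0 := fun h => hx (by simp [h])
  rw [mem_closedBall_zero_iff, ← logNorm_le_iff (norm_pos_iff.2 hx0)]
  exact hb (subset_tsupport _ h1)

omit hζc in
-- The divergence of the radial test field ζ(log |x|) x, which extracts the radial derivative from
-- the distributional gradient.
theorem sum_fderiv_radialTest {x : Space d} (hx : x ≠ 0) :
    ∑ j : Fin d, fderiv ℝ (fun x : Space d => ζ (logNorm x) * x j) x (EuclideanSpace.single j 1) =
      deriv ζ (logNorm x) + d * ζ (logNorm x) := by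
  have h0 : ‖x‖ ^ 2 ≠ 0 := by simpa using hx
  have h1 : ∀ j : Fin d, fderiv ℝ (fun x : Space d => ζ (logNorm x) * x j) x
      (EuclideanSpace.single j 1) =
      ζ (logNorm x) + deriv ζ (logNorm x) * ((‖x‖ ^ 2)⁻¹ * x j ^ 2) := by
    intro j
    have h2 : HasFDerivAt (fun x : Space d => x j) (EuclideanSpace.proj j : Space d →L[ℝ] ℝ) x :=
      (EuclideanSpace.proj j : Space d →L[ℝ] ℝ).hasFDerivAt
    have h3 : HasFDerivAt (fun x : Space d => ζ (logNorm x) * x j) _ x :=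
      (((hζ.differentiable (by simp)) (logNorm x)).hasDerivAt.comp_hasFDerivAt x
        (hasFDerivAt_logNorm hx)).mul h2
    rw [h3.fderiv]
    simp [EuclideanSpace.inner_single_right]
    ring
  simp only [h1]
  rw [Finset.sum_add_distrib, ← Finset.mul_sum, ← Finset.mul_sum, ← EuclideanSpace.real_norm_sq_eq,
    inv_mul_cancel₀ h0]
  simp
  ring

end radialTest

variable [NeZero d]

theorem memLp_comp_logNorm_of_hasCompactSupport {Ψ : ℝ → ℂ} (hΨ : Continuous Ψ)
    (hΨc : HasCompactSupport Ψ) : MemLp (fun x : Space d => Ψ (logNorm x)) 2 volume := by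
  rw [memLp_comp_logNorm_iff hΨ.aestronglyMeasurable]
  have : Continuous fun y => Real.exp (d * y) * ‖Ψ y‖ ^ 2 := by fun_prop
  refine this.integrable_of_hasCompactSupport (HasCompactSupport.mul_left ?_)
  exact hΨc.comp_left (g := fun z : ℂ => ‖z‖ ^ 2) (by simp)

/-- The weak form of the radial derivative. -/
theorem exists_radial_weakDeriv {f : Space d → ℂ} (hf : MemH1 f) {F : ℝ → ℂ}
    (hF : ∀ᵐ x : Space d, f x = F (logNorm x)) :
    ∃ p : ℝ → ℂ, AEStronglyMeasurable p volume ∧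
      MemLp (fun x : Space d => p (logNorm x)) 2 volume ∧
      ∀ η : ℝ → ℝ, ContDiff ℝ ∞ η → HasCompactSupport η →
        ∫ y, F y * ((deriv η y : ℝ) : ℂ) = -∫ y, (Real.exp y : ℂ) * p y * (η y : ℂ) := by
  obtain ⟨hf2, g, hg, hfg⟩ := hf
  -- The radial component of the gradient is not known to be a radial function, so it is projected
  -- onto functions of |x|.
  set G : Space d → ℂ := fun x => ∑ j : Fin d, g x j * ((x j / ‖x‖ : ℝ) : ℂ) with hGdef
  have hG : MemLp G 2 volume := by
    refine memLp_finsetSum _ fun j _ => ?_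
    refine (memLp_apply hg j).of_le_mul (c := 1) ?_ (ae_of_all _ fun x => ?_)
    · refine (memLp_apply hg j).1.mul (Measurable.aestronglyMeasurable ?_)
      exact Complex.measurable_ofReal.comp
        (((by fun_prop : Continuous fun x : Space d => x j).measurable).div measurable_norm)
    · rw [norm_mul, Complex.norm_real, one_mul]
      exact mul_le_of_le_one_right (norm_nonneg _) (abs_apply_div_norm_le x j)
  obtain ⟨p, hpm, hp2, hp⟩ := exists_radial_projection hG
  refine ⟨p, hpm, hp2, fun η hη hηc => ?_⟩
  -- With this factor the divergence of the test field is e^(-dy) η', and the exponential cancels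
  -- the volume density.
  set ζ : ℝ → ℝ := fun y => Real.exp (-(d * y)) * η y with hζdef
  have hζ : ContDiff ℝ ∞ ζ := (by fun_prop : ContDiff ℝ ∞ fun y : ℝ => Real.exp (-(d * y))).mul hη
  have hζc : HasCompactSupport ζ := hηc.mul_left
  have hζd : ∀ y, deriv ζ y + d * ζ y = Real.exp (-(d * y)) * deriv η y := fun y => by
    have h1 : HasDerivAt (fun y : ℝ => Real.exp (-(d * y))) (Real.exp (-(d * y)) * -(d * 1)) y :=
      (((hasDerivAt_id y).const_mul (d : ℝ)).neg).exp
    have h2 : HasDerivAt ζ _ y := h1.mul ((hη.differentiable (by simp)) y).hasDerivAt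
    rw [h2.deriv, hζdef]
    ring
  have hexp : ∀ y : ℝ, (Real.exp (d * y) : ℂ) * (Real.exp (-(d * y)) : ℂ) = 1 := fun y => by
    rw [← Complex.ofReal_mul, ← Real.exp_add, add_neg_cancel, Real.exp_zero, Complex.ofReal_one]
  set ψ : Fin d → Space d → ℝ := fun j x => ζ (logNorm x) * x j
  have hψ : ∀ j, ContDiff ℝ ∞ (ψ j) := contDiff_radialTest hζ hζc
  have hψc : ∀ j, HasCompactSupport (ψ j) := hasCompactSupport_radialTest hζc
  have hsum := Finset.sum_congr (rfl : (Finset.univ : Finset (Fin d)) = Finset.univ)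
    fun j _ => hfg (ψ j) (hψ j) (hψc j) j
  rw [Finset.sum_neg_distrib, ← integral_finsetSum _ fun j _ =>
      integrable_mul_of_memLp hf2 (memLp_fderiv_apply (hψ j) (hψc j) _),
    ← integral_finsetSum _ fun j _ => integrable_mul_of_memLp (memLp_apply hg j)
      (memLp_ofReal_of_hasCompactSupport (hψ j).continuous (hψc j))] at hsum
  have hL : ∫ x, ∑ j : Fin d, f x *
      ((fderiv ℝ (ψ j) x (EuclideanSpace.single j 1) : ℝ) : ℂ) =
      sphereArea d • ∫ y, F y * ((deriv η y : ℝ) : ℂ) := by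
    have h1 : ∀ᵐ x : Space d, ∑ j : Fin d, f x *
        ((fderiv ℝ (ψ j) x (EuclideanSpace.single j 1) : ℝ) : ℂ) =
        F (logNorm x) * ((deriv ζ (logNorm x) + d * ζ (logNorm x) : ℝ) : ℂ) := by
      filter_upwards [hF, ae_pos_norm (d := d)] with x hx hx0
      rw [← Finset.mul_sum, ← Complex.ofReal_sum, sum_fderiv_radialTest hζ (norm_pos_iff.1 hx0), hx]
    rw [integral_congr_ae h1, integral_comp_logNorm (d := d)
      (fun y => F y * ((deriv ζ y + d * ζ y : ℝ) : ℂ))]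
    congr 2
    ext y
    rw [hζd, Complex.real_smul, Complex.ofReal_mul, mul_left_comm, ← mul_assoc (Real.exp _ : ℂ),
      hexp, one_mul]
  set Ψ : ℝ → ℂ := fun y => (Real.exp y : ℂ) * (ζ y : ℂ)
  have hΨ : Continuous Ψ := by
    have := hζ.continuous
    fun_prop
  have hΨc : HasCompactSupport Ψ :=
    (hζc.comp_left (g := fun r : ℝ => (r : ℂ)) (by simp)).mul_left
  have hR : ∫ x, ∑ j : Fin d, g x j * (ψ j x : ℂ) =
      sphereArea d • ∫ y, (Real.exp y : ℂ) * p y * (η y : ℂ) := by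
    have h1 : ∀ᵐ x : Space d, ∑ j : Fin d, g x j * (ψ j x : ℂ) = G x * Ψ (logNorm x) := by
      filter_upwards [ae_pos_norm (d := d)] with x hx0
      have h2 : Real.exp (logNorm x) = ‖x‖ := Real.exp_log hx0
      have h3 : (‖x‖ : ℂ) ≠ 0 := by exact_mod_cast hx0.ne'
      simp only [hGdef, Finset.sum_mul, Ψ, ψ, h2]
      refine Finset.sum_congr rfl fun j _ => ?_
      push_cast
      field_simp
    rw [integral_congr_ae h1, hp Ψ hΨ (memLp_comp_logNorm_of_hasCompactSupport hΨ hΨc),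
      integral_comp_logNorm (d := d) (fun y => p y * Ψ y)]
    congr 2
    ext y
    simp only [Ψ, ζ, Complex.real_smul]
    push_cast
    have := hexp y
    push_cast at this
    linear_combination (p y * Complex.exp y * η y) * this
  rw [hL, hR, ← smul_neg] at hsum
  exact smul_right_injective ℂ sphereArea_pos.ne' hsum

/-- A radial function in `H¹` is, as a function of `log |x|`, absolutely continuous. -/
theorem exists_isPrimitive_of_isRadial {f : Space d → ℂ} (hf : MemH1 f) (hr : IsRadial f) :
    ∃ F p : ℝ → ℂ, IsPrimitive F (fun y => (Real.exp y : ℂ) * p y) ∧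
      (∀ᵐ x : Space d, f x = F (logNorm x)) ∧
      AEStronglyMeasurable p volume ∧
      MemLp (fun x : Space d => p (logNorm x)) 2 volume := by
  obtain ⟨h, hh⟩ := hr
  set F₀ : ℝ → ℂ := fun y => h (Real.exp y)
  have hF₀ : ∀ᵐ x : Space d, f x = F₀ (logNorm x) := by
    filter_upwards [hh, ae_pos_norm (d := d)] with x hx hx0
    rw [hx]; simp only [F₀, logNorm, Real.exp_log hx0]
  obtain ⟨p, hpm, hp2, hp⟩ := exists_radial_weakDeriv hf hF₀
  have hF₀2 : MemLp (fun x : Space d => F₀ (logNorm x)) 2 volume := hf.1.ae_eq hF₀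
  have hF₀m : AEStronglyMeasurable F₀ volume :=
    aestronglyMeasurable_of_comp_logNorm (d := d) fun r =>
      ((hF₀2.locallyIntegrable (by norm_num)).integrableOn_isCompact
        (isCompact_closedBall 0 r)).mono_set Metric.ball_subset_closedBall
  have hloc : ∀ {P : ℝ → ℂ}, AEStronglyMeasurable P volume →
      MemLp (fun x : Space d => P (logNorm x)) 2 volume → LocallyIntegrable P := by
    intro P hPm hP
    rw [memLp_comp_logNorm_iff hPm] at hP
    have hP2 : MemLp (fun y => (Real.exp (d * y / 2) : ℂ) * P y) 2 volume := by
      have hm : AEStronglyMeasurable (fun y => (Real.exp (d * y / 2) : ℂ) * P y) volume :=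
        (by fun_prop : Continuous fun y : ℝ =>
          (Real.exp (d * y / 2) : ℂ)).aestronglyMeasurable.mul hPm
      rw [memLp_two_iff_integrable_sq_norm hm]
      refine hP.congr (ae_of_all _ fun y => ?_)
      simp only [norm_mul, Complex.norm_real, Real.norm_of_nonneg (Real.exp_pos _).le, mul_pow,
        ← Real.exp_nat_mul]
      congr 2; push_cast; ring
    have h1 := (hP2.locallyIntegrable (by norm_num)).locallyIntegrableOn univ
    have h2 := h1.continuousOn_mul (g := fun y : ℝ => (Real.exp (-(d * y / 2)) : ℂ))
      (by fun_prop) isOpen_univ.isLocallyClosed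
    rw [locallyIntegrableOn_univ] at h2
    refine h2.congr (ae_of_all _ fun y => ?_)
    simp only [← mul_assoc]
    rw [← Complex.ofReal_mul, ← Real.exp_add, neg_add_cancel, Real.exp_zero, Complex.ofReal_one,
      one_mul]
  have hpl : LocallyIntegrable fun y => (Real.exp y : ℂ) * p y := by
    rw [← locallyIntegrableOn_univ]
    exact ((hloc hpm hp2).locallyIntegrableOn univ).continuousOn_mul (by fun_prop)
      isOpen_univ.isLocallyClosed
  have hpi : ∀ x y, IntervalIntegrable (fun y => (Real.exp y : ℂ) * p y) volume x y := fun x y =>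
    (hpl.integrableOn_isCompact isCompact_uIcc).intervalIntegrable
  set F₁ : ℝ → ℂ := fun y => ∫ z in (0 : ℝ)..y, (Real.exp z : ℂ) * p z
  have hF₁ : IsPrimitive F₁ fun y => (Real.exp y : ℂ) * p y :=
    ⟨hpi, fun x y => intervalIntegral.integral_interval_sub_left (hpi 0 y) (hpi 0 x)⟩
  -- The given representative and the primitive F₁ have the same weak derivative, hence differ by a
  -- constant almost everywhere.
  obtain ⟨c, hc⟩ := exists_ae_eq_const_of_integral_mul_deriv (D := fun y => F₀ y - F₁ y)
    ((hloc hF₀m hF₀2).sub (hF₁.continuous.locallyIntegrable)) (by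
      intro η hη hηc
      have hdc : Continuous (deriv η) := hη.continuous_deriv (by simp)
      have hdc' : Continuous fun y => ((deriv η y : ℝ) : ℂ) := Complex.continuous_ofReal.comp hdc
      have hηs : HasCompactSupport fun y => (η y : ℂ) :=
        hηc.comp_left (g := fun r : ℝ => (r : ℂ)) (by simp)
      have hds : HasCompactSupport fun y => ((deriv η y : ℝ) : ℂ) :=
        hηc.deriv.comp_left (g := fun r : ℝ => (r : ℂ)) (by simp)
      have hηp : IsPrimitive (fun y => (η y : ℂ)) fun y => ((deriv η y : ℝ) : ℂ) :=
        .of_hasDerivAt (fun y => ((hη.differentiable (by simp)) y).hasDerivAt.ofReal_comp) hdc'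
      have hi : ∀ {P : ℝ → ℂ} {ξ : ℝ → ℝ}, LocallyIntegrable P → Continuous ξ →
          HasCompactSupport ξ → Integrable fun y => P y * (ξ y : ℂ) := fun {P ξ} hP hξ hξc =>
        (hP.integrable_smul_left_of_hasCompactSupport hξ hξc).congr
          (ae_of_all _ fun y => by simp [mul_comm])
      have hi₁ := hi hF₁.continuous.locallyIntegrable hdc hηc.deriv
      have hi₂ := hi hpl hη.continuous hηc
      have h1 := (hF₁.mul hηp).integral_eq_zero
        (hi hF₁.continuous.locallyIntegrable hη.continuous hηc) (hi₁.add hi₂)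
      rw [integral_add hi₁ hi₂] at h1
      simp only [sub_mul]
      rw [integral_sub (hi (hloc hF₀m hF₀2) hdc hηc.deriv) hi₁, hp η hη hηc]
      linear_combination -h1)
  refine ⟨fun y => F₁ y + c, p, ⟨hF₁.intervalIntegrable, fun x y => ?_⟩, ?_, hpm, hp2⟩
  · rw [← hF₁.sub_eq]; ring
  · filter_upwards [hF₀, (ae_comp_logNorm_iff (d := d)).2 hc] with x hx1 hx2
    rw [hx1, ← hx2]; ring

end

/-! ### The dictionary between radial functions and profiles -/

/-- The exponent `(d - 2) / 2` of Hardy's inequality. -/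
def hardyExp (d : ℕ) : ℝ := ((d : ℝ) - 2) / 2

/-- The function `|x|^{-(d-2)/2} v(log |x|)`. -/
def toSpace (d : ℕ) (v : ℝ → ℂ) (x : Space d) : ℂ :=
  (Real.exp (-(hardyExp d * logNorm x)) : ℂ) * v (logNorm x)

/-- The radial derivative of `toSpace d v`, in terms of `log |x|`. -/
def radialDeriv (d : ℕ) (v q : ℝ → ℂ) (y : ℝ) : ℂ :=
  (Real.exp (-((hardyExp d + 1) * y)) : ℂ) * (q y - hardyExp d * v y)

/-- `f` is the radial function with logarithmic profile `v`. -/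
structure HasProfile {d : ℕ} (f : Space d → ℂ) (v q : ℝ → ℂ) : Prop where
  isProfile : IsProfile v q
  ae_eq : ∀ᵐ x, f x = toSpace d v x

/-- Hardy's inequality, in qualitative form. -/
theorem memLp_two_of_sub_memLp {a : ℝ} (ha : 0 < a) {v q : ℝ → ℂ} (h : IsPrimitive v q)
    (hk : MemLp (fun y => q y - a * v y) 2 volume) (he : MemLp (expMul v) 2 volume) :
    MemLp v 2 volume := by
  have hvc := h.continuous
  rw [memLp_two_iff_integrable_sq_norm hvc.aestronglyMeasurable]
  have hki : Integrable fun y => ‖q y - a * v y‖ ^ 2 := (memLp_two_iff_integrable_sq_norm hk.1).1 hk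
  have hei : Integrable fun y => ‖expMul v y‖ ^ 2 := (memLp_two_iff_integrable_sq_norm he.1).1 he
  have hc2 : Continuous fun y => ‖v y‖ ^ 2 := by fun_prop
  have hneg : IntegrableOn (fun y => ‖v y‖ ^ 2) (Iic 0) := by
    refine integrableOn_Iic_of_intervalIntegral_norm_bounded
      (I := a⁻¹ * (‖v 0‖ ^ 2 + a⁻¹ * ∫ y, ‖q y - a * v y‖ ^ 2)) (l := atBot) (a := id) 0
      (fun A => hc2.integrableOn_Ioc) tendsto_id ?_
    filter_upwards [eventually_le_atBot (0 : ℝ)] with A hA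
    simp only [id, norm_pow, norm_norm]
    have h1 := h.norm_sq.sub_eq A 0
    have hi := h.norm_sq.intervalIntegrable A 0
    -- With k = q - a v, the derivative of |v|² is 2 Re(k v̄) + 2a |v|², which is at least a |v|² -
    -- |k|²/a by completing the square. Integrating up to 0 bounds ∫ |v|² over [A, 0] independently
    -- of A.
    have hle : ∫ y in A..0, (a * ‖v y‖ ^ 2 - a⁻¹ * ‖q y - a * v y‖ ^ 2) ≤
        ∫ y in A..0, 2 * (q y * conj (v y)).re := by
      refine intervalIntegral.integral_mono hA ?_ hi fun y => ?_
      · exact ((hc2.intervalIntegrable _ _).const_mul _).sub (hki.intervalIntegrable.const_mul _)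
      · set k := q y - a * v y with hkdef
        have e1 : q y * conj (v y) = k * conj (v y) + a * (v y * conj (v y)) := by
          rw [hkdef]; ring
        have e2 : (q y * conj (v y)).re = (k * conj (v y)).re + a * ‖v y‖ ^ 2 := by
          rw [e1, Complex.mul_conj, Complex.normSq_eq_norm_sq, Complex.add_re, ← Complex.ofReal_mul,
            Complex.ofReal_re]
        have e3 := Complex.abs_re_le_norm (k * conj (v y))
        rw [norm_mul, RCLike.norm_conj] at e3
        have e4 := neg_le_of_abs_le e3
        have e5 : 0 ≤ a⁻¹ * (‖k‖ - a * ‖v y‖) ^ 2 := by positivity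
        have e6 : a⁻¹ * (‖k‖ - a * ‖v y‖) ^ 2 =
            a⁻¹ * ‖k‖ ^ 2 - 2 * (‖k‖ * ‖v y‖) + a * ‖v y‖ ^ 2 := by field_simp; ring
        simp only [e2]
        linarith
    rw [intervalIntegral.integral_sub ((hc2.intervalIntegrable _ _).const_mul _)
      (hki.intervalIntegrable.const_mul _), intervalIntegral.integral_const_mul,
      intervalIntegral.integral_const_mul] at hle
    have h2 : ∫ y in A..0, ‖q y - a * v y‖ ^ 2 ≤ ∫ y, ‖q y - a * v y‖ ^ 2 := by
      rw [intervalIntegral.integral_of_le hA]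
      exact setIntegral_le_integral hki (ae_of_all _ fun _ => by positivity)
    have h3 : a⁻¹ * ∫ y in A..0, ‖q y - a * v y‖ ^ 2 ≤ a⁻¹ * ∫ y, ‖q y - a * v y‖ ^ 2 := by gcongr
    rw [inv_mul_eq_div, le_div_iff₀ ha]
    have := sq_nonneg ‖v A‖
    linarith
  -- On the positive side finiteness of the mass suffices, because there |v| ≤ e^y |v|.
  have hpos : IntegrableOn (fun y => ‖v y‖ ^ 2) (Ioi 0) := by
    refine hei.integrableOn.mono' hc2.aestronglyMeasurable
      ((ae_restrict_iff' measurableSet_Ioi).2 (ae_of_all _ fun y hy => ?_))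
    rw [norm_pow, norm_norm, norm_expMul]
    gcongr
    exact le_mul_of_one_le_left (norm_nonneg _) (Real.one_le_exp (le_of_lt hy))
  rw [← integrableOn_univ, ← Iic_union_Ioi (a := (0 : ℝ))]
  exact hneg.union hpos

section

variable {d : ℕ}

theorem exp_dim_mul_sq (y : ℝ) : Real.exp (d * y) *
    (Real.exp (-(hardyExp d * y)) * Real.exp (-(hardyExp d * y))) = Real.exp y * Real.exp y := by
  rw [← Real.exp_add, ← Real.exp_add, ← Real.exp_add, hardyExp]
  congr 1; ring

theorem exp_dim_mul_sq' (y : ℝ) : Real.exp (d * y) *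
    (Real.exp (-((hardyExp d + 1) * y)) * Real.exp (-((hardyExp d + 1) * y))) = 1 := by
  rw [← Real.exp_add, ← Real.exp_add, Real.exp_eq_one_iff, hardyExp]
  ring

theorem IsProfile.memLp_sub {v q : ℝ → ℂ} (h : IsProfile v q) (a : ℝ) :
    MemLp (fun y => q y - a * v y) 2 volume :=
  h.memLp_deriv.sub (h.memLp.const_mul _)

/-- The cross terms in the gradient pairing integrate to zero. -/
theorem IsProfile.pair_sub_sub {v q w p : ℝ → ℂ} (h : IsProfile v q) (h' : IsProfile w p) (a : ℝ) :
    pair (fun y => q y - a * v y) (fun y => p y - a * w y) =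
      pair q p + ((a ^ 2 : ℝ) : ℂ) * pair v w := by
  have hw := h'.memLp.const_mul (a : ℂ)
  have hv := h.memLp.const_mul (a : ℂ)
  -- The cross terms are -a times the integral of the derivative of v w̄. Their vanishing is Hardy's
  -- inequality with the sharp constant, as an identity.
  have h1 := (h.prim.mul h'.prim.conj_comp).integral_eq_zero (integrable_pair h.memLp h'.memLp)
    ((integrable_pair h.memLp h'.memLp_deriv).add (integrable_pair h.memLp_deriv h'.memLp))
  rw [integral_add (integrable_pair h.memLp h'.memLp_deriv)
    (integrable_pair h.memLp_deriv h'.memLp)] at h1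
  change pair v p + pair q w = 0 at h1
  rw [pair_sub_left h.memLp_deriv hv (h'.memLp_sub a), pair_sub_right h'.memLp_deriv hw
    h.memLp_deriv, pair_sub_right h'.memLp_deriv hw hv, pair_smul_right, pair_smul_left,
    pair_smul_left, pair_smul_right]
  push_cast
  linear_combination -(a : ℂ) * h1

theorem sum_radialField_mul_conj (p p' : ℝ → ℂ) {x : Space d} (hx : 0 < ‖x‖) :
    ∑ j : Fin d, radialField p x j * conj (radialField p' x j) =
      p (logNorm x) * conj (p' (logNorm x)) := by
  have h1 : ∑ j : Fin d, (x j / ‖x‖) * (x j / ‖x‖) = 1 := by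
    simp only [← pow_two, div_pow]
    rw [← Finset.sum_div, ← EuclideanSpace.real_norm_sq_eq, div_self (by positivity)]
  have h2 : ∑ j : Fin d, ((x j / ‖x‖ : ℝ) : ℂ) * ((x j / ‖x‖ : ℝ) : ℂ) = 1 := by
    exact_mod_cast h1
  rw [← mul_one (p (logNorm x) * _), ← h2, Finset.mul_sum]
  refine Finset.sum_congr rfl fun j _ => ?_
  rw [radialField_apply, radialField_apply, map_mul, Complex.conj_ofReal]
  ring

theorem norm_radialField_sq (p : ℝ → ℂ) {x : Space d} (hx : 0 < ‖x‖) :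
    ‖radialField p x‖ ^ 2 = ‖p (logNorm x)‖ ^ 2 := by
  have h1 := sum_radialField_mul_conj p p hx
  simp only [Complex.mul_conj, Complex.normSq_eq_norm_sq] at h1
  rw [EuclideanSpace.norm_sq_eq]
  exact_mod_cast h1

variable [NeZero d]

theorem aestronglyMeasurable_radialField {p : ℝ → ℂ} (hp : AEStronglyMeasurable p volume) :
    AEStronglyMeasurable (radialField p : Space d → EuclideanSpace ℂ (Fin d)) volume := by
  refine (PiLp.continuous_toLp 2 _).comp_aestronglyMeasurable
    (aemeasurable_pi_lambda _ fun j => AEStronglyMeasurable.aemeasurable ?_).aestronglyMeasurable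
  refine (hp.comp_quasiMeasurePreserving quasiMeasurePreserving_logNorm).mul
    (Measurable.aestronglyMeasurable ?_)
  exact Complex.measurable_ofReal.comp
    (((by fun_prop : Continuous fun x : Space d => x j).measurable).div measurable_norm)

section

variable {v q w p : ℝ → ℂ}

theorem IsProfile.aestronglyMeasurable_radialDeriv (h : IsProfile v q) :
    AEStronglyMeasurable (radialDeriv d v q) volume :=
  (by fun_prop : Continuous fun y : ℝ =>
    (Real.exp (-((hardyExp d + 1) * y)) : ℂ)).aestronglyMeasurable.mul
      (h.memLp_sub _).1

theorem exp_mul_norm_radialDeriv_sq (v q : ℝ → ℂ) (y : ℝ) :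
    Real.exp (d * y) * ‖radialDeriv d v q y‖ ^ 2 = ‖q y - hardyExp d * v y‖ ^ 2 := by
  rw [radialDeriv, norm_mul, Complex.norm_real, Real.norm_of_nonneg (Real.exp_pos _).le, mul_pow,
    pow_two (Real.exp _), ← mul_assoc, exp_dim_mul_sq', one_mul]

theorem IsProfile.memLp_radialField (h : IsProfile v q) :
    MemLp (radialField (radialDeriv d v q) : Space d → _) 2 volume := by
  have hm := h.aestronglyMeasurable_radialDeriv (d := d)
  rw [memLp_two_iff_integrable_sq_norm (aestronglyMeasurable_radialField hm)]
  have h1 : Integrable fun x : Space d => ‖radialDeriv d v q (logNorm x)‖ ^ 2 := by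
    rw [integrable_comp_logNorm (F := fun y => ‖radialDeriv d v q y‖ ^ 2)]
    simp only [smul_eq_mul, exp_mul_norm_radialDeriv_sq]
    exact (memLp_two_iff_integrable_sq_norm (h.memLp_sub _).1).1 (h.memLp_sub _)
  refine h1.congr ?_
  filter_upwards [ae_pos_norm (d := d)] with x hx
  rw [norm_radialField_sq _ hx]

theorem exp_mul_norm_toSpace_sq (v : ℝ → ℂ) (y : ℝ) : Real.exp (d * y) *
    ‖(Real.exp (-(hardyExp d * y)) : ℂ) * v y‖ ^ 2 = ‖expMul v y‖ ^ 2 := by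
  rw [norm_mul, Complex.norm_real, Real.norm_of_nonneg (Real.exp_pos _).le, mul_pow,
    pow_two (Real.exp _), ← mul_assoc, exp_dim_mul_sq, norm_expMul]
  ring

theorem IsProfile.memLp_toSpace (h : IsProfile v q) : MemLp (toSpace d v) 2 volume := by
  have hc : Continuous fun y => (Real.exp (-(hardyExp d * y)) : ℂ) * v y := by
    have := h.prim.continuous
    fun_prop
  refine (memLp_comp_logNorm_iff (d := d) hc.aestronglyMeasurable).2 ?_
  simp only [exp_mul_norm_toSpace_sq]
  exact (memLp_two_iff_integrable_sq_norm h.memLp_exp.1).1 h.memLp_exp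

theorem IsProfile.isWeakGradient_toSpace (h : IsProfile v q) :
    IsWeakGradient (toSpace d v) (radialField (radialDeriv d v q)) := by
  have hd : (0 : ℝ) < d := by exact_mod_cast Nat.pos_of_ne_zero (NeZero.ne d)
  refine isWeakGradient_radialField
    (F := fun y => (Real.exp (-(hardyExp d * y)) : ℂ) * v y) ?_ fun B => ?_
  · have h1 : ∀ y, HasDerivAt (fun y : ℝ => Real.exp (-(hardyExp d * y)))
        (Real.exp (-(hardyExp d * y)) * -(hardyExp d * 1)) y := fun y =>
      (((hasDerivAt_id y).const_mul _).neg).exp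
    refine (h.prim.ofReal_mul h1 (by fun_prop)).congr (fun _ => rfl) fun y => ?_
    have h2 : Real.exp y * Real.exp (-((hardyExp d + 1) * y)) = Real.exp (-(hardyExp d * y)) := by
      rw [← Real.exp_add]; congr 1; ring
    rw [radialDeriv, ← mul_assoc, ← Complex.ofReal_mul, h2]
    push_cast
    ring
  · have hki := (memLp_two_iff_integrable_sq_norm (h.memLp_sub (hardyExp d)).1).1
      (h.memLp_sub (hardyExp d))
    have hei : IntegrableOn (fun y : ℝ => Real.exp (d * y)) (Iic B) := integrableOn_exp_mul_Iic hd B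
    refine (hei.add hki.integrableOn).mono' ?_ (ae_of_all _ fun y => ?_)
    · exact (((by fun_prop : Continuous fun y : ℝ => (Real.exp (d * y) : ℂ)).aestronglyMeasurable).mul
        h.aestronglyMeasurable_radialDeriv).restrict
    · simp only [Pi.add_apply]
      rw [← exp_mul_norm_radialDeriv_sq (d := d) v q, norm_mul, Complex.norm_real,
        Real.norm_of_nonneg (Real.exp_pos _).le]
      have := Real.exp_pos (d * y)
      -- Uses t ≤ 1 + t²: square integrability together with the finite volume of balls gives
      -- weighted integrability up to the origin.
      nlinarith [sq_nonneg (‖radialDeriv d v q y‖ - 1), norm_nonneg (radialDeriv d v q y)]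

end

namespace HasProfile

variable {f g : Space d → ℂ} {v q w p : ℝ → ℂ}

theorem memLp (h : HasProfile f v q) : MemLp f 2 volume :=
  h.isProfile.memLp_toSpace.ae_eq (h.ae_eq.mono fun _ hx => hx.symm)

theorem memH1 (h : HasProfile f v q) : MemH1 f := by
  refine ⟨h.memLp, _, h.isProfile.memLp_radialField, fun ψ hψ hψc j => ?_⟩
  rw [← h.isProfile.isWeakGradient_toSpace ψ hψ hψc j]
  exact integral_congr_ae (h.ae_eq.mono fun x hx => by simp only [hx])

/-- `weakGrad` is an arbitrary choice; uniqueness of distributional gradients identifies it with the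
explicit radial field. -/
theorem weakGrad_ae_eq (h : HasProfile f v q) :
    weakGrad f =ᵐ[volume] radialField (radialDeriv d v q) :=
  h.memH1.weakGrad_spec.2.ae_eq h.isProfile.isWeakGradient_toSpace h.ae_eq
    h.memH1.weakGrad_spec.1 h.isProfile.memLp_radialField

theorem sub (h : HasProfile f v q) (h' : HasProfile g w p) :
    HasProfile (f - g) (fun y => v y - w y) (fun y => q y - p y) := by
  refine ⟨h.isProfile.sub h'.isProfile, ?_⟩
  filter_upwards [h.ae_eq, h'.ae_eq] with x hx hx'
  rw [Pi.sub_apply, hx, hx', toSpace, toSpace, toSpace]; ring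

theorem integral_mul_conj (h : HasProfile f v q) (h' : HasProfile g w p) :
    ∫ x, f x * conj (g x) = sphereArea d * massPairing v w := by
  have h1 : ∀ᵐ x, f x * conj (g x) = toSpace d v x * conj (toSpace d w x) := by
    filter_upwards [h.ae_eq, h'.ae_eq] with x hx hx'
    rw [hx, hx']
  rw [integral_congr_ae h1, ← Complex.real_smul]
  refine (integral_comp_logNorm (fun y => ((Real.exp (-(hardyExp d * y)) : ℂ) * v y) *
    conj ((Real.exp (-(hardyExp d * y)) : ℂ) * w y))).trans ?_
  rw [massPairing, pair]
  congr 2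
  ext y
  have h2 := congrArg (fun r : ℝ => (r : ℂ)) (exp_dim_mul_sq (d := d) y)
  simp only [Complex.ofReal_mul] at h2
  rw [Complex.real_smul, expMul, expMul, map_mul, map_mul, Complex.conj_ofReal, Complex.conj_ofReal]
  linear_combination (v y * conj (w y)) * h2

theorem integral_weakGrad (h : HasProfile f v q) (h' : HasProfile g w p) :
    ∫ x, ∑ j : Fin d, weakGrad f x j * conj (weakGrad g x j) =
      sphereArea d * (pair q p + ((hardyExp d ^ 2 : ℝ) : ℂ) * pair v w) := by
  have h1 : ∀ᵐ x, ∑ j : Fin d, weakGrad f x j * conj (weakGrad g x j) =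
      radialDeriv d v q (logNorm x) * conj (radialDeriv d w p (logNorm x)) := by
    filter_upwards [h.weakGrad_ae_eq, h'.weakGrad_ae_eq, ae_pos_norm (d := d)] with x hx hx' hx0
    rw [hx, hx', sum_radialField_mul_conj _ _ hx0]
  rw [integral_congr_ae h1, ← Complex.real_smul, ← h.isProfile.pair_sub_sub h'.isProfile]
  refine (integral_comp_logNorm
    (fun y => radialDeriv d v q y * conj (radialDeriv d w p y))).trans ?_
  rw [pair]
  congr 2
  ext y
  have h2 := congrArg (fun r : ℝ => (r : ℂ)) (exp_dim_mul_sq' (d := d) y)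
  simp only [Complex.ofReal_mul] at h2
  rw [Complex.real_smul, radialDeriv, radialDeriv, map_mul, Complex.conj_ofReal]
  rw [Complex.ofReal_one] at h2
  linear_combination ((q y - hardyExp d * v y) * conj (p y - hardyExp d * w y)) * h2

/-- Collecting exponents: d - b - (σ + 2)α = 2 - b - σα, because d = 2α + 2. -/
theorem integral_weight_mul_conj (h : HasProfile f v q) (h' : HasProfile g w p) {b σ : ℝ} :
    ∫ x, ((‖x‖ ^ (-b) * ‖f x‖ ^ σ : ℝ) : ℂ) * (f x * conj (g x)) =
      sphereArea d * ∫ y, ((Real.exp ((2 - b - σ * hardyExp d) * y) * ‖v y‖ ^ σ : ℝ) : ℂ) *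
        (v y * conj (w y)) := by
  have h1 : ∀ᵐ x, ((‖x‖ ^ (-b) * ‖f x‖ ^ σ : ℝ) : ℂ) * (f x * conj (g x)) =
      ((Real.exp (-b * logNorm x) * ‖toSpace d v x‖ ^ σ : ℝ) : ℂ) *
        (toSpace d v x * conj (toSpace d w x)) := by
    filter_upwards [h.ae_eq, h'.ae_eq, ae_pos_norm (d := d)] with x hx hx' hx0
    rw [hx, hx', exp_logNorm hx0]
  rw [integral_congr_ae h1, ← Complex.real_smul]
  refine (integral_comp_logNorm (fun y => ((Real.exp (-b * y) *
    ‖(Real.exp (-(hardyExp d * y)) : ℂ) * v y‖ ^ σ : ℝ) : ℂ) *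
    (((Real.exp (-(hardyExp d * y)) : ℂ) * v y) *
    conj ((Real.exp (-(hardyExp d * y)) : ℂ) * w y)))).trans ?_
  congr 2
  ext y
  have h2 : Real.exp (d * y) * (Real.exp (-b * y) *
      ‖(Real.exp (-(hardyExp d * y)) : ℂ) * v y‖ ^ σ) *
      (Real.exp (-(hardyExp d * y)) * Real.exp (-(hardyExp d * y))) =
      Real.exp ((2 - b - σ * hardyExp d) * y) * ‖v y‖ ^ σ := by
    rw [norm_mul, Complex.norm_real, Real.norm_of_nonneg (Real.exp_pos _).le,
      Real.mul_rpow (Real.exp_pos _).le (norm_nonneg _), ← Real.exp_mul]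
    calc _ = Real.exp (d * y) * Real.exp (-b * y) * Real.exp (-(hardyExp d * y) * σ) *
          (Real.exp (-(hardyExp d * y)) * Real.exp (-(hardyExp d * y))) * ‖v y‖ ^ σ := by ring
      _ = _ := by
        rw [← Real.exp_add, ← Real.exp_add, ← Real.exp_add, ← Real.exp_add]
        congr 2
        rw [hardyExp]; ring
  have h3 := congrArg (fun r : ℝ => (r : ℂ)) h2
  rw [← h2, Complex.real_smul, map_mul, Complex.conj_ofReal]
  push_cast
  ring

theorem hamiltonianPairing_eq (h : HasProfile f v q) (h' : HasProfile g w p) {b c σ : ℝ} :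
    hamiltonianPairing b c σ f g = sphereArea d *
      energyPairing (2 - b - σ * hardyExp d) (c + hardyExp d ^ 2) σ v q w p := by
  -- The Hardy term is the case b = 2, σ = 0, in which the exponential weight disappears.
  have h1 := h.integral_weight_mul_conj h' (b := 2) (σ := 0)
  have h2 : ∫ x, ((1 / ‖x‖ ^ 2 : ℝ) : ℂ) * (f x * conj (g x)) = sphereArea d * pair v w := by
    rw [pair]
    refine Eq.trans (integral_congr_ae (ae_of_all _ fun x => ?_)) (h1.trans ?_)
    · simp only [Real.rpow_zero, mul_one, Real.rpow_neg (norm_nonneg x), one_div]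
      norm_cast
    · simp
  rw [hamiltonianPairing, h.integral_weakGrad h', h.integral_weight_mul_conj h', h2, energyPairing]
  push_cast
  ring

end HasProfile

end

theorem toReal_eLpNorm_sq {X E : Type*} [MeasurableSpace X] {μ : Measure X} [NormedAddCommGroup E]
    {f : X → E} (hf : MemLp f 2 μ) : (eLpNorm f 2 μ).toReal ^ 2 = ∫ x, ‖f x‖ ^ 2 ∂μ := by
  have h0 : 0 ≤ ∫ x, ‖f x‖ ^ (2 : ℝ) ∂μ := integral_nonneg fun x => by positivity
  rw [hf.eLpNorm_eq_integral_rpow_norm two_ne_zero ENNReal.ofNat_ne_top,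
    ENNReal.toReal_ofReal (by positivity), ← Real.rpow_natCast, ENNReal.toReal_ofNat,
    ← Real.rpow_mul h0]
  norm_num

theorem hardyExp_pos {d : ℕ} (hd : 3 ≤ d) : 0 < hardyExp d := by
  have : (3 : ℝ) ≤ d := by exact_mod_cast hd
  rw [hardyExp]; linarith

namespace HasProfile

variable {d : ℕ} [NeZero d] {f : Space d → ℂ} {v q : ℝ → ℂ}

/-- In dimension at least three every radial function in `H¹` has a logarithmic profile. -/
theorem exists_of_isRadial (hd : 3 ≤ d) (hf : MemH1 f) (hr : IsRadial f) :
    ∃ v q, HasProfile f v q := by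
  obtain ⟨F, p, hFp, hF, hpm, hp⟩ := exists_isPrimitive_of_isRadial hf hr
  set a := hardyExp d with ha
  -- Here q - a v is e^((a+1)y) times the radial derivative, so its L² norm is that of the gradient
  -- up to the sphere area. Hardy's inequality, which needs a > 0, then puts v and q separately in
  -- L².
  set v : ℝ → ℂ := fun y => (Real.exp (a * y) : ℂ) * F y with hv
  have hexp : ∀ y : ℝ, (Real.exp (-(a * y)) : ℂ) * (Real.exp (a * y) : ℂ) = 1 := fun y => by
    rw [← Complex.ofReal_mul, ← Real.exp_add, neg_add_cancel, Real.exp_zero, Complex.ofReal_one]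
  set q : ℝ → ℂ := fun y => ((Real.exp (a * y) * a : ℝ) : ℂ) * F y +
    (Real.exp (a * y) : ℂ) * ((Real.exp y : ℂ) * p y) with hq
  have hvq : IsPrimitive v q := by
    have h1 : ∀ y, HasDerivAt (fun y : ℝ => Real.exp (a * y)) (Real.exp (a * y) * a) y := fun y => by
      simpa using ((hasDerivAt_id y).const_mul a).exp
    exact hFp.ofReal_mul h1 (by fun_prop)
  have hk : ∀ y, q y - a * v y = (Real.exp ((a + 1) * y) : ℂ) * p y := fun y => by
    have : Real.exp ((a + 1) * y) = Real.exp (a * y) * Real.exp y := by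
      rw [← Real.exp_add]; congr 1; ring
    rw [this, hq, hv]; push_cast; ring
  have hf2 : MemLp (fun x : Space d => F (logNorm x)) 2 volume := hf.1.ae_eq hF
  have hkm : MemLp (fun y => q y - a * v y) 2 volume := by
    simp only [hk]
    have hm : AEStronglyMeasurable (fun y => (Real.exp ((a + 1) * y) : ℂ) * p y) volume :=
      (by fun_prop : Continuous fun y : ℝ =>
        (Real.exp ((a + 1) * y) : ℂ)).aestronglyMeasurable.mul hpm
    rw [memLp_two_iff_integrable_sq_norm hm]
    refine ((memLp_comp_logNorm_iff hpm).1 hp).congr (ae_of_all _ fun y => ?_)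
    simp only [norm_mul, Complex.norm_real, Real.norm_of_nonneg (Real.exp_pos _).le, mul_pow,
      ← Real.exp_nat_mul]
    congr 2
    rw [ha, hardyExp]; push_cast; ring
  have hem : MemLp (expMul v) 2 volume := by
    have hc : Continuous (expMul v) := by
      have := hvq.continuous
      unfold expMul; fun_prop
    rw [memLp_two_iff_integrable_sq_norm hc.aestronglyMeasurable]
    refine ((memLp_comp_logNorm_iff hFp.continuous.aestronglyMeasurable).1 hf2).congr
      (ae_of_all _ fun y => ?_)
    simp only [norm_expMul, hv, norm_mul, Complex.norm_real,
      Real.norm_of_nonneg (Real.exp_pos _).le, mul_pow, ← Real.exp_nat_mul]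
    rw [← mul_assoc, ← Real.exp_add]
    congr 2
    rw [ha, hardyExp]; push_cast; ring
  have hvm : MemLp v 2 volume := memLp_two_of_sub_memLp (hardyExp_pos hd) hvq hkm hem
  refine ⟨v, q, ⟨hvq, hvm, ?_, hem⟩, ?_⟩
  · refine (hkm.add (hvm.const_mul (a : ℂ))).ae_eq (ae_of_all _ fun y => ?_)
    simp
  · filter_upwards [hF] with x hx
    rw [hx, toSpace, hv]
    simp only
    rw [← mul_assoc, hexp, one_mul]

/-- Integrals of weighted powers of a radial function. -/
theorem integral_weight_mul_rpow (h : HasProfile f v q) {b s β : ℝ}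
    (hβ : β = d - b - s * hardyExp d) :
    (Integrable (fun x => ‖x‖ ^ (-b) * ‖f x‖ ^ s) ↔
      Integrable fun y => Real.exp (β * y) * ‖v y‖ ^ s) ∧
    ∫ x, ‖x‖ ^ (-b) * ‖f x‖ ^ s = sphereArea d * ∫ y, Real.exp (β * y) * ‖v y‖ ^ s := by
  set K : ℝ → ℝ := fun y => Real.exp (-b * y) * ‖(Real.exp (-(hardyExp d * y)) : ℂ) * v y‖ ^ s
  have h1 : (fun x => ‖x‖ ^ (-b) * ‖f x‖ ^ s) =ᵐ[volume] fun x => K (logNorm x) := by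
    filter_upwards [h.ae_eq, ae_pos_norm (d := d)] with x hx hx0
    rw [hx, ← exp_logNorm hx0]; rfl
  have h2 : ∀ y, Real.exp (d * y) • K y = Real.exp (β * y) * ‖v y‖ ^ s := by
    intro y
    simp only [K, smul_eq_mul]
    rw [norm_mul, Complex.norm_real, Real.norm_of_nonneg (Real.exp_pos _).le,
      Real.mul_rpow (Real.exp_pos _).le (norm_nonneg _), ← Real.exp_mul, ← mul_assoc, ← mul_assoc,
      ← Real.exp_add, ← Real.exp_add]
    congr 2
    rw [hβ]; ring
  constructor
  · rw [integrable_congr h1, integrable_comp_logNorm]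
    simp only [h2]
  · rw [integral_congr_ae h1, integral_comp_logNorm]
    simp only [h2, smul_eq_mul]

theorem integral_norm_sq (h : HasProfile f v q) :
    ∫ x, ‖f x‖ ^ 2 = sphereArea d * l2 (expMul v) ^ 2 := by
  have h1 := (h.integral_weight_mul_rpow (b := 0) (s := 2) (β := 2) (by rw [hardyExp]; ring)).2
  simp only [neg_zero, Real.rpow_zero, one_mul, Real.rpow_two] at h1
  rw [h1, l2_sq h.isProfile.memLp_exp]
  congr 2
  ext y
  rw [norm_expMul, mul_pow, ← Real.exp_nat_mul]
  norm_num

theorem mass_eq (h : HasProfile f v q) : mass f = sphereArea d * l2 (expMul v) ^ 2 :=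
  h.integral_norm_sq

theorem integral_inv_sq_mul (h : HasProfile f v q) :
    Integrable (fun x => ‖f x‖ ^ 2 / ‖x‖ ^ 2) ∧
      ∫ x, ‖f x‖ ^ 2 / ‖x‖ ^ 2 = sphereArea d * l2 v ^ 2 := by
  have h1 := h.integral_weight_mul_rpow (b := 2) (s := 2) (β := 0) (by rw [hardyExp]; ring)
  have h2 : ∀ x : Space d, ‖x‖ ^ (-2 : ℝ) * ‖f x‖ ^ (2 : ℝ) = ‖f x‖ ^ 2 / ‖x‖ ^ 2 := fun x => by
    rw [Real.rpow_neg (norm_nonneg x), Real.rpow_two, Real.rpow_two]; ring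
  simp only [h2] at h1
  simp only [zero_mul, Real.exp_zero, one_mul, Real.rpow_two] at h1
  rw [l2_sq h.isProfile.memLp]
  exact ⟨h1.1.2 h.isProfile.integrable_norm_sq, h1.2⟩

theorem integral_weakGrad_sq (h : HasProfile f v q) :
    Integrable (fun x => ‖weakGrad f x‖ ^ 2) ∧
      ∫ x, ‖weakGrad f x‖ ^ 2 = sphereArea d * (l2 q ^ 2 + hardyExp d ^ 2 * l2 v ^ 2) := by
  have h0 := h.memH1.weakGrad_spec.1
  refine ⟨(memLp_two_iff_integrable_sq_norm h0.1).1 h0, ?_⟩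
  have h1 := h.integral_weakGrad h
  rw [pair_self h.isProfile.memLp_deriv, pair_self h.isProfile.memLp] at h1
  have h2 : ∀ x, ∑ j : Fin d, weakGrad f x j * conj (weakGrad f x j) =
      ((‖weakGrad f x‖ ^ 2 : ℝ) : ℂ) := fun x => by
    simp only [Complex.mul_conj, Complex.normSq_eq_norm_sq]
    rw [EuclideanSpace.norm_sq_eq]
    push_cast; rfl
  simp only [h2] at h1
  rw [integral_complex_ofReal] at h1
  exact_mod_cast h1

theorem normSqH1c_eq (h : HasProfile f v q) (c : ℝ) :
    normSqH1c c f = sphereArea d * (l2 q ^ 2 + (c + hardyExp d ^ 2) * l2 v ^ 2) := by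
  rw [normSqH1c, integral_add h.integral_weakGrad_sq.1 (h.integral_inv_sq_mul.1.const_mul c),
    integral_const_mul, h.integral_weakGrad_sq.2, h.integral_inv_sq_mul.2]
  ring

/-- The `H¹` norm controls the norm of the profile. -/
theorem profileNorm_le (hd : 3 ≤ d) (h : HasProfile f v q) :
    profileNorm v q ≤ ((hardyExp d)⁻¹ + 1) * (Real.sqrt (sphereArea d))⁻¹ *
      (eLpNorm f 2 volume + eLpNorm (weakGrad f) 2 volume).toReal := by
  have hκ := sphereArea_pos (d := d)
  have ha := hardyExp_pos hd
  set s := Real.sqrt (sphereArea d)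
  have hs : 0 < s := Real.sqrt_pos.2 hκ
  have hs2 : s ^ 2 = sphereArea d := Real.sq_sqrt hκ.le
  rw [ENNReal.toReal_add h.memLp.eLpNorm_ne_top h.memH1.weakGrad_spec.1.eLpNorm_ne_top]
  have e1 := toReal_eLpNorm_sq h.memLp
  have e2 := toReal_eLpNorm_sq h.memH1.weakGrad_spec.1
  rw [h.integral_norm_sq] at e1
  rw [h.integral_weakGrad_sq.2] at e2
  set A := (eLpNorm f 2 volume).toReal
  set B := (eLpNorm (weakGrad f) 2 volume).toReal
  have hA : 0 ≤ A := ENNReal.toReal_nonneg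
  have hB : 0 ≤ B := ENNReal.toReal_nonneg
  have b1 : s * l2 (expMul v) ≤ A := by
    refine abs_le_of_sq_le_sq' ?_ hA |>.2
    rw [e1, mul_pow, hs2]
  have b2 : s * l2 q ≤ B := by
    refine abs_le_of_sq_le_sq' ?_ hB |>.2
    rw [e2, mul_pow, hs2]
    have : 0 ≤ hardyExp d ^ 2 * l2 v ^ 2 := by positivity
    nlinarith
  have b3 : s * (hardyExp d * l2 v) ≤ B := by
    refine abs_le_of_sq_le_sq' ?_ hB |>.2
    rw [e2, mul_pow, mul_pow, hs2]
    have : 0 ≤ l2 q ^ 2 := by positivity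
    nlinarith
  have b4 : s * l2 v ≤ (hardyExp d)⁻¹ * B := by
    rw [inv_mul_eq_div, le_div_iff₀ ha]; linarith
  have key : s * profileNorm v q ≤ ((hardyExp d)⁻¹ + 1) * (A + B) := by
    have : 0 ≤ (hardyExp d)⁻¹ * A := by positivity
    unfold profileNorm
    linarith
  calc profileNorm v q = s⁻¹ * (s * profileNorm v q) := by field_simp
    _ ≤ s⁻¹ * (((hardyExp d)⁻¹ + 1) * (A + B)) := by gcongr
    _ = _ := by ring

theorem integral_truncatedWeight_mul (h : HasProfile f v q) (θ : ℝ → ℝ) {R : ℝ} (hR : 0 < R) :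
    ∫ x, truncatedWeight θ R x * ‖f x‖ ^ 2 = sphereArea d *
      (massPairing (fun y => ((R ^ 2 * logProfile θ (y - Real.log R) : ℝ) : ℂ) * v y) v).re := by
  set K : ℝ → ℝ := fun y => R ^ 2 * logProfile θ (y - Real.log R) *
    ‖(Real.exp (-(hardyExp d * y)) : ℂ) * v y‖ ^ 2
  have h1 : (fun x => truncatedWeight θ R x * ‖f x‖ ^ 2) =ᵐ[volume] fun x => K (logNorm x) := by
    filter_upwards [h.ae_eq, ae_pos_norm (d := d)] with x hx hx0
    rw [hx, truncatedWeight]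
    simp only [K, logProfile, logNorm, toSpace]
    rw [Real.exp_sub, Real.exp_log hx0, Real.exp_log hR]
  rw [integral_congr_ae h1, integral_comp_logNorm, smul_eq_mul]
  congr 1
  have h2 : massPairing (fun y => ((R ^ 2 * logProfile θ (y - Real.log R) : ℝ) : ℂ) * v y) v =
      ((∫ y, Real.exp (d * y) • K y : ℝ) : ℂ) := by
    rw [← integral_complex_ofReal, massPairing, pair]
    congr 1
    ext y
    have h3 : expMul (fun y => ((R ^ 2 * logProfile θ (y - Real.log R) : ℝ) : ℂ) * v y) y *
        conj (expMul v y) = ((R ^ 2 * logProfile θ (y - Real.log R) : ℝ) : ℂ) *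
          (expMul v y * conj (expMul v y)) := by simp only [expMul]; ring
    rw [h3, Complex.mul_conj, Complex.normSq_eq_norm_sq, ← Complex.ofReal_mul, smul_eq_mul]
    congr 1
    rw [← exp_mul_norm_toSpace_sq (d := d)]
    simp only [K]; ring
  rw [h2, Complex.ofReal_re]

end HasProfile

/-! ### Transfer of the equation and of the virial identity -/

/-- The profiles of a radial solution of the INLS equation solve the one-dimensional equation. -/
theorem IsFocusingSolution.isProfileSolution {d : ℕ} [NeZero d] (hd : 3 ≤ d) {b c σ : ℝ}
    {I : Set ℝ} {u : ℝ → Space d → ℂ} (hu : IsFocusingSolution b c σ I u) {v q : ℝ → ℝ → ℂ}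
    (h : ∀ t ∈ I, HasProfile (u t) (v t) (q t)) :
    IsProfileSolution (2 - b - σ * hardyExp d) (c + hardyExp d ^ 2) σ I v q := by
  have hκ := sphereArea_pos (d := d)
  refine ⟨fun t ht => (h t ht).isProfile, fun t ht => ?_, fun w p hw t ht => ?_⟩
  · have h1 := (ENNReal.tendsto_toReal ENNReal.zero_ne_top).comp (hu.continuousH1 t ht)
    have h2 := h1.const_mul (((hardyExp d)⁻¹ + 1) * (Real.sqrt (sphereArea d))⁻¹)
    rw [ENNReal.toReal_zero, mul_zero] at h2
    refine squeeze_zero' (Eventually.of_forall fun s => profileNorm_nonneg _ _) ?_ h2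
    filter_upwards [self_mem_nhdsWithin] with s hs
    have h3 := ((h s hs).sub (h t ht))
    refine (h3.profileNorm_le hd).trans (le_of_eq ?_)
    have h4 : weakGrad (u s - u t) =ᵐ[volume] weakGrad (u s) - weakGrad (u t) :=
      h3.memH1.weakGrad_spec.2.ae_eq
        ((hu.memH1 s hs).weakGrad_spec.2.sub (hu.memH1 t ht).weakGrad_spec.2 (hu.memH1 s hs).1
          (hu.memH1 t ht).1 (hu.memH1 s hs).weakGrad_spec.1 (hu.memH1 t ht).weakGrad_spec.1)
        (EventuallyEq.refl _ _) h3.memH1.weakGrad_spec.1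
        ((hu.memH1 s hs).weakGrad_spec.1.sub (hu.memH1 t ht).weakGrad_spec.1)
    rw [eLpNorm_congr_ae h4]
    rfl
  -- Every profile is the profile of an H¹ function, so the equation in H⁻¹ may be tested against
  -- it.
  · have hW : HasProfile (toSpace d w) w p := ⟨hw, ae_of_all _ fun _ => rfl⟩
    have h1 := hu.equation _ hW.memH1 t ht
    rw [(h t ht).hamiltonianPairing_eq hW] at h1
    have h2 := (h1.congr (fun s hs => ((h s hs).integral_mul_conj hW).symm)
      ((h t ht).integral_mul_conj hW).symm).const_mul ((sphereArea d : ℂ)⁻¹)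
    have hκ' : (sphereArea d : ℂ) ≠ 0 := by exact_mod_cast hκ.ne'
    refine (h2.congr_deriv ?_).congr (fun s _ => ?_) ?_ <;> field_simp

theorem contDiffOn_two_of_hasDerivWithinAt {f f' f'' : ℝ → ℝ} {I : Set ℝ} (hI : UniqueDiffOn ℝ I)
    (h1 : ∀ t ∈ I, HasDerivWithinAt f (f' t) I t) (h2 : ∀ t ∈ I, HasDerivWithinAt f' (f'' t) I t)
    (hc : ContinuousOn f'' I) :
    ContDiffOn ℝ 2 f I ∧ ∀ t ∈ I, iteratedDerivWithin 2 f I t = f'' t := by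
  have e1 : ∀ t ∈ I, derivWithin f I t = f' t := fun t ht => (h1 t ht).derivWithin (hI t ht)
  have e2 : ∀ t ∈ I, derivWithin f' I t = f'' t := fun t ht => (h2 t ht).derivWithin (hI t ht)
  have c1 : ContDiffOn ℝ 1 f' I := by
    rw [show (1 : WithTop ℕ∞) = 0 + 1 by norm_num, contDiffOn_succ_iff_derivWithin hI]
    refine ⟨fun t ht => (h2 t ht).differentiableWithinAt, by simp, ?_⟩
    exact contDiffOn_zero.2 (hc.congr e2)
  refine ⟨?_, fun t ht => ?_⟩
  · rw [show (2 : WithTop ℕ∞) = 1 + 1 by norm_num, contDiffOn_succ_iff_derivWithin hI]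
    exact ⟨fun t ht => (h1 t ht).differentiableWithinAt, by simp, c1.congr e1⟩
  · rw [iteratedDerivWithin_succ, ← e2 t ht]
    refine derivWithin_congr (fun s hs => ?_) ?_
    · rw [iteratedDerivWithin_one, e1 s hs]
    · rw [iteratedDerivWithin_one, e1 t ht]

/-- The truncated virial identity for a radial solution. -/
theorem IsFocusingSolution.virial_identity {d : ℕ} [NeZero d] (hd : 3 ≤ d) {b c σ : ℝ}
    (hσ : 0 < σ) (hβ0 : 0 ≤ 2 - b - σ * hardyExp d) (hβ2 : 2 - b - σ * hardyExp d ≤ 2)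
    {I : Set ℝ} (hI : I.OrdConnected) (hIi : (interior I).Nonempty) {u : ℝ → Space d → ℂ}
    (hu : IsFocusingSolution b c σ I u) {v q : ℝ → ℝ → ℂ}
    (h : ∀ t ∈ I, HasProfile (u t) (v t) (q t)) {θ : ℝ → ℝ} (hθ : IsVirialProfile θ) {R : ℝ}
    (hR : 0 < R) :
    ContDiffOn ℝ 2 (virial (truncatedWeight θ R) u) I ∧
    ∀ t ∈ I, iteratedDerivWithin 2 (virial (truncatedWeight θ R) u) I t =
      sphereArea d * virialRate (2 - b - σ * hardyExp d) (c + hardyExp d ^ 2) σ (virialCutoff θ R)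
        (fun x => deriv (logSlope θ) (x - Real.log R))
        (fun x => deriv (deriv (logSlope θ)) (x - Real.log R))
        (fun x => deriv (deriv (deriv (logSlope θ))) (x - Real.log R)) (v t) (q t) := by
  have hs := hu.isProfileSolution hd h
  obtain ⟨C, -, hC⟩ := hθ.exists_logSlope_bound
  obtain ⟨B, hB⟩ := hθ.exists_logProfile_bound
  have hm := isCutoff_virialCutoff hθ hC R
  -- In y = log r the derivative of the weight is r φ_R'(r) = r² (φ_R'(r)/r), which is e^(2y) times
  -- the cutoff.
  have hφ : ∀ x, HasDerivAt (fun x => R ^ 2 * logProfile θ (x - Real.log R))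
      (Real.exp (2 * x) * virialCutoff θ R x) x := fun x => by
    have h1 := ((hθ.contDiff_logProfile.differentiable (by norm_num)
      (x - Real.log R)).hasDerivAt.comp_sub_const x (Real.log R)).const_mul (R ^ 2)
    refine h1.congr_deriv ?_
    rw [virialCutoff, logSlope, ← mul_assoc, ← Real.exp_add,
      show 2 * x + -2 * (x - Real.log R) = (2 : ℕ) * Real.log R by push_cast; ring,
      Real.exp_nat_mul, Real.exp_log hR]
  have hφB : ∀ x, |R ^ 2 * logProfile θ (x - Real.log R)| ≤ R ^ 2 * B := fun x => by
    rw [abs_mul, abs_of_pos (by positivity : 0 < R ^ 2)]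
    gcongr
    exact hB _
  have hm3 : ∀ x, HasDerivAt (fun x => deriv (deriv (logSlope θ)) (x - Real.log R))
      (deriv (deriv (deriv (logSlope θ))) (x - Real.log R)) x := fun x =>
    (hθ.contDiff_deriv2_logSlope.differentiable (by norm_num) _).hasDerivAt.comp_sub_const
      x (Real.log R)
  have hm3c : Continuous fun x => deriv (deriv (deriv (logSlope θ))) (x - Real.log R) :=
    hθ.continuous_deriv3_logSlope.comp (continuous_sub_right _)
  have hm3C : ∀ x, |deriv (deriv (deriv (logSlope θ))) (x - Real.log R)| ≤ C := fun x =>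
    (hC _).2.2.2
  refine contDiffOn_two_of_hasDerivWithinAt (uniqueDiffOn_convex hI.convex hIi)
    (f' := fun t => sphereArea d * momentum (virialCutoff θ R) (v t) (q t)) (fun t ht => ?_)
    (fun t ht => (hs.hasDerivWithinAt_momentum hI hβ0 hβ2 hσ hm hm3 hm3c hm3C ht).const_mul _)
    (continuousOn_const.mul (hs.continuousOn_virialRate hβ0 hβ2 hσ hm hm3c hm3C))
  refine ((hs.hasDerivWithinAt_virial hI hβ0 hβ2 hσ.le hm hφ hφB ht).const_mul
    (sphereArea d)).congr (fun s hs' => ?_) ?_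
  · exact (h s hs').integral_truncatedWeight_mul θ hR
  · exact (h t ht).integral_truncatedWeight_mul θ hR

end INLS

end

/-! ### The truncated virial estimate -/

theorem lemma4p6 (d : ℕ) (hd : 3 ≤ d) (b σ c : ℝ) (hb0 : 0 < b) (hb2 : b < 2)
    (hσ0 : 0 < σ) (hσ : σ ≤ (4 - 2 * b) / ((d : ℝ) - 2))
    (hc : -(((d : ℝ) - 2) / 2) ^ 2 < c)
    (θ : ℝ → ℝ) (hθ : INLS.IsVirialProfile θ) (m : ℝ) :
    ∃ C : ℝ, 0 < C ∧
      ∀ (I : Set ℝ), I.OrdConnected → (interior I).Nonempty →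
      ∀ u : ℝ → INLS.Space d → ℂ, INLS.IsFocusingSolution b c σ I u →
        (∀ t ∈ I, INLS.IsRadial (u t)) →
        (∃ t₀ ∈ I, INLS.mass (u t₀) ≤ m) →
        (∀ t ∈ I, Integrable (fun x => ‖u t x‖ ^ 2 / ‖x‖ ^ 2) ∧
          Integrable (fun x => ‖x‖ ^ (-b) * ‖u t x‖ ^ (σ + 2))) ∧
        ∀ R : ℝ, 1 < R →
          ContDiffOn ℝ 2 (INLS.virial (INLS.truncatedWeight θ R) u) I ∧
          ∀ ε : ℝ, 0 < ε → ∀ t ∈ I,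
            iteratedDerivWithin 2 (INLS.virial (INLS.truncatedWeight θ R) u) I t ≤
              8 * INLS.normSqH1c c (u t)
                - 4 * (d * σ + 2 * b) / (σ + 2) * (∫ x, ‖x‖ ^ (-b) * ‖u t x‖ ^ (σ + 2))
                + C * (R ^ (-2 : ℝ)
                    + ε ^ (-(σ / (4 - σ))) * R ^ (-(2 * (((d : ℝ) - 1) * σ + 2 * b) / (4 - σ)))
                    + ε * INLS.normSqH1c c (u t)) := by
  open INLS in
  have : NeZero d := ⟨by omega⟩
  have hd' : (3 : ℝ) ≤ d := by exact_mod_cast hd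
  have hd2 : (0 : ℝ) < (d : ℝ) - 2 := by linarith
  have hκ := sphereArea_pos (d := d)
  have hα := hardyExp_pos hd
  set κ := sphereArea d
  set α := hardyExp d with hαdef
  have hα2 : (d : ℝ) - 2 = 2 * α := by rw [hαdef, hardyExp]; ring
  have hγ : 0 ≤ c + α ^ 2 := by
    rw [hαdef, hardyExp]; linarith
  rw [hα2, le_div_iff₀ (by positivity)] at hσ
  set β := 2 - b - σ * α with hβ
  have hβ0 : 0 ≤ β := by linarith
  have hβ2 : β ≤ 2 := by have := mul_pos hσ0 hα; linarith
  -- For d ≥ 3 one has d - 2 ≥ 1, so σ ≤ 4 - 2b < 4; Young's inequality requires this.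
  have hσ4 : σ < 4 := by
    have : 1 ≤ 2 * α := by linarith
    nlinarith
  obtain ⟨A, hA0, hA⟩ := hθ.exists_logSlope_bound
  set K := 8 + 8 * β / (σ + 2) + 6 * A + 4 / (σ + 2) * (3 * A) with hK
  have hK0 : 0 ≤ K := by positivity
  -- A bound for ‖e^y v‖² at every time, by conservation of mass. The absolute value makes the
  -- constants nonnegative for every real m.
  set M := |m| / κ with hM
  have hM0 : 0 ≤ M := by positivity
  set B := K * (2 ^ (σ / 2) * M ^ (σ / 4 + 1)) with hB
  have hB0 : 0 ≤ B := by positivity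
  -- One summand per error: 3A|m| for R⁻², κB for the pure Young term, B for the ε term (where κ is
  -- absorbed into the form of P_c), and 1 for positivity.
  refine ⟨1 + 3 * A * |m| + B + κ * B, by positivity, fun I hI hIi u hu hr hm => ?_⟩
  -- Profiles are chosen for all real t, with the zero functions as irrelevant values outside I.
  have hprof : ∀ t, ∃ v q, t ∈ I → HasProfile (u t) v q := fun t => by
    by_cases ht : t ∈ I
    · obtain ⟨v, q, h⟩ := HasProfile.exists_of_isRadial hd (hu.memH1 t ht) (hr t ht)
      exact ⟨v, q, fun _ => h⟩
    · exact ⟨0, 0, fun h => absurd h ht⟩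
  choose v q hvq using hprof
  have hpot : ∀ t ∈ I, (Integrable (fun x => ‖x‖ ^ (-b) * ‖u t x‖ ^ (σ + 2)) ↔
      Integrable fun y => Real.exp (β * y) * ‖v t y‖ ^ (σ + 2)) ∧
      ∫ x, ‖x‖ ^ (-b) * ‖u t x‖ ^ (σ + 2) =
        κ * ∫ y, Real.exp (β * y) * ‖v t y‖ ^ (σ + 2) := fun t ht =>
    (hvq t ht).integral_weight_mul_rpow (by rw [hβ]; linarith)
  have hsol := hu.isProfileSolution hd hvq
  refine ⟨fun t ht => ⟨(hvq t ht).integral_inv_sq_mul.1, (hpot t ht).1.2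
    (integrable_exp_mul_norm_rpow hβ0 hβ2 hσ0 (hvq t ht).isProfile)⟩, fun R hR => ?_⟩
  have hR0 : 0 < R := by linarith
  obtain ⟨hV, hV'⟩ := hu.virial_identity hd hσ0 hβ0 hβ2 hI hIi hvq hθ hR0
  refine ⟨hV, fun ε hε t ht => ?_⟩
  have hv := (hvq t ht).isProfile
  rw [hV' t ht, (hvq t ht).normSqH1c_eq, (hpot t ht).2]
  have h1 := virialRate_le hθ hA hβ0 hβ2 hγ hσ0 hσ4 hR0 hv rfl hε
  have hmass : κ * l2 (expMul (v t)) ^ 2 ≤ |m| := by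
    obtain ⟨t₀, ht₀, hm⟩ := hm
    have h2 := hsol.mass_eq hI hβ0 hβ2 hσ0.le ht ht₀
    rw [massPairing, massPairing, pair_self hv.memLp_exp,
      pair_self (hvq t₀ ht₀).isProfile.memLp_exp] at h2
    rw [Complex.ofReal_injective h2, ← (hvq t₀ ht₀).mass_eq]
    exact hm.trans (le_abs_self m)
  set L := l2 (expMul (v t)) ^ 2
  have hL0 : 0 ≤ L := by positivity
  have hLM : L ≤ M := by rw [hM, le_div_iff₀ hκ]; linarith
  have e1 : 8 - 8 * β / (σ + 2) = 4 * (d * σ + 2 * b) / (σ + 2) := by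
    have : (d : ℝ) = 2 * α + 2 := by linarith
    rw [this, hβ]; field_simp; ring
  have e2 : 4 * (σ / 2 + 2 - β) / (4 - σ) = 2 * (((d : ℝ) - 1) * σ + 2 * b) / (4 - σ) := by
    have : (d : ℝ) = 2 * α + 2 := by linarith
    rw [this, hβ]; congr 1; ring
  rw [e1, e2] at h1
  set P := ε ^ (-(σ / (4 - σ))) * R ^ (-(2 * (((d : ℝ) - 1) * σ + 2 * b) / (4 - σ)))
  have hP : 0 ≤ P := by positivity
  set Q := R ^ (-2 : ℝ)
  have hQ : 0 ≤ Q := by positivity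
  set J := ∫ y, Real.exp (β * y) * ‖v t y‖ ^ (σ + 2)
  set D := 4 * (d * σ + 2 * b) / (σ + 2)
  set N := l2 (q t) ^ 2 + (c + α ^ 2) * l2 (v t) ^ 2
  -- Here c + α² ≥ 0 is used: the form of P_c dominates the radial kinetic term, so the ε error can
  -- be expressed through it.
  have hqN : l2 (q t) ^ 2 ≤ N := le_add_of_nonneg_right (by positivity)
  have hN : 0 ≤ N := by positivity
  have h2 : K * (2 ^ (σ / 2) * L ^ (σ / 4 + 1)) * (ε * l2 (q t) ^ 2 + P) ≤ B * (ε * N + P) := by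
    rw [hB]
    gcongr
  have h3 : κ * (3 * A * Q * L) ≤ 3 * A * |m| * Q := by
    calc _ = 3 * A * Q * (κ * L) := by ring
      _ ≤ 3 * A * Q * |m| := by gcongr
      _ = _ := by ring
  have h4 := mul_le_mul_of_nonneg_left (h1.trans (add_le_add_right h2 _)) hκ.le
  -- These three quantities are the surplus of the common constant over what each error term needs.
  have r1 : 0 ≤ (1 + B + κ * B) * Q := by positivity
  have r2 : 0 ≤ (1 + 3 * A * |m| + B) * P := by positivity
  have r3 : 0 ≤ (1 + 3 * A * |m| + κ * B) * (ε * (κ * N)) := by positivity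
  linarith
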